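/- **Setting.** Let $d\ge1$, $N\ge2$, $[N]=\{1,\dots,N\}$, $\mathcal X=[N]^d$. A model consists of random outputs $F(x,\xi_x)$, $x\in\mathcal X$, with objective $f(x)=\mathbb E[F(x,\xi_x)]$, and of random vectors $G(x,\eta_x)\in\mathbb R^d$, $x\in[1,N]^d$ (measurable in $x$ and the randomness). Let $\tilde f$ be the convex extension of $f$ to $[1,N]^d$: on the unit cube $y+[0,1]^d$, if $\alpha$ is a permutation with $(x-y)_{\alpha(1)}\ge\dots\ge(x-y)_{\alpha(d)}$ and $S^{x,i}=y+\sum_{j\le i}e_{\alpha(j)}$ $(0\le i\le d)$, then $\tilde f(x)=f(S^{x,0})+\sum_{i=1}^d[f(S^{x,i})-f(S^{x,i-1})](x-y)_{\alpha(i)}$. For $\sigma,\tilde\sigma>0$ and real $L,B$ let $\mathcal{MC}$ be the class of models such that * $f$ is $L^\natural$-convex: $f(x)+f(y)\ge f(\lceil (x+y)/2\rceil)+f(\lfloor (x+y)/2\rfloor)$ for $x,y\in\mathcal X$; * each $F(x,\xi_x)-f(x)$ is sub-Gaussian with parameter $\sigma^2$, i.e. its moment generating function is at most $e^{\sigma^2t^2/2}$;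 * $|f(x)-f(y)|\le L$ whenever $\|x-y\|_\infty\le1$; * for some minimizer $x^*$ of $f$, $\langle\mathbb E[G(x,\eta_x)],x-x^*\rangle\ge\tilde f(x)-\tilde f(x^*)$ for all $x\in[1,N]^d$; for each $x$ the components of $G(x,\eta_x)$ are independent and, after centering, sub-Gaussian with parameter $\tilde\sigma^2$; * for all $x\in[1,N]^d$ and $i$: $\mathbb E[G_i(x,\eta_x)]\ge-B$ if $x_i>1$, and $\mathbb E[G_i(x,\eta_x)]\le B$ if $x_i<N$. (With $B=L$ this is automatic if $\mathbb E[G(x,\eta_x)]$ is a subgradient of $\tilde f$ at $x$ relative to $[1,N]^d$.) For $c>0$, $\mathcal{MC}_c$ is the subclass where $f$ has a unique minimizer $x^*$ and $f(x)\ge f(x^*)+c$ for $x\ne x^*$. An algorithm sequentially and adaptively asks for independent replications of $F(x,\xi_x)$ (cost $1$) or $G(x,\eta_x)$ (cost $\gamma$), stops almost surely and returns a point of $\mathcal X$; its simulation cost is the total cost of its queries. It is $(\epsilon,\delta)$-PGS if, on every model of $\mathcal{MC}$, the returned $x$ satisfies $f(x)\le\min f+\epsilon$ with probability at least $1-\delta$;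 it is $(c,\delta)$-PCS-IZ if, on every model of $\mathcal{MC}_c$, it returns $x^*$ with probability at least $1-\delta$. $T(\epsilon,\delta,\mathcal{MC})$ and $T(\delta,\mathcal{MC}_c)$ denote the infimum over $(\epsilon,\delta)$-PGS, resp. $(c,\delta)$-PCS-IZ, algorithms of the supremum over the class of the expected simulation cost. **Algorithms.** SSGD on $\mathcal Y=\{y\in[1,N]^d:\|y-x^0\|_\infty\le D/2\}$ with parameters $(T,M,\eta)$: for $t<T$ put $x^{t+1}=\mathcal P_{\mathcal Y}\bigl(x^t-\eta\,\mathcal T_M(\hat g^t)\bigr)$, where $\hat g^t$ is a fresh replication of $G(x^t,\eta_{x^t})$, $\mathcal T_M$ truncates every component to $[-M,M]$ and $\mathcal P_{\mathcal Y}$ is the projection; return $\bar x=\frac1T\sum_{t<T}x^t$. For constants $\kappa,\theta>0$, a precision $\epsilon$ and a failing probability $\delta$, the parameters are $$T=\Bigl\lceil\kappa\tfrac{dD^2}{\epsilon^2}\log\tfrac1\delta\Bigr\rceil,\qquad M=\theta\sqrt{\log\tfrac{dDT}{\epsilon}},\qquad \eta=\frac{D}{M\sqrt T}.$$ Rounding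 of $\bar x$ with $(\epsilon,\delta)$: simulate each $S^{\bar x,0},\dots,S^{\bar x,d}$ $\lceil 32\sigma^2\epsilon^{-2}\log(8/\delta)\rceil$ times and return the one with the smallest empirical mean. *Algorithm 2* (projected and truncated SSGD): run SSGD from $x^0=(N/2,\dots,N/2)$ on $[1,N]^d$ ($D=N$) with the parameters for $(\epsilon,\delta)$; round with $(\epsilon,\delta)$. *Algorithm 3* (adaptive SSGD): let $E=\lceil\log_2N\rceil+1$ and $x_{-1}=(N/2,\dots,N/2)$. For $e=0,\dots,E-1$ run SSGD from $x_{e-1}$ with $D_e=2^{-e}N$ (so on $\{y\in[1,N]^d:\|y-x_{e-1}\|_\infty\le2^{-e-1}N\}$), with the parameters for precision $\epsilon_e=2^{-e}cN/4$ and failing probability $\delta/(2E)$, and let $x_e$ be its output; finally round $x_{E-1}$ with $(c/2,\delta)$. **Theorem.** For all $\sigma,\tilde\sigma>0$ there is $\kappa_0>0$ such that for all $\kappa\ge\kappa_0$ and $\theta>0$ there is a constant $C>0$, depending only on $\sigma,\tilde\sigma,\kappa,\theta$ (not on $d,N,\epsilon,\delta,c,\gamma,L,B$), such that for all $d\ge1$,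 $N\ge2$, $L$, $B$: 1. For every $\epsilon>0$ there is $\delta_0>0$ such that for all $\delta\in(0,\delta_0)$ and $\gamma\ge1$, Algorithm 2 is $(\epsilon,\delta)$-PGS on $\mathcal{MC}$, its simulation cost is almost surely at most $C\gamma dN^2\epsilon^{-2}\log(1/\delta)$ on every model of $\mathcal{MC}$, and $$T(\epsilon,\delta,\mathcal{MC})\le C\,\frac{\gamma dN^2}{\epsilon^2}\log\frac1\delta .$$ 2. For every $c>0$ there is $\delta_0>0$ such that for all $\delta\in(0,\delta_0)$ and $\gamma\ge1$, Algorithm 3 is $(c,\delta)$-PCS-IZ on $\mathcal{MC}_c$, its simulation cost is almost surely at most $C\gamma d\log(N)c^{-2}\log(1/\delta)$ on every model of $\mathcal{MC}_c$, and $$T(\delta,\mathcal{MC}_c)\le C\,\frac{\gamma d\log N}{c^2}\log\frac1\delta .$$ -/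

import Mathlib

open MeasureTheory ProbabilityTheory
open scoped NNReal ENNReal

universe u

noncomputable section

namespace ConvexSim

/-! ### The decision space and its convex hull -/

/-- The discrete decision space `[N]^d`, where `[N] = {1, …, N}`. -/
abbrev Grid (d N : ℕ) : Type := {x : Fin d → ℤ // ∀ i, 1 ≤ x i ∧ x i ≤ N}

/-- The solid cube `[1, N]^d`. -/
abbrev Cube (d N : ℕ) : Type := {x : Fin d → ℝ // ∀ i, 1 ≤ x i ∧ x i ≤ N}

/-- A grid point regarded as a point of the cube. -/
def Grid.toCube {d N : ℕ} (x : Grid d N) : Cube d N :=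
  ⟨fun i => (x.1 i : ℝ), fun i => by
    have h1 : (1 : ℝ) ≤ x.1 i := by exact_mod_cast (x.2 i).1
    have h2 : (x.1 i : ℝ) ≤ N := by exact_mod_cast (x.2 i).2
    exact ⟨h1, h2⟩⟩

/-- `⌈(x + y) / 2⌉`, componentwise. -/
def Grid.midCeil {d N : ℕ} (x y : Grid d N) : Grid d N :=
  ⟨fun i => ⌈((x.1 i : ℝ) + y.1 i) / 2⌉, fun i => by
    have hx1 : (1 : ℝ) ≤ x.1 i := by exact_mod_cast (x.2 i).1
    have hy1 : (1 : ℝ) ≤ y.1 i := by exact_mod_cast (y.2 i).1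
    have hx2 : (x.1 i : ℝ) ≤ N := by exact_mod_cast (x.2 i).2
    have hy2 : (y.1 i : ℝ) ≤ N := by exact_mod_cast (y.2 i).2
    constructor
    · rw [Int.le_ceil_iff]
      push_cast
      linarith
    · rw [Int.ceil_le]
      push_cast
      linarith⟩

/-- `⌊(x + y) / 2⌋`, componentwise. -/
def Grid.midFloor {d N : ℕ} (x y : Grid d N) : Grid d N :=
  ⟨fun i => ⌊((x.1 i : ℝ) + y.1 i) / 2⌋, fun i => by
    have hx1 : (1 : ℝ) ≤ x.1 i := by exact_mod_cast (x.2 i).1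
    have hy1 : (1 : ℝ) ≤ y.1 i := by exact_mod_cast (y.2 i).1
    have hx2 : (x.1 i : ℝ) ≤ N := by exact_mod_cast (x.2 i).2
    have hy2 : (y.1 i : ℝ) ≤ N := by exact_mod_cast (y.2 i).2
    constructor
    · rw [Int.le_floor]
      push_cast
      linarith
    · have h : (⌊((x.1 i : ℝ) + y.1 i) / 2⌋ : ℝ) ≤ N :=
        (Int.floor_le _).trans (by linarith)
      exact_mod_cast h⟩

/-- `L♮`-convexity on `[N]^d`: discrete midpoint convexity. -/
def LNatConvex {d N : ℕ} (f : Grid d N → ℝ) : Prop :=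
  ∀ x y : Grid d N, f (Grid.midCeil x y) + f (Grid.midFloor x y) ≤ f x + f y

/-! ### Consistent permutations, neighbouring points, convex extension -/

/-- The lower corner `y ∈ [N-1]^d` of a unit cube `y + [0,1]^d` containing `x`. -/
def corner {d N : ℕ} (x : Cube d N) (i : Fin d) : ℤ := min ⌊x.1 i⌋ ((N : ℤ) - 1)

/-- The local coordinates `x - y ∈ [0,1]^d` of `x` in its unit cube. -/
def localCoord {d N : ℕ} (x : Cube d N) (i : Fin d) : ℝ := x.1 i - corner x i

/-- A consistent permutation of `x`: it lists the local coordinates in nonincreasing order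
(ties are broken by the index). -/
def consistentPerm {d N : ℕ} (x : Cube d N) : Equiv.Perm (Fin d) :=
  Tuple.sort (fun i => -localCoord x i)

/-- The `k`-th neighbouring point `S^{x,k} = y + ∑_{j ≤ k} e_{α(j)}`, `0 ≤ k ≤ d`, where `α` is the
consistent permutation of `x`. With positions counted from `0`, the `i`-th unit vector is in the
sum exactly if `α⁻¹(i) < k`. -/
def neighbor {d N : ℕ} [hN : Fact (2 ≤ N)] (x : Cube d N) (k : ℕ) : Grid d N :=
  ⟨fun i => corner x i + if ((consistentPerm x).symm i : ℕ) < k then 1 else 0, fun i => by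
    have h2 : (2 : ℤ) ≤ N := by exact_mod_cast hN.out
    have h1 : (1 : ℤ) ≤ ⌊x.1 i⌋ := by
      rw [Int.le_floor]
      exact_mod_cast (x.2 i).1
    have h3 : 1 ≤ corner x i := le_min h1 (by omega)
    have h4 : corner x i ≤ (N : ℤ) - 1 := min_le_right _ _
    dsimp only
    split_ifs <;> constructor <;> omega⟩

/-- The convex extension of `f` to `[1, N]^d`: on each unit cube, the Lovász extension
`f(S^{x,0}) + ∑_{i=1}^d (f(S^{x,i}) - f(S^{x,i-1})) (x - y)_{α(i)}`. -/
def convexExtension {d N : ℕ} [Fact (2 ≤ N)] (f : Grid d N → ℝ) (x : Cube d N) : ℝ :=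
  f (neighbor x 0) +
    ∑ i : Fin d, (f (neighbor x (i + 1)) - f (neighbor x i)) * localCoord x (consistentPerm x i)

/-! ### Simulation models -/

/-- A simulation model on `[N]^d` with gradient information. `ξ x` is the law of the random object
`ξ_x` with values in `Y`, and `F (x, ξ_x)` is the simulation output at `x`; `η x` is the law of the
random object `η_x` with values in `Z`, and `G (x, η_x)` is the subgradient estimator at `x`. -/
structure SimModel (d N : ℕ) : Type (u + 1) where
  Y : Type u
  [mY : MeasurableSpace Y]
  ξ : Grid d N → Measure Y
  [prob_ξ : ∀ x, IsProbabilityMeasure (ξ x)]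
  F : Grid d N → Y → ℝ
  measurable_F : ∀ x, Measurable (F x)
  Z : Type u
  [mZ : MeasurableSpace Z]
  η : Kernel (Cube d N) Z
  [prob_η : IsMarkovKernel η]
  G : Cube d N → Z → Fin d → ℝ
  measurable_G : Measurable (Function.uncurry G)

attribute [instance] SimModel.mY SimModel.prob_ξ SimModel.mZ SimModel.prob_η

namespace SimModel

variable {d N : ℕ}

/-- The objective function `f(x) = 𝔼 F(x, ξ_x)`. -/
def f (M : SimModel.{u} d N) (x : Grid d N) : ℝ := ∫ y, M.F x y ∂(M.ξ x)

/-- The componentwise mean `𝔼 G(x, η_x)` of the subgradient estimator. -/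
def meanG (M : SimModel.{u} d N) (x : Cube d N) (i : Fin d) : ℝ := ∫ z, M.G x z i ∂(M.η x)

/-- Every simulation output is sub-Gaussian with parameter `σ²`. -/
def SubgaussianOutput (M : SimModel.{u} d N) (σ : ℝ≥0) : Prop :=
  ∀ x, HasSubgaussianMGF (fun y => M.F x y - M.f x) (σ ^ 2) (M.ξ x)

/-- The `ℓ∞`-Lipschitz constant of `f` is at most `L`. -/
def LipschitzObjective (M : SimModel.{u} d N) (L : ℝ) : Prop :=
  ∀ x y : Grid d N, (∀ i, |x.1 i - y.1 i| ≤ 1) → |M.f x - M.f y| ≤ L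

/-- `G` is a subgradient estimator without bias and correlation: its mean satisfies the subgradient
inequality of the convex extension towards a minimizer `x*` of `f`, and its components are mutually
independent and sub-Gaussian with parameter `τ²`. -/
def UnbiasedSubgradient [Fact (2 ≤ N)] (M : SimModel.{u} d N) (τ : ℝ≥0) : Prop :=
  (∃ xs : Grid d N, (∀ y, M.f xs ≤ M.f y) ∧
    ∀ x : Cube d N, convexExtension M.f x - convexExtension M.f xs.toCube ≤
      ∑ i, M.meanG x i * (x.1 i - xs.toCube.1 i)) ∧
  ∀ x : Cube d N,
    iIndepFun (fun i z => M.G x z i) (M.η x) ∧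
    ∀ i, HasSubgaussianMGF (fun z => M.G x z i - M.meanG x i) (τ ^ 2) (M.η x)

/-- The components of the mean of `G` are bounded by `B`, except that on a face of the cube the
component normal to that face may be arbitrarily large in the outward direction (as it may be for
a subgradient relative to the cube). -/
def MeanBound (M : SimModel.{u} d N) (B : ℝ) : Prop :=
  ∀ (x : Cube d N) (i : Fin d),
    (1 < x.1 i → -B ≤ M.meanG x i) ∧ (x.1 i < N → M.meanG x i ≤ B)

/-- `f` has a unique minimizer, at least `c` better than every other point. -/
def IndifferenceZone (M : SimModel.{u} d N) (c : ℝ) : Prop :=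
  ∃ xs : Grid d N, ∀ x, x ≠ xs → M.f xs + c ≤ M.f x

end SimModel

/-- The class `𝓜𝓒` of `L♮`-convex models satisfying the standing assumptions. -/
def modelsMC (d N : ℕ) [Fact (2 ≤ N)] (σ τ : ℝ≥0) (L B : ℝ) : Set (SimModel.{u} d N) :=
  {M | LNatConvex M.f ∧ M.SubgaussianOutput σ ∧ M.LipschitzObjective L ∧
    M.UnbiasedSubgradient τ ∧ M.MeanBound B}

/-- The subclass `𝓜𝓒_c` of models with indifference zone parameter `c`. -/
def modelsMCc (d N : ℕ) [Fact (2 ≤ N)] (σ τ : ℝ≥0) (L B c : ℝ) : Set (SimModel.{u} d N) :=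
  {M | M ∈ modelsMC d N σ τ L B ∧ M.IndifferenceZone c}

/-! ### Simulation algorithms and their cost -/

/-- A query: simulate `F(x, ξ_x)` at a grid point, or the subgradient estimator `G(x, η_x)` at a
point of the cube. -/
abbrev Query (d N : ℕ) : Type := Grid d N ⊕ Cube d N

/-- An observation: the value of `F`, or the value of `G`. -/
abbrev Obs (d : ℕ) : Type := ℝ ⊕ (Fin d → ℝ)

/-- The law of the answer to a query; each query is answered by a fresh independent replication. -/
def SimModel.response {d N : ℕ} (M : SimModel.{u} d N) : Query d N → Measure (Obs d)
  | .inl x => (M.ξ x).map (fun y => Sum.inl (M.F x y))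
  | .inr x => (M.η x).map (fun z => Sum.inr (M.G x z))

/-- The cost of a query, in units of one evaluation of `F`. -/
def queryCost {d N : ℕ} (γ : ℝ) : Query d N → ℝ
  | .inl _ => 1
  | .inr _ => γ

/-- A sequential procedure with input in `α` and output in `β`. The state holds what is remembered
of the history of observations (it may be the full history). In each state `act` either poses the
next query (sampling rule) or stops (stopping rule) with an output (recommendation rule); `next`
updates the state after an observation. -/
structure Procedure (d N : ℕ) (α β : Type) [MeasurableSpace α] [MeasurableSpace β] where
  State : Type
  [mState : MeasurableSpace State]
  init : α → State
  act : State → Query d N ⊕ β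
  next : State → Obs d → State
  measurable_init : Measurable init
  measurable_act : Measurable act
  measurable_next : Measurable (Function.uncurry next)

attribute [instance] Procedure.mState

namespace Procedure

variable {d N : ℕ} {α β δ : Type} [MeasurableSpace α] [MeasurableSpace β] [MeasurableSpace δ]

/-- One step from a state with accumulated cost: if the procedure stops, no mass is passed on. -/
def stepLaw (P : Procedure d N α β) (M : SimModel.{u} d N) (γ : ℝ) (s : P.State × ℝ) :
    Measure (P.State × ℝ) :=
  match P.act s.1 with
  | .inl q => (M.response q).map (fun o => (P.next s.1 o, s.2 + queryCost γ q))
  | .inr _ => 0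

/-- The law of the state and the accumulated cost after `n` queries, on the event that at least `n`
queries are made. -/
def runLaw (P : Procedure d N α β) (M : SimModel.{u} d N) (γ : ℝ) (a : α) :
    ℕ → Measure (P.State × ℝ)
  | 0 => Measure.dirac (P.init a, 0)
  | n + 1 => (P.runLaw M γ a n).bind (P.stepLaw M γ)

/-- If the procedure stops in the given state: the unit mass at its output and accumulated cost. -/
def stopLaw (P : Procedure d N α β) (s : P.State × ℝ) : Measure (β × ℝ) :=
  match P.act s.1 with
  | .inl _ => 0
  | .inr b => Measure.dirac (b, s.2)

/-- The joint law of the output and the total simulation cost, on the event that the procedure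
stops. -/
def outcomeLaw (P : Procedure d N α β) (M : SimModel.{u} d N) (γ : ℝ) (a : α) :
    Measure (β × ℝ) :=
  Measure.sum fun n => (P.runLaw M γ a n).bind P.stopLaw

/-- The procedure that returns `b` without any query. -/
def pure (b : β) : Procedure d N Unit β where
  State := Unit
  init := id
  act := fun _ => Sum.inr b
  next := fun s _ => s
  measurable_init := measurable_id
  measurable_act := measurable_const
  measurable_next := measurable_fst

/-- A function on a product whose first factor is a sum is measurable if both parts are. -/
theorem measurable_of_sum_prod {α' β' γ' δ' : Type*} [MeasurableSpace α'] [MeasurableSpace β']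
    [MeasurableSpace γ'] [MeasurableSpace δ'] {g : (α' ⊕ β') × γ' → δ'}
    (hl : Measurable fun p : α' × γ' => g (Sum.inl p.1, p.2))
    (hr : Measurable fun p : β' × γ' => g (Sum.inr p.1, p.2)) : Measurable g := by
  have h : Measurable (g ∘ (MeasurableEquiv.sumProdDistrib α' β' γ').symm) :=
    measurable_fun_sum hl hr
  have h2 := h.comp (MeasurableEquiv.sumProdDistrib α' β' γ').measurable
  convert h2 using 1
  funext x
  simp

/-- Run `P`, then run `Q` on its output. -/
def andThen (P : Procedure d N α β) (Q : Procedure d N β δ) : Procedure d N α δ where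
  State := P.State ⊕ Q.State
  init := fun a => Sum.inl (P.init a)
  act := Sum.elim (fun s => Sum.elim Sum.inl (fun b => Q.act (Q.init b)) (P.act s)) Q.act
  next := fun s o =>
    Sum.elim
      (fun s => Sum.elim (fun _ => Sum.inl (P.next s o))
        (fun b => Sum.inr (Q.next (Q.init b) o)) (P.act s))
      (fun s => Sum.inr (Q.next s o)) s
  measurable_init := measurable_inl.comp P.measurable_init
  measurable_act :=
    ((measurable_inl.sumElim (Q.measurable_act.comp Q.measurable_init)).comp
      P.measurable_act).sumElim Q.measurable_act
  measurable_next := by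
    apply measurable_of_sum_prod
    · have h : Measurable (fun p : (Query d N ⊕ β) × (P.State × Obs d) =>
          Sum.elim (fun _ => (Sum.inl (P.next p.2.1 p.2.2) : P.State ⊕ Q.State))
            (fun b => Sum.inr (Q.next (Q.init b) p.2.2)) p.1) := by
        apply measurable_of_sum_prod
        · exact measurable_inl.comp (P.measurable_next.comp measurable_snd)
        · exact measurable_inr.comp (Q.measurable_next.comp
            ((Q.measurable_init.comp measurable_fst).prodMk
              (measurable_snd.comp measurable_snd)))
      exact h.comp ((P.measurable_act.comp measurable_fst).prodMk measurable_id)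
    · exact measurable_inr.comp Q.measurable_next

end Procedure

/-- A simulation algorithm recommends a decision. -/
abbrev SimAlgorithm (d N : ℕ) : Type 1 := Procedure d N Unit (Grid d N)

/-- An optimality guarantee: a property of the joint law of recommendation and cost on a model. -/
abbrev Guarantee (d N : ℕ) : Type (u + 1) := SimModel.{u} d N → Measure (Grid d N × ℝ) → Prop

/-- `(ε, δ)`-PGS: with probability at least `1 - δ`, the recommended decision is `ε`-optimal. -/
def PGS {d N : ℕ} (ε δ : ℝ) : Guarantee.{u} d N := fun M out =>
  ENNReal.ofReal (1 - δ) ≤ out {p | ∀ y, M.f p.1 ≤ M.f y + ε}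

/-- `δ`-PCS-IZ: with probability at least `1 - δ`, the recommended decision is optimal. (It is used
on models with an indifference zone, for which the optimal decision is unique.) -/
def PCSIZ {d N : ℕ} (δ : ℝ) : Guarantee.{u} d N := fun M out =>
  ENNReal.ofReal (1 - δ) ≤ out {p | ∀ y, M.f p.1 ≤ M.f y}

/-- `A` is an `(𝒪, 𝓜)`-algorithm: on every model of the class it stops almost surely and its
recommendation satisfies the guarantee. -/
def IsAlgorithmFor {d N : ℕ} (O : Guarantee.{u} d N) (models : Set (SimModel.{u} d N)) (γ : ℝ)
    (A : SimAlgorithm d N) : Prop :=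
  ∀ M ∈ models, IsProbabilityMeasure (A.outcomeLaw M γ ()) ∧ O M (A.outcomeLaw M γ ())

/-- The expected simulation cost `T(𝒪, 𝓜) = inf_A sup_M 𝔼[cost]` over all
`(𝒪, 𝓜)`-algorithms `A` and all models `M ∈ 𝓜`. -/
def expectedSimulationCost {d N : ℕ} (O : Guarantee.{u} d N) (models : Set (SimModel.{u} d N))
    (γ : ℝ) : ℝ≥0∞ :=
  ⨅ (A : SimAlgorithm d N) (_ : IsAlgorithmFor O models γ A),
    ⨆ M ∈ models, ∫⁻ p, ENNReal.ofReal p.2 ∂(A.outcomeLaw M γ ())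

/-- The simulation cost of `A` is at most `C` almost surely, on every model of the class. -/
def CostAtMost {d N : ℕ} (models : Set (SimModel.{u} d N)) (γ : ℝ) (A : SimAlgorithm d N)
    (C : ℝ) : Prop :=
  ∀ M ∈ models, ∀ᵐ p ∂(A.outcomeLaw M γ ()), p.2 ≤ C

/-! ### Projection, truncation, argmin, and their measurability -/

theorem measurable_coord {d N : ℕ} (i : Fin d) : Measurable fun x : Cube d N => x.1 i :=
  (measurable_pi_apply i).comp measurable_subtype_coe

theorem measurable_corner {d N : ℕ} (i : Fin d) : Measurable fun x : Cube d N => corner x i :=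
  (Int.measurable_floor.comp (measurable_coord i)).min measurable_const

theorem measurable_localCoord {d N : ℕ} (i : Fin d) :
    Measurable fun x : Cube d N => localCoord x i := by
  have h : Measurable fun x : Cube d N => ((corner x i : ℤ) : ℝ) :=
    (measurable_from_top (f := fun z : ℤ => (z : ℝ))).comp (measurable_corner i)
  exact (measurable_coord i).sub h

theorem measurableSet_consistentPerm {d N : ℕ} (τ : Equiv.Perm (Fin d)) :
    MeasurableSet {x : Cube d N | consistentPerm x = τ} := by
  have h (i : Fin d) : Measurable fun x : Cube d N => -localCoord x i :=
    (measurable_localCoord i).neg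
  have : {x : Cube d N | consistentPerm x = τ} =
      {x | (∀ i j, i ≤ j → -localCoord x (τ i) ≤ -localCoord x (τ j)) ∧
        ∀ i j, i < j → -localCoord x (τ i) = -localCoord x (τ j) → τ i < τ j} := by
    ext x
    simp only [Set.mem_ofPred_eq, consistentPerm]
    rw [eq_comm, Tuple.eq_sort_iff]
    rfl
  rw [this, Set.ofPred_and]
  simp only [Set.ofPred_forall]
  refine MeasurableSet.inter ?_ ?_
  · exact MeasurableSet.iInter fun i => MeasurableSet.iInter fun j => MeasurableSet.iInter fun _ =>
      measurableSet_le (h _) (h _)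
  · refine MeasurableSet.iInter fun i => MeasurableSet.iInter fun j => MeasurableSet.iInter fun _ =>
      ?_
    by_cases hij : τ i < τ j
    · simp [hij]
    · simpa only [hij, imp_false, Set.compl_def] using! (measurableSet_eq_fun (h (τ i)) (h (τ j))).compl

section Tools

variable {d N : ℕ} [hN : Fact (2 ≤ N)]

/-- Componentwise projection of `v` onto `[1, N]^d`. -/
def clip (v : Fin d → ℝ) : Cube d N :=
  ⟨fun i => max 1 (min (N : ℝ) (v i)), fun i => by
    have h : (2 : ℝ) ≤ N := by exact_mod_cast hN.out
    exact ⟨le_max_left _ _, max_le (by linarith) (min_le_left _ _)⟩⟩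

/-- The orthogonal projection onto `𝒩(x, a) = {y ∈ [1, N]^d : ‖y - x‖_∞ ≤ a}`. -/
def projBox (x : Cube d N) (a : ℝ) (v : Fin d → ℝ) : Cube d N :=
  clip (fun i => max (x.1 i - a) (min (x.1 i + a) (v i)))

/-- Componentwise truncation `(g ∧ M) ∨ (-M)`. -/
def truncate (M : ℝ) (g : Fin d → ℝ) : Fin d → ℝ := fun i => max (min (g i) M) (-M)

/-- The index of a smallest entry (the first one). -/
def argminFin {n : ℕ} (v : Fin (n + 1) → ℝ) : Fin (n + 1) :=
  (Finset.univ.filter fun i => ∀ j, v i ≤ v j).min' <| by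
    obtain ⟨i, hi⟩ := Finite.exists_min v
    exact ⟨i, by simpa using hi⟩

theorem measurable_clip : Measurable (clip : (Fin d → ℝ) → Cube d N) := by
  unfold clip
  fun_prop

theorem measurable_projBox (a : ℝ) :
    Measurable fun p : Cube d N × (Fin d → ℝ) => projBox p.1 a p.2 := by
  refine measurable_clip.comp (measurable_pi_lambda _ fun i => ?_)
  have h1 : Measurable fun p : Cube d N × (Fin d → ℝ) => p.1.1 i :=
    (measurable_coord i).comp measurable_fst
  have h2 : Measurable fun p : Cube d N × (Fin d → ℝ) => p.2 i :=
    (measurable_pi_apply i).comp measurable_snd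
  exact (h1.sub_const a).max ((h1.add_const a).min h2)

theorem measurable_truncate (M : ℝ) : Measurable (truncate M : (Fin d → ℝ) → Fin d → ℝ) := by
  unfold truncate
  fun_prop

theorem argminFin_eq_iff {n : ℕ} (v : Fin (n + 1) → ℝ) (i : Fin (n + 1)) :
    argminFin v = i ↔ (∀ j, v i ≤ v j) ∧ ∀ k, (∀ j, v k ≤ v j) → i ≤ k := by
  unfold argminFin
  rw [Finset.min'_eq_iff]
  simp

theorem measurable_argminFin {n : ℕ} :
    Measurable (argminFin : (Fin (n + 1) → ℝ) → Fin (n + 1)) := by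
  have h (i : Fin (n + 1)) : MeasurableSet {v : Fin (n + 1) → ℝ | ∀ j, v i ≤ v j} := by
    rw [Set.ofPred_forall]
    exact MeasurableSet.iInter fun j =>
      measurableSet_le (measurable_pi_apply i) (measurable_pi_apply j)
  apply measurable_to_countable'
  intro i
  have : argminFin ⁻¹' {i} = {v : Fin (n + 1) → ℝ | ∀ j, v i ≤ v j} ∩
      ⋂ k, {v : Fin (n + 1) → ℝ | (∀ j, v k ≤ v j) → i ≤ k} := by
    ext v
    simp [argminFin_eq_iff]
  rw [this]
  refine (h i).inter (MeasurableSet.iInter fun k => ?_)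
  by_cases hk : i ≤ k
  · simp [hk]
  · simpa [hk, Set.compl_def] using (h k).compl

theorem measurable_neighbor (k : ℕ) : Measurable fun x : Cube d N => neighbor x k := by
  refine Measurable.subtype_mk (measurable_pi_lambda _ fun i => ?_)
  refine (measurable_corner i).add (Measurable.ite ?_ measurable_const measurable_const)
  have : {x : Cube d N | ((consistentPerm x).symm i : ℕ) < k} =
      ⋃ τ : Equiv.Perm (Fin d), {x : Cube d N | consistentPerm x = τ ∧ (τ.symm i : ℕ) < k} := by
    ext x
    simp
  rw [this]
  refine MeasurableSet.iUnion fun τ => ?_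
  by_cases hτ : (τ.symm i : ℕ) < k
  · simpa [hτ] using measurableSet_consistentPerm τ
  · simp [hτ]

theorem measurable_neighbor_comp {Ω : Type*} [MeasurableSpace Ω] {x : Ω → Cube d N} {k : Ω → ℕ}
    (hx : Measurable x) (hk : Measurable k) : Measurable fun ω => neighbor (x ω) (k ω) := by
  have h : Measurable fun p : ℕ × Cube d N => neighbor p.2 p.1 :=
    measurable_from_prod_countable_right fun k => measurable_neighbor k
  exact h.comp (hk.prodMk hx)

end Tools

/-! ### The algorithms -/

/-- The state update of the rounding procedure. -/
def roundNext {d N : ℕ} (s : ℕ × Cube d N × (Fin (d + 1) → ℝ)) (o : Obs d) :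
    ℕ × Cube d N × (Fin (d + 1) → ℝ) :=
  (s.1 + 1, s.2.1, fun j =>
    s.2.2 j + if (j : ℕ) = s.1 % (d + 1) then Sum.elim id (fun _ => 0) o else 0)

theorem measurable_roundNext {d N : ℕ} :
    Measurable (Function.uncurry (roundNext : ℕ × Cube d N × (Fin (d + 1) → ℝ) → _)) := by
  have h1 : Measurable fun p : (ℕ × Cube d N × (Fin (d + 1) → ℝ)) × Obs d => p.1.1 :=
    measurable_fst.comp measurable_fst
  have h2 : Measurable fun p : (ℕ × Cube d N × (Fin (d + 1) → ℝ)) × Obs d => p.1.2.1 :=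
    measurable_fst.comp (measurable_snd.comp measurable_fst)
  have h3 (j : Fin (d + 1)) :
      Measurable fun p : (ℕ × Cube d N × (Fin (d + 1) → ℝ)) × Obs d => p.1.2.2 j :=
    (measurable_pi_apply j).comp (measurable_snd.comp (measurable_snd.comp measurable_fst))
  have h4 : Measurable fun o : Obs d => (Sum.elim id (fun _ => 0) o : ℝ) :=
    measurable_id.sumElim measurable_const
  have h5 (j : Fin (d + 1)) : Measurable fun q : ℕ × Obs d =>
      if (j : ℕ) = q.1 % (d + 1) then (Sum.elim id (fun _ => 0) q.2 : ℝ) else 0 := by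
    refine measurable_from_prod_countable_right fun k => ?_
    by_cases hk : (j : ℕ) = k % (d + 1)
    · simp only [if_pos hk]
      exact h4
    · simp only [if_neg hk]
      exact measurable_const
  exact (h1.add_const 1).prodMk (h2.prodMk (measurable_pi_lambda _ fun j =>
    (h3 j).add ((h5 j).comp (h1.prodMk measurable_snd))))

section Algorithms

variable {d N : ℕ} [hN : Fact (2 ≤ N)]

/-- The projected and truncated stochastic subgradient method on the search space `𝒩(x⁰, a)`, where
`x⁰` is the input and starting point, with `T` iterations, truncation threshold `M` and step size
`step`: from `x^t` move to `x^{t+1} = 𝒫(x^t - step • 𝒯_M(G(x^t, η)))`. It returns the average of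
`x^0, …, x^{T-1}` (a point of the cube, so that `clip` does not change it). The state is
`(t, x⁰, x^t, x^0 + ⋯ + x^{t-1})`. -/
def ssgd (a : ℝ) (T : ℕ) (M step : ℝ) : Procedure d N (Cube d N) (Cube d N) where
  State := ℕ × Cube d N × Cube d N × (Fin d → ℝ)
  init := fun x₀ => (0, x₀, x₀, 0)
  act := fun s =>
    if s.1 < T then Sum.inl (Sum.inr s.2.2.1)
    else Sum.inr (clip fun i => s.2.2.2 i / T)
  next := fun s o =>
    let g : Fin d → ℝ := Sum.elim (fun _ => 0) id o
    (s.1 + 1, s.2.1, projBox s.2.1 a (fun i => s.2.2.1.1 i - step * truncate M g i),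
      fun i => s.2.2.2 i + s.2.2.1.1 i)
  measurable_init := by fun_prop
  measurable_act := by
    refine Measurable.ite (measurableSet_lt measurable_fst measurable_const) ?_ ?_
    · exact measurable_inl.comp (measurable_inr.comp
        (measurable_fst.comp (measurable_snd.comp measurable_snd)))
    · refine measurable_inr.comp (measurable_clip.comp ?_)
      fun_prop
  measurable_next := by
    have hg : Measurable fun p : (ℕ × Cube d N × Cube d N × (Fin d → ℝ)) × Obs d =>
        truncate M (Sum.elim (fun _ => 0) id p.2) :=
      (measurable_truncate M).comp
        ((measurable_const.sumElim measurable_id).comp measurable_snd)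
    have h1 : Measurable fun p : (ℕ × Cube d N × Cube d N × (Fin d → ℝ)) × Obs d => p.1.1 :=
      measurable_fst.comp measurable_fst
    have h2 : Measurable fun p : (ℕ × Cube d N × Cube d N × (Fin d → ℝ)) × Obs d => p.1.2.1 :=
      measurable_fst.comp (measurable_snd.comp measurable_fst)
    have h3 (i : Fin d) : Measurable fun p :
        (ℕ × Cube d N × Cube d N × (Fin d → ℝ)) × Obs d => p.1.2.2.1.1 i :=
      (measurable_coord i).comp (measurable_fst.comp
        (measurable_snd.comp (measurable_snd.comp measurable_fst)))
    have h4 (i : Fin d) : Measurable fun p :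
        (ℕ × Cube d N × Cube d N × (Fin d → ℝ)) × Obs d => p.1.2.2.2 i :=
      (measurable_pi_apply i).comp (measurable_snd.comp
        (measurable_snd.comp (measurable_snd.comp measurable_fst)))
    refine (h1.add_const 1).prodMk (h2.prodMk (Measurable.prodMk ?_ ?_))
    · exact (measurable_projBox a).comp (h2.prodMk (measurable_pi_lambda _ fun i =>
        (h3 i).sub (((measurable_pi_apply i).comp hg).const_mul step)))
    · exact measurable_pi_lambda _ fun i => (h4 i).add (h3 i)

/-- The decision rule of the rounding procedure in the state
`(number k of simulations so far, x, sums of the observations at S^0, …, S^d)`: as long as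
`k < (d + 1) n`, simulate `S^{k mod (d + 1)}`; then return the neighbouring point with the smallest
empirical mean. -/
def roundAct (n : ℕ) (s : ℕ × Cube d N × (Fin (d + 1) → ℝ)) : Query d N ⊕ Grid d N :=
  if s.1 < (d + 1) * n then Sum.inl (Sum.inl (neighbor s.2.1 (s.1 % (d + 1))))
  else Sum.inr (neighbor s.2.1 (argminFin fun j => s.2.2 j / n))

theorem measurable_roundAct (n : ℕ) : Measurable (roundAct n : _ → Query d N ⊕ Grid d N) := by
  have hk : Measurable fun k : ℕ => k % (d + 1) := Measurable.of_discrete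
  have hj : Measurable fun j : Fin (d + 1) => (j : ℕ) := Measurable.of_discrete
  have h2 : Measurable fun s : ℕ × Cube d N × (Fin (d + 1) → ℝ) => s.2.1 :=
    measurable_fst.comp measurable_snd
  have h3 : Measurable fun s : ℕ × Cube d N × (Fin (d + 1) → ℝ) => fun j => s.2.2 j / (n : ℝ) :=
    measurable_pi_lambda _ fun j =>
      ((measurable_pi_apply j).comp (measurable_snd.comp measurable_snd)).div_const _
  have h4 : Measurable fun s : ℕ × Cube d N × (Fin (d + 1) → ℝ) =>
      neighbor s.2.1 (s.1 % (d + 1)) :=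
    measurable_neighbor_comp h2 (hk.comp measurable_fst)
  have h5 : Measurable fun s : ℕ × Cube d N × (Fin (d + 1) → ℝ) =>
      neighbor s.2.1 (argminFin fun j => s.2.2 j / (n : ℝ)) :=
    measurable_neighbor_comp h2 (hj.comp (measurable_argminFin.comp h3))
  have h6 : MeasurableSet {s : ℕ × Cube d N × (Fin (d + 1) → ℝ) | s.1 < (d + 1) * n} :=
    measurableSet_lt measurable_fst measurable_const
  exact Measurable.ite h6 (measurable_inl.comp (measurable_inl.comp h4)) (measurable_inr.comp h5)

/-- The rounding procedure: simulate each of the neighbouring points `S^0, …, S^d` of the input `x`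
`n` times (in turn) and return the one with the smallest empirical mean. -/
def roundToGrid (n : ℕ) : Procedure d N (Cube d N) (Grid d N) where
  State := ℕ × Cube d N × (Fin (d + 1) → ℝ)
  init := fun x => (0, x, 0)
  act := roundAct n
  next := roundNext
  measurable_init := measurable_const.prodMk (measurable_id.prodMk measurable_const)
  measurable_act := measurable_roundAct n
  measurable_next := measurable_roundNext

/-- The starting point `(N/2, …, N/2)`. -/
def startPoint : Cube d N :=
  ⟨fun _ => (N : ℝ) / 2, fun _ => by
    have h : (2 : ℝ) ≤ N := by exact_mod_cast hN.out
    constructor <;> linarith⟩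

/-- The number of replications at which the two-sided Hoeffding confidence interval of level
`1 - δ/4` for a `σ²`-sub-Gaussian mean has half-width at most `ε/4`. -/
def roundSamples (σ : ℝ≥0) (ε δ : ℝ) : ℕ := ⌈32 * (σ : ℝ) ^ 2 / ε ^ 2 * Real.log (8 / δ)⌉₊

/-- The SSGD method for PGS: run SSGD on `[1, N]^d` (which is `𝒩((N/2)𝟏, N/2)`) from `(N/2)𝟏`,
then round. -/
def ssgdPGS (σ : ℝ≥0) (ε δ : ℝ) (T : ℕ) (M step : ℝ) : SimAlgorithm d N :=
  ((Procedure.pure startPoint).andThen (ssgd ((N : ℝ) / 2) T M step)).andThen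
    (roundToGrid (roundSamples σ ε δ))

/-- `T = ⌈κ · d D² / ε² · log(1/δ)⌉`, where `D` is the width of the search space. -/
def numIter (κ : ℝ) (d : ℕ) (D ε δ : ℝ) : ℕ :=
  ⌈κ * (d * D ^ 2 / ε ^ 2 * Real.log (1 / δ))⌉₊

/-- `M = θ · √(log(d D T / ε))`. -/
def truncThreshold (θ : ℝ) (d : ℕ) (D ε : ℝ) (T : ℕ) : ℝ := θ * √(Real.log (d * D * T / ε))

/-- `D / (M √T)`. -/
def stepSize (D M : ℝ) (T : ℕ) : ℝ := D / (M * √T)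

/-- The number of epochs `E = ⌈log₂ N⌉ + 1`. -/
def numEpochs (N : ℕ) : ℕ := Nat.clog 2 N + 1

/-- The first `m` epochs of the adaptive SSGD method. Epoch `e` runs SSGD for the precision
`ε_e = 2^{-e} c N / 4` and the failing probability `δ / (2E)` on `𝒴_e = 𝒩(x_{e-1}, 2^{-e-1} N)`, of
width `D_e = 2^{-e} N`, starting from the output `x_{e-1}` of the previous epoch. For `e = 0` the
starting point is `(N/2)𝟏`, so that `𝒴_0 = [1, N]^d`. -/
def adaptiveEpochs (κ θ c δ : ℝ) : ℕ → Procedure d N Unit (Cube d N)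
  | 0 => Procedure.pure startPoint
  | e + 1 =>
    let D : ℝ := (N : ℝ) / 2 ^ e
    let ε : ℝ := c * N / 4 / 2 ^ e
    let T : ℕ := numIter κ d D ε (δ / (2 * numEpochs N))
    let M : ℝ := truncThreshold θ d D ε T
    (adaptiveEpochs κ θ c δ e).andThen (ssgd (D / 2) T M (stepSize D M T))

/-- The adaptive SSGD method for PCS-IZ: all `E` epochs, then rounding with precision `c / 2`. -/
def adaptiveSSGD (σ : ℝ≥0) (κ θ c δ : ℝ) : SimAlgorithm d N :=
  (adaptiveEpochs κ θ c δ (numEpochs N)).andThen (roundToGrid (roundSamples σ (c / 2) δ))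

end Algorithms

end ConvexSim

end

open ConvexSim

namespace ConvexSim

/-! ### L♮-convexity, affine minorants and the convex extension -/

section Convexity

variable {d N : ℕ}

/-! The costs are deterministic counts (`Procedure.Bounded`), so the work lies in the failing
probabilities. Each of these is bounded by a nonnegative potential on states whose expectation does
not increase along a run (`Procedure.Triple`). Potentials can be glued along `andThen`, and the
failing probabilities of successive phases then add up.

Convexity: the affine function interpolating `f` at the neighbouring points of `x` lies below `f` on
the whole grid (`LNatConvex.nonneg_of_chain`, `LNatConvex.interp_le`). Hence the extension is
convex. An indifference zone makes `f` grow linearly away from its minimizer, since midpoints with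
the minimizer halve distances (`LNatConvex.sharp`); the extension inherits this growth
(`LNatConvex.sharp_convexExtension`).

SSGD: projection gives the usual one-step inequality for the squared distance to the minimizer
(`sum_sq_projBox_le`), which is exponentiated into a supermartingale (`ssgd_triple`). Truncation is
`1`-Lipschitz, so truncated components stay sub-Gaussian with twice the parameter
(`hasSubgaussianMGF_lipschitz_comp`), and the noise in the direction of the minimizer has variance
proxy at most `2 τ² d D²`, whatever the threshold. The threshold enters only the bias, which
vanishes as it grows (`SimModel.truncated_subgradient`), and the optimization error, of relative
size `√(log T / T)`. Both are absorbed once `T` is large, that is, for `δ` small in terms of all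
other data; this is why `L` and `B` do not enter the constants. What remains is `exp(-T ε² / (64 τ²
d D²))`, at most `δ / 2` if `κ ≥ 128 τ²`.

Rounding: some neighbouring point is at least as good as the extension, and Chernoff bounds with a
union over the `d + 1` candidates identify a good one (`round_triple`).

Adaptive method: by linear growth, precision `c D / 4` in value is localization in `ℓ∞`, so the box
can be halved (`adaptiveEpochs_triple`). Since `D_e / ε_e = 4 / c` in each epoch, all epochs take
equally many steps (`numIter_epoch`), and `N²` is replaced by the number of epochs, of order `log
N`. -/

theorem Grid.mid_add (x y : Grid d N) (i : Fin d) :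
    (Grid.midCeil x y).1 i + (Grid.midFloor x y).1 i = x.1 i + y.1 i ∧
      (Grid.midFloor x y).1 i ≤ (Grid.midCeil x y).1 i ∧
      (Grid.midCeil x y).1 i ≤ (Grid.midFloor x y).1 i + 1 := by
  have hc : (Grid.midCeil x y).1 i = (x.1 i + y.1 i + 1) / 2 := by
    change ⌈((x.1 i : ℝ) + y.1 i) / 2⌉ = _
    rw [Int.ceil_eq_iff]
    have h1 := Int.mul_ediv_add_emod (x.1 i + y.1 i + 1) 2
    have h2 : (x.1 i + y.1 i + 1) % 2 = 0 ∨ (x.1 i + y.1 i + 1) % 2 = 1 := by omega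
    have h3 : (2 * ((x.1 i + y.1 i + 1) / 2 : ℤ) : ℝ) + ((x.1 i + y.1 i + 1) % 2 : ℤ) =
        x.1 i + y.1 i + 1 := by exact_mod_cast h1
    rcases h2 with h | h <;> rw [h] at h3 <;> push_cast at h3 <;> constructor <;> linarith
  have hf : (Grid.midFloor x y).1 i = (x.1 i + y.1 i) / 2 := by
    change ⌊((x.1 i : ℝ) + y.1 i) / 2⌋ = _
    rw [Int.floor_eq_iff]
    have h1 := Int.mul_ediv_add_emod (x.1 i + y.1 i) 2
    have h2 : (x.1 i + y.1 i) % 2 = 0 ∨ (x.1 i + y.1 i) % 2 = 1 := by omega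
    have h3 : (2 * ((x.1 i + y.1 i) / 2 : ℤ) : ℝ) + ((x.1 i + y.1 i) % 2 : ℤ) =
        x.1 i + y.1 i := by exact_mod_cast h1
    rcases h2 with h | h <;> rw [h] at h3 <;> push_cast at h3 <;> constructor <;> linarith
  rw [hc, hf]
  omega

/-- Adding an affine function preserves `L♮`-convexity. -/
theorem LNatConvex.sub_affine {f : Grid d N → ℝ} (hf : LNatConvex f) (b : ℝ) (a : Fin d → ℝ) :
    LNatConvex fun p : Grid d N => f p - (b + ∑ i, a i * (p.1 i : ℝ)) := by
  intro x y
  have h := hf x y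
  have h2 : ∑ i, a i * ((Grid.midCeil x y).1 i : ℝ) + ∑ i, a i * ((Grid.midFloor x y).1 i : ℝ) =
      ∑ i, a i * (x.1 i : ℝ) + ∑ i, a i * (y.1 i : ℝ) := by
    rw [← Finset.sum_add_distrib, ← Finset.sum_add_distrib]
    refine Finset.sum_congr rfl fun i _ => ?_
    have := (Grid.mid_add x y i).1
    have : ((Grid.midCeil x y).1 i : ℝ) + (Grid.midFloor x y).1 i = x.1 i + y.1 i := by
      exact_mod_cast this
    rw [← mul_add, this, mul_add]
  linarith

/-- If an `L♮`-convex function vanishes on a maximal chain of a unit cube, it is nonnegative on the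
cube. -/
theorem LNatConvex.nonneg_of_chain_of_mem {g : Grid d N → ℝ} (hg : LNatConvex g)
    {y : Fin d → ℤ} {α : Equiv.Perm (Fin d)} {S : ℕ → Grid d N}
    (hS : ∀ k i, (S k).1 i = y i + if (α.symm i : ℕ) < k then 1 else 0)
    (h0 : ∀ k ≤ d, g (S k) = 0) (p : Grid d N) (hp : ∀ i, y i ≤ p.1 i ∧ p.1 i ≤ y i + 1) :
    0 ≤ g p := by
  have hmin (k : ℕ) (i : Fin d) : 1 ≤ min (p.1 i) ((S k).1 i) ∧ min (p.1 i) ((S k).1 i) ≤ N := by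
    have h1 := p.2 i
    have h2 := (S k).2 i
    omega
  -- Within one unit cube the rounded midpoints are join and meet. The meet of `A (k + 1)` and `S k`
  -- is `A k`, and their join is `S k` or `S (k + 1)`, where `g` vanishes; so nonnegativity climbs
  -- from `A 0 = S 0` to `A d = p`.
  let A : ℕ → Grid d N := fun k => ⟨fun i => min (p.1 i) ((S k).1 i), hmin k⟩
  have key : ∀ k ≤ d, 0 ≤ g (A k) := by
    intro k
    induction k with
    | zero =>
      intro _
      have : A 0 = S 0 := by
        apply Subtype.ext
        funext i
        have h1 := hS 0 i
        have h2 := hp i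
        simp only [A, not_lt_zero, if_false] at h1 ⊢
        omega
      rw [this, h0 0 (Nat.zero_le _)]
    | succ k ih =>
      intro hk
      have ih := ih (by omega)
      have hmid := hg (A (k + 1)) (S k)
      rw [h0 k (by omega)] at hmid
      have hfl : Grid.midFloor (A (k + 1)) (S k) = A k := by
        apply Subtype.ext
        funext i
        obtain ⟨h1, h2, h3⟩ := Grid.mid_add (A (k + 1)) (S k) i
        have h4 := hS k i
        have h5 := hS (k + 1) i
        have h6 := hp i
        simp only [A] at h1 h2 h3 ⊢
        split_ifs at h4 h5 <;> omega
      have hce : g (Grid.midCeil (A (k + 1)) (S k)) = 0 := by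
        by_cases hpk : p.1 (α ⟨k, by omega⟩) = y (α ⟨k, by omega⟩)
        · have : Grid.midCeil (A (k + 1)) (S k) = S k := by
            apply Subtype.ext
            funext i
            obtain ⟨h1, h2, h3⟩ := Grid.mid_add (A (k + 1)) (S k) i
            have h4 := hS k i
            have h5 := hS (k + 1) i
            have h6 := hp i
            by_cases hi : i = α ⟨k, by omega⟩
            · rw [hi] at h1 h2 h3 h4 h5 h6 ⊢
              simp only [A, Equiv.symm_apply_apply, lt_self_iff_false, if_false] at h1 h2 h3 h4 ⊢
              omega
            · have : (α.symm i : ℕ) ≠ k := by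
                intro h
                apply hi
                rw [← α.apply_symm_apply i]
                congr 1
                exact Fin.ext h
              simp only [A] at h1 h2 h3 ⊢
              split_ifs at h4 h5 <;> omega
          rw [this, h0 k (by omega)]
        · have : Grid.midCeil (A (k + 1)) (S k) = S (k + 1) := by
            apply Subtype.ext
            funext i
            obtain ⟨h1, h2, h3⟩ := Grid.mid_add (A (k + 1)) (S k) i
            have h4 := hS k i
            have h5 := hS (k + 1) i
            have h6 := hp i
            by_cases hi : i = α ⟨k, by omega⟩
            · rw [hi] at h1 h2 h3 h4 h5 h6 ⊢
              simp only [A, Equiv.symm_apply_apply, lt_self_iff_false, if_false,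
                Nat.lt_succ_self, if_true] at h1 h2 h3 h4 h5 ⊢
              omega
            · have : (α.symm i : ℕ) ≠ k := by
                intro h
                apply hi
                rw [← α.apply_symm_apply i]
                congr 1
                exact Fin.ext h
              simp only [A] at h1 h2 h3 ⊢
              split_ifs at h4 h5 <;> omega
          rw [this, h0 (k + 1) hk]
      rw [hfl, hce] at hmid
      linarith
  have hA : A d = p := by
    apply Subtype.ext
    funext i
    have h1 := hS d i
    have h2 := hp i
    rw [if_pos (α.symm i).2] at h1
    simp only [A]
    omega
  have := key d le_rfl
  rwa [hA] at this

/-- If an `L♮`-convex function vanishes on a maximal chain of a unit cube, it is nonnegative. -/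
theorem LNatConvex.nonneg_of_chain {g : Grid d N → ℝ} (hg : LNatConvex g)
    {y : Fin d → ℤ} {α : Equiv.Perm (Fin d)} {S : ℕ → Grid d N}
    (hS : ∀ k i, (S k).1 i = y i + if (α.symm i : ℕ) < k then 1 else 0)
    (h0 : ∀ k ≤ d, g (S k) = 0) (p : Grid d N) : 0 ≤ g p := by
  have hcube := hg.nonneg_of_chain_of_mem hS h0
  have hS0 (i : Fin d) : (S 0).1 i = y i := by simp [hS]
  have hSd (i : Fin d) : (S d).1 i = y i + 1 := by simp [hS]
  -- The opposite cube at `y`: both midpoints with the top vertex `y + 1` fall back into the cube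
  -- already treated.
  have hlow (q : Grid d N) (hq : ∀ i, y i - 1 ≤ q.1 i ∧ q.1 i ≤ y i) : 0 ≤ g q := by
    have hmid := hg q (S d)
    rw [h0 d le_rfl, add_zero] at hmid
    have h1 : 0 ≤ g (Grid.midCeil q (S d)) := hcube _ fun i => by
      have := Grid.mid_add q (S d) i
      have := hSd i
      have := hq i
      omega
    have h2 : 0 ≤ g (Grid.midFloor q (S d)) := hcube _ fun i => by
      have := Grid.mid_add q (S d) i
      have := hSd i
      have := hq i
      omega
    linarith
  -- Midpoints with `S 0 = y` are within `⌈m / 2⌉` of `y`, which is less than `m` only for `m ≥ 2`.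
  -- At distance one the upper midpoint is in the cube above `y` and the lower one in the cube
  -- below.
  have key : ∀ m : ℕ, ∀ q : Grid d N, (∀ i, |q.1 i - y i| ≤ m) → 0 ≤ g q := by
    intro m
    induction m using Nat.strong_induction_on with
    | _ m ih =>
      intro q hq
      have hmid := hg q (S 0)
      rw [h0 0 (Nat.zero_le _), add_zero] at hmid
      by_cases hm : m ≤ 1
      · have h1 : 0 ≤ g (Grid.midCeil q (S 0)) := hcube _ fun i => by
          have := Grid.mid_add q (S 0) i
          have := hS0 i
          have := abs_le.1 (hq i)
          omega
        have h2 : 0 ≤ g (Grid.midFloor q (S 0)) := hlow _ fun i => by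
          have := Grid.mid_add q (S 0) i
          have := hS0 i
          have := abs_le.1 (hq i)
          omega
        linarith
      · have h1 : 0 ≤ g (Grid.midCeil q (S 0)) := ih (m - 1) (by omega) _ fun i => by
          have := Grid.mid_add q (S 0) i
          have := hS0 i
          have := abs_le.1 (hq i)
          rw [abs_le]
          omega
        have h2 : 0 ≤ g (Grid.midFloor q (S 0)) := ih (m - 1) (by omega) _ fun i => by
          have := Grid.mid_add q (S 0) i
          have := hS0 i
          have := abs_le.1 (hq i)
          rw [abs_le]
          omega
        linarith
  refine key (∑ i, (p.1 i - y i).natAbs) p fun i => ?_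
  have := Finset.single_le_sum (f := fun i => (p.1 i - y i).natAbs) (fun _ _ => Nat.zero_le _)
    (Finset.mem_univ i)
  rw [Int.abs_eq_natAbs]
  exact_mod_cast this

theorem localCoord_mem (x : Cube d N) (i : Fin d) : 0 ≤ localCoord x i ∧ localCoord x i ≤ 1 := by
  have hx := x.2 i
  have h1 := Int.floor_le (x.1 i)
  have h2 := Int.lt_floor_add_one (x.1 i)
  unfold localCoord corner
  rcases le_total ⌊x.1 i⌋ ((N : ℤ) - 1) with h | h
  · rw [min_eq_left h]
    constructor <;> linarith
  · rw [min_eq_right h]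
    have h3 : (((N : ℤ) - 1 : ℤ) : ℝ) ≤ ⌊x.1 i⌋ := by exact_mod_cast h
    push_cast at h3 ⊢
    constructor <;> linarith

theorem localCoord_antitone (x : Cube d N) {j k : Fin d} (h : j ≤ k) :
    localCoord x (consistentPerm x k) ≤ localCoord x (consistentPerm x j) := by
  have := Tuple.monotone_sort (fun i => -localCoord x i) h
  simpa [consistentPerm] using this

/-- An `L♮`-convex function with an indifference zone grows linearly away from its minimizer. -/
theorem LNatConvex.sharp {f : Grid d N → ℝ} (hf : LNatConvex f) {xs : Grid d N} {c : ℝ}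
    (hc : 0 ≤ c) (hxs : ∀ x, x ≠ xs → f xs + c ≤ f x) (p : Grid d N) (i : Fin d) :
    f xs + c * |(p.1 i : ℝ) - xs.1 i| ≤ f p := by
  have key : ∀ m : ℕ, ∀ q : Grid d N, (∀ i, |q.1 i - xs.1 i| ≤ m) →
      ∀ i, f xs + c * |(q.1 i : ℝ) - xs.1 i| ≤ f q := by
    intro m
    induction m using Nat.strong_induction_on with
    | _ m ih =>
      intro q hq i
      by_cases hm : m ≤ 1
      · by_cases hqx : q = xs
        · simp [hqx]
        · have h1 : |(q.1 i : ℝ) - xs.1 i| ≤ 1 := by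
            have : |q.1 i - xs.1 i| ≤ 1 := (hq i).trans (by exact_mod_cast hm)
            exact_mod_cast this
          have := hxs q hqx
          nlinarith
      -- Both midpoints with `xs` are closer to it, and their deviations from `xs` in coordinate `i`
      -- sum to that of `q`; adding the two induction hypotheses gives the claim.
      · have hmid := hf q xs
        have h1 := ih (m - 1) (by omega) (Grid.midCeil q xs) (fun i => by
          have := Grid.mid_add q xs i
          have := abs_le.1 (hq i)
          rw [abs_le]
          omega) i
        have h2 := ih (m - 1) (by omega) (Grid.midFloor q xs) (fun i => by
          have := Grid.mid_add q xs i
          have := abs_le.1 (hq i)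
          rw [abs_le]
          omega) i
        have h3 : ((Grid.midCeil q xs).1 i : ℝ) + (Grid.midFloor q xs).1 i = q.1 i + xs.1 i := by
          exact_mod_cast (Grid.mid_add q xs i).1
        have h4 := abs_add_le (((Grid.midCeil q xs).1 i : ℝ) - xs.1 i)
          ((Grid.midFloor q xs).1 i - xs.1 i)
        have h5 : ((Grid.midCeil q xs).1 i : ℝ) - xs.1 i + ((Grid.midFloor q xs).1 i - xs.1 i) =
          q.1 i - xs.1 i := by linarith
        rw [h5] at h4
        nlinarith
  refine key N p (fun i => ?_) i
  have h1 := p.2 i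
  have h2 := xs.2 i
  rw [abs_le]
  omega

/-- A bound for the increments to neighbouring points bounds the range. -/
theorem sub_le_of_lipschitz {f : Grid d N → ℝ} {L : ℝ}
    (hL : ∀ x y : Grid d N, (∀ i, |x.1 i - y.1 i| ≤ 1) → |f x - f y| ≤ L) (p q : Grid d N) :
    f p - f q ≤ N * L := by
  have key : ∀ m : ℕ, ∀ p : Grid d N, (∀ i, |p.1 i - q.1 i| ≤ m) → f p - f q ≤ m * L := by
    intro m
    induction m with
    | zero =>
      intro p hp
      have : p = q := by
        apply Subtype.ext
        funext i
        have := abs_le.1 (hp i)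
        omega
      simp [this]
    | succ m ih =>
      intro p hp
      -- `r` is `p` clamped to the `ℓ∞` ball of radius `m` about `q`, hence one step from `p`.
      let r : Grid d N := ⟨fun i => max (q.1 i - m) (min (q.1 i + m) (p.1 i)), fun i => by
        have h1 := p.2 i
        have h2 := q.2 i
        dsimp only
        omega⟩
      have h1 := ih r (fun i => by
        rw [abs_le]
        simp only [r]
        omega)
      have h2 := hL p r (fun i => by
        have := abs_le.1 (hp i)
        rw [abs_le]
        have := hp i
        simp only [r]
        omega)
      have h3 := le_abs_self (f p - f r)
      push_cast
      linarith
  refine key N p (fun i => ?_)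
  have h1 := p.2 i
  have h2 := q.2 i
  rw [abs_le]
  omega

variable [hN : Fact (2 ≤ N)]

theorem neighbor_apply (x : Cube d N) (k : ℕ) (i : Fin d) : (neighbor x k).1 i =
    corner x i + if ((consistentPerm x).symm i : ℕ) < k then 1 else 0 := rfl

/-- The affine function that interpolates `f` at the neighbouring points of `x`. -/
noncomputable def interp (f : Grid d N → ℝ) (x : Cube d N) (z : Fin d → ℝ) : ℝ :=
  f (neighbor x 0) + ∑ i : Fin d, (f (neighbor x (i + 1)) - f (neighbor x i)) *
    (z (consistentPerm x i) - corner x (consistentPerm x i))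

theorem interp_self (f : Grid d N → ℝ) (x : Cube d N) : interp f x x.1 = convexExtension f x := rfl

theorem interp_eq_affine (f : Grid d N → ℝ) (x : Cube d N) : ∃ (b : ℝ) (a : Fin d → ℝ),
    ∀ z, interp f x z = b + ∑ i, a i * z i := by
  refine ⟨f (neighbor x 0) + ∑ i : Fin d, (f (neighbor x (i + 1)) - f (neighbor x i)) *
    (- corner x (consistentPerm x i)), fun i => f (neighbor x ((consistentPerm x).symm i + 1)) -
      f (neighbor x ((consistentPerm x).symm i)), fun z => ?_⟩
  rw [← Equiv.sum_comp (consistentPerm x) (fun i => _ * z i), add_assoc,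
    ← Finset.sum_add_distrib]
  unfold interp
  congr 1
  refine Finset.sum_congr rfl fun i _ => ?_
  simp only [Equiv.symm_apply_apply]
  ring

/-- At `S^{x,k}` the sorted local coordinates are `k` ones followed by zeros, so the sum telescopes.
-/
theorem interp_neighbor (f : Grid d N → ℝ) (x : Cube d N) {k : ℕ} (hk : k ≤ d) :
    interp f x (fun i => ((neighbor x k).1 i : ℝ)) = f (neighbor x k) := by
  unfold interp
  have : ∀ i : Fin d, (f (neighbor x (i + 1)) - f (neighbor x i)) *
      (((neighbor x k).1 (consistentPerm x i) : ℝ) - corner x (consistentPerm x i)) =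
      (fun j : ℕ => if j < k then f (neighbor x (j + 1)) - f (neighbor x j) else 0) i := by
    intro i
    rw [neighbor_apply, Equiv.symm_apply_apply]
    by_cases h : (i : ℕ) < k <;> simp [h]
  rw [Finset.sum_congr rfl fun i _ => this i, Fin.sum_univ_eq_sum_range
    (fun j : ℕ => if j < k then f (neighbor x (j + 1)) - f (neighbor x j) else 0),
    ← Finset.sum_filter]
  have h2 : (Finset.range d).filter (· < k) = Finset.range k := by
    ext j
    simp
    omega
  rw [h2, Finset.sum_range_sub (fun j => f (neighbor x j))]
  ring

/-- The interpolating affine function is a global minorant of an `L♮`-convex function. -/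
theorem LNatConvex.interp_le {f : Grid d N → ℝ} (hf : LNatConvex f) (x : Cube d N)
    (p : Grid d N) : interp f x p.toCube.1 ≤ f p := by
  obtain ⟨b, a, h⟩ := interp_eq_affine f x
  have h1 := (hf.sub_affine b a).nonneg_of_chain (neighbor_apply x) (fun k hk => by
    have := interp_neighbor f x hk
    rw [h] at this
    linarith) p
  rw [h]
  exact sub_nonneg.1 h1

/-- The weights of a point of the cube as a convex combination of its neighbouring points. -/
theorem exists_weights (x : Cube d N) : ∃ w : ℕ → ℝ, (∀ k, 0 ≤ w k) ∧
    ∑ k ∈ Finset.range (d + 1), w k = 1 ∧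
    ∀ f : Grid d N → ℝ, convexExtension f x = ∑ k ∈ Finset.range (d + 1), w k * f (neighbor x k) := by
  -- The sorted local coordinates, padded by `1` in front and `0` behind. Their successive
  -- differences are the weights; the formula for the extension follows by Abel summation.
  let u : ℕ → ℝ := fun k => if k = 0 then 1 else
    if h : k - 1 < d then localCoord x (consistentPerm x ⟨k - 1, h⟩) else 0
  have hu : ∀ k, u (k + 1) ≤ u k := by
    intro k
    rcases Nat.eq_zero_or_pos k with rfl | hk
    · simp only [u]
      split_ifs <;> first | exact (localCoord_mem _ _).2 | simp_all
    · simp only [u, Nat.add_sub_cancel, Nat.add_eq_zero_iff, one_ne_zero, and_false, if_false,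
        hk.ne']
      split_ifs with h1 h2 h2
      · exact localCoord_antitone x (by simp [Fin.le_def])
      · omega
      · exact (localCoord_mem _ _).1
      · exact le_rfl
  have hd : u (d + 1) = 0 := by simp [u]
  have habel : ∀ (a : ℕ → ℝ) (n : ℕ), ∑ k ∈ Finset.range (n + 1), (u k - u (k + 1)) * a k =
      u 0 * a 0 + ∑ k ∈ Finset.range n, (a (k + 1) - a k) * u (k + 1) - u (n + 1) * a n := by
    intro a n
    induction n with
    | zero => simp; ring
    | succ n ih => rw [Finset.sum_range_succ, ih, Finset.sum_range_succ]; ring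
  refine ⟨fun k => u k - u (k + 1), fun k => sub_nonneg.2 (hu k), ?_, fun f => ?_⟩
  · rw [Finset.sum_range_sub', hd]
    simp [u]
  · rw [habel (fun k => f (neighbor x k)) d, hd]
    unfold convexExtension
    have : ∀ i : Fin d, localCoord x (consistentPerm x i) = u (i + 1) := by
      intro i
      simp [u]
    simp_rw [this]
    rw [Fin.sum_univ_eq_sum_range
      (fun k => (f (neighbor x (k + 1)) - f (neighbor x k)) * u (k + 1))]
    simp [u]

/-- The increment along the `j`-th edge of the chain is the coefficient of the `j`-th sorted
coordinate. Together with `convexExtension_mono` this carries affine minorants from the grid to the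
cube. -/
theorem convexExtension_const_add_linear (b : ℝ) (a : Fin d → ℝ) (x : Cube d N) :
    convexExtension (fun p : Grid d N => b + ∑ i, a i * (p.1 i : ℝ)) x = b + ∑ i, a i * x.1 i := by
  have h : ∀ k i, ((neighbor x k).1 i : ℝ) = corner x i +
      if ((consistentPerm x).symm i : ℕ) < k then 1 else 0 := by
    intro k i
    rw [neighbor_apply]
    push_cast
    rfl
  unfold convexExtension
  have h1 : ∀ j : Fin d, (b + ∑ i, a i * ((neighbor x (j + 1)).1 i : ℝ)) -
      (b + ∑ i, a i * ((neighbor x j).1 i : ℝ)) = a (consistentPerm x j) := by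
    intro j
    rw [add_sub_add_left_eq_sub, ← Finset.sum_sub_distrib,
      Finset.sum_eq_single (consistentPerm x j)]
    · rw [h, h, Equiv.symm_apply_apply]
      simp [mul_add]
    · intro i _ hi
      have : ((consistentPerm x).symm i : ℕ) ≠ j := by
        intro h'
        apply hi
        rw [← (consistentPerm x).apply_symm_apply i]
        congr 1
        exact Fin.ext h'
      rw [h, h]
      have h2 : ((consistentPerm x).symm i : ℕ) < j + 1 ↔ ((consistentPerm x).symm i : ℕ) < j := by
        omega
      simp [h2]
    · simp
  simp_rw [h1]
  rw [Equiv.sum_comp (consistentPerm x) (fun i => a i * localCoord x i), add_assoc,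
    ← Finset.sum_add_distrib]
  congr 1
  refine Finset.sum_congr rfl fun i _ => ?_
  rw [h]
  simp [localCoord]
  ring

theorem convexExtension_mono {f g : Grid d N → ℝ} (h : ∀ p, f p ≤ g p) (x : Cube d N) :
    convexExtension f x ≤ convexExtension g x := by
  obtain ⟨w, hw, -, hf⟩ := exists_weights x
  rw [hf, hf]
  exact Finset.sum_le_sum fun k _ => mul_le_mul_of_nonneg_left (h _) (hw k)

/-- The interpolating affine function is a global minorant of the convex extension. -/
theorem LNatConvex.interp_le_convexExtension {f : Grid d N → ℝ} (hf : LNatConvex f)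
    (x z : Cube d N) : interp f x z.1 ≤ convexExtension f z := by
  obtain ⟨b, a, h⟩ := interp_eq_affine f x
  rw [h, ← convexExtension_const_add_linear]
  refine convexExtension_mono (fun p => ?_) z
  have := hf.interp_le x p
  rwa [h] at this

/-- The convex extension of an `L♮`-convex function satisfies the two-point Jensen inequality. -/
theorem LNatConvex.convexExtension_convex {f : Grid d N → ℝ} (hf : LNatConvex f)
    {x y z : Cube d N} {s t : ℝ} (hs : 0 ≤ s) (ht : 0 ≤ t) (hst : s + t = 1)
    (hz : ∀ i, z.1 i = s * x.1 i + t * y.1 i) :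
    convexExtension f z ≤ s * convexExtension f x + t * convexExtension f y := by
  -- The interpolant at `z` supports the extension there: it agrees with it at `z` and lies below it
  -- at `x` and `y`.
  obtain ⟨b, a, h⟩ := interp_eq_affine f z
  have hx := mul_le_mul_of_nonneg_left (hf.interp_le_convexExtension z x) hs
  have hy := mul_le_mul_of_nonneg_left (hf.interp_le_convexExtension z y) ht
  rw [← interp_self]
  have : interp f z z.1 = s * interp f z x.1 + t * interp f z y.1 := by
    simp only [h, hz, mul_add, Finset.sum_add_distrib, Finset.mul_sum]
    have h2 : ∀ i, a i * (s * x.1 i) = s * (a i * x.1 i) := fun i => by ring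
    have h3 : ∀ i, a i * (t * y.1 i) = t * (a i * y.1 i) := fun i => by ring
    simp_rw [h2, h3]
    linear_combination -b * hst
  linarith

/-- Only this half of the equality is needed: it replaces the extension at the minimizer by `f` in
the subgradient inequality. -/
theorem LNatConvex.convexExtension_toCube_le {f : Grid d N → ℝ} (hf : LNatConvex f)
    (p : Grid d N) : convexExtension f p.toCube ≤ f p := by
  rw [← interp_self]
  exact hf.interp_le _ p

theorem convexExtension_le_of_le {f : Grid d N → ℝ} {b : ℝ} (h : ∀ p, f p ≤ b) (x : Cube d N) :
    convexExtension f x ≤ b := by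
  have h1 := convexExtension_mono (g := fun p : Grid d N => b + ∑ i, (0 : Fin d → ℝ) i * (p.1 i : ℝ))
    (fun p => by simpa using h p) x
  rw [convexExtension_const_add_linear] at h1
  simpa using h1

/-- A convex combination is at least its smallest entry. Hence exact rounding loses nothing. -/
theorem exists_neighbor_le (f : Grid d N → ℝ) (x : Cube d N) :
    ∃ k ≤ d, f (neighbor x k) ≤ convexExtension f x := by
  obtain ⟨w, hw, hw1, hf⟩ := exists_weights x
  by_contra! h
  have hpos : ∃ k ∈ Finset.range (d + 1), 0 < w k := by
    by_contra! h'
    have := Finset.sum_nonpos h'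
    linarith
  obtain ⟨k, hk, hk'⟩ := hpos
  have h2 : ∑ k ∈ Finset.range (d + 1), w k * convexExtension f x <
      ∑ k ∈ Finset.range (d + 1), w k * f (neighbor x k) := by
    refine Finset.sum_lt_sum (fun j hj => mul_le_mul_of_nonneg_left
      (h j (by simpa [Nat.lt_succ_iff] using hj)).le (hw j)) ⟨k, hk, ?_⟩
    exact mul_lt_mul_of_pos_left (h k (by simpa [Nat.lt_succ_iff] using hk)) hk'
  rw [← Finset.sum_mul, hw1, ← hf, one_mul] at h2
  exact lt_irrefl _ h2

/-- The absolute value is a maximum of linear functions of slope `s` with `|s| ≤ c`. Each of them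
yields an affine minorant of `f` by `LNatConvex.sharp`, hence one of the extension; the slopes `c`
and `-c` suffice. This turns precision in value into localization. -/
theorem LNatConvex.sharp_convexExtension {f : Grid d N → ℝ} (hf : LNatConvex f) {xs : Grid d N}
    {c : ℝ} (hc : 0 ≤ c) (hxs : ∀ x, x ≠ xs → f xs + c ≤ f x) (x : Cube d N) (i : Fin d) :
    f xs + c * |x.1 i - xs.1 i| ≤ convexExtension f x := by
  have key : ∀ s : ℝ, |s| ≤ c → f xs + s * (x.1 i - xs.1 i) ≤ convexExtension f x := by
    intro s hs
    have h1 := convexExtension_mono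
      (f := fun p : Grid d N => (f xs - s * xs.1 i) + ∑ j, (Pi.single i s : Fin d → ℝ) j * (p.1 j : ℝ))
      (g := f) (fun p => by
        have h2 := hf.sharp hc hxs p i
        simp only [Pi.single_apply, ite_mul, zero_mul, Finset.sum_ite_eq', Finset.mem_univ, if_true]
        have h3 : s * ((p.1 i : ℝ) - xs.1 i) ≤ c * |(p.1 i : ℝ) - xs.1 i| := by
          refine (le_abs_self _).trans ?_
          rw [abs_mul]
          exact mul_le_mul_of_nonneg_right hs (abs_nonneg _)
        linarith) x
    rw [convexExtension_const_add_linear] at h1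
    simp only [Pi.single_apply, ite_mul, zero_mul, Finset.sum_ite_eq', Finset.mem_univ, if_true] at h1
    linarith
  rcases abs_cases (x.1 i - xs.1 i) with ⟨h, -⟩ | ⟨h, -⟩ <;> rw [h]
  · exact key c (by rw [abs_of_nonneg hc])
  · have := key (-c) (by rw [abs_neg, abs_of_nonneg hc])
    linarith

end Convexity

/-! ### Potentials for runs of procedures: expectation bounds, termination, cost -/

section Semantics

theorem measurable_kernel_map {A Ω B : Type*} [MeasurableSpace A] [MeasurableSpace Ω]
    [MeasurableSpace B] (κ : Kernel A Ω) [IsSFiniteKernel κ] {f : A → Ω → B}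
    (hf : Measurable (Function.uncurry f)) : Measurable fun a => (κ a).map (f a) := by
  refine Measure.measurable_of_measurable_coe _ fun s hs => ?_
  have h : ∀ a, (κ a).map (f a) s = κ a (Prod.mk a ⁻¹' (Function.uncurry f ⁻¹' s)) := fun a => by
    rw [Measure.map_apply hf.of_uncurry_left hs]
    rfl
  simp_rw [h]
  exact Kernel.measurable_kernel_prodMk_left (hf hs)

/-- Holds for nonmeasurable `f`, as the integral is a supremum over simple functions below `f`. Such
one-sided rules let the potentials in `Procedure.Triple` be arbitrary functions. -/
theorem lintegral_dirac_le {A : Type*} [MeasurableSpace A] (a : A) (f : A → ℝ≥0∞) :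
    ∫⁻ x, f x ∂(Measure.dirac a) ≤ f a := by
  rw [lintegral]
  refine iSup₂_le fun g hg => ?_
  rw [← SimpleFunc.lintegral_eq_lintegral, lintegral_dirac' _ g.measurable]
  exact hg a

variable {d N : ℕ}

theorem SimModel.measurable_response (M : SimModel.{u} d N) : Measurable M.response := by
  have h1 : Measurable fun x => M.response (Sum.inl x) := Measurable.of_discrete
  have h2 : Measurable fun x => M.response (Sum.inr x) :=
    measurable_kernel_map M.η (measurable_inr.comp M.measurable_G)
  exact measurable_fun_sum h1 h2

/-- The answers to the queries as a Markov kernel. -/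
noncomputable def SimModel.responseKernel (M : SimModel.{u} d N) : Kernel (Query d N) (Obs d) :=
  ⟨M.response, M.measurable_response⟩

theorem SimModel.measurable_G_apply (M : SimModel.{u} d N) (x : Cube d N) : Measurable (M.G x) :=
  M.measurable_G.of_uncurry_left

instance SimModel.isProbabilityMeasure_response (M : SimModel.{u} d N) (q : Query d N) :
    IsProbabilityMeasure (M.response q) := by
  cases q with
  | inl x =>
    exact Measure.isProbabilityMeasure_map (μ := M.ξ x) (f := fun y => Sum.inl (M.F x y))
      (measurable_inl.comp (M.measurable_F x)).aemeasurable
  | inr x =>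
    exact Measure.isProbabilityMeasure_map (μ := M.η x) (f := fun z => Sum.inr (M.G x z))
      (measurable_inr.comp (M.measurable_G_apply x)).aemeasurable

instance (M : SimModel.{u} d N) : IsMarkovKernel M.responseKernel :=
  ⟨fun q => M.isProbabilityMeasure_response q⟩

theorem measurable_queryCost (γ : ℝ) : Measurable (queryCost γ : Query d N → ℝ) := by
  have h : (queryCost γ : Query d N → ℝ) = Sum.elim (fun _ => 1) (fun _ => γ) := by
    funext q
    cases q <;> rfl
  rw [h]
  exact measurable_const.sumElim measurable_const

namespace Procedure

variable {α β δ : Type} [MeasurableSpace α] [MeasurableSpace β] [MeasurableSpace δ]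
  {P : Procedure d N α β} {Q : Procedure d N β δ} {M : SimModel.{u} d N} {γ : ℝ}

theorem measurable_stepLaw (P : Procedure d N α β) (M : SimModel.{u} d N) (γ : ℝ) :
    Measurable (P.stepLaw M γ) := by
  let g : (Query d N ⊕ β) × (P.State × ℝ) → Measure (P.State × ℝ) := fun p =>
    Sum.elim (fun q => (M.response q).map (fun o => (P.next p.2.1 o, p.2.2 + queryCost γ q)))
      (fun _ => 0) p.1
  have hg : Measurable g := by
    apply measurable_of_sum_prod
    · have h1 : Measurable (Function.uncurry
          fun (a : Query d N × (P.State × ℝ)) (o : Obs d) =>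
            ((P.next a.2.1 o, a.2.2 + queryCost γ a.1) : P.State × ℝ)) := by
        refine Measurable.prodMk ?_ ?_
        · exact P.measurable_next.comp ((measurable_fst.comp
            (measurable_snd.comp measurable_fst)).prodMk measurable_snd)
        · exact (measurable_snd.comp (measurable_snd.comp measurable_fst)).add
            ((measurable_queryCost γ).comp (measurable_fst.comp measurable_fst))
      exact measurable_kernel_map (M.responseKernel.comap Prod.fst measurable_fst) h1
    · exact measurable_const
  have h : P.stepLaw M γ = g ∘ fun s => (P.act s.1, s) := by
    funext s
    simp only [stepLaw, g, Function.comp]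
    cases P.act s.1 <;> rfl
  rw [h]
  exact hg.comp ((P.measurable_act.comp measurable_fst).prodMk measurable_id)

theorem measurable_stopLaw (P : Procedure d N α β) : Measurable P.stopLaw := by
  let g : (Query d N ⊕ β) × (P.State × ℝ) → Measure (β × ℝ) := fun p =>
    Sum.elim (fun _ => 0) (fun b => Measure.dirac (b, p.2.2)) p.1
  have hg : Measurable g := by
    apply measurable_of_sum_prod
    · exact measurable_const
    · exact Measure.measurable_dirac.comp
        (measurable_fst.prodMk (measurable_snd.comp measurable_snd))
  have h : P.stopLaw = g ∘ fun s => (P.act s.1, s) := by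
    funext s
    simp only [stopLaw, g, Function.comp]
    cases P.act s.1 <;> rfl
  rw [h]
  exact hg.comp ((P.measurable_act.comp measurable_fst).prodMk measurable_id)

/-- An expectation transformer judgement: started on an input `a` with accumulated cost `r`, the
expectation of `post` at the output and total cost is at most `pre a r`, as witnessed by a
supermartingale along the run of `P`. -/
def Triple (P : Procedure d N α β) (M : SimModel.{u} d N) (γ : ℝ) (pre : α → ℝ → ℝ≥0∞)
    (post : β → ℝ → ℝ≥0∞) : Prop :=
  ∃ U : P.State → ℝ → ℝ≥0∞, (∀ a r, U (P.init a) r ≤ pre a r) ∧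
    (∀ s r b, P.act s = Sum.inr b → post b r ≤ U s r) ∧
    ∀ s r q, P.act s = Sum.inl q →
      ∫⁻ o, U (P.next s o) (r + queryCost γ q) ∂(M.response q) ≤ U s r

theorem Triple.mono {pre pre' : α → ℝ → ℝ≥0∞} {post : β → ℝ → ℝ≥0∞}
    (h : Triple P M γ pre post) (hpre : ∀ a r, pre a r ≤ pre' a r) :
    Triple P M γ pre' post := by
  obtain ⟨U, h1, h2, h3⟩ := h
  exact ⟨U, fun a r => (h1 a r).trans (hpre a r), h2, h3⟩

theorem Triple.mono_post {pre : α → ℝ → ℝ≥0∞} {post post' : β → ℝ → ℝ≥0∞}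
    (h : Triple P M γ pre post) (hpost : ∀ b r, post' b r ≤ post b r) :
    Triple P M γ pre post' := by
  obtain ⟨U, h1, h2, h3⟩ := h
  exact ⟨U, h1, fun s r b hb => (hpost b r).trans (h2 s r b hb), h3⟩

/-- A state in which `P` stops with `b` acts like the initial state of `Q` on `b`; there the
potential of `P` dominates `mid`, hence the potential of `Q`. So the handover needs no query of its
own. -/
theorem Triple.andThen {pre : α → ℝ → ℝ≥0∞} {mid : β → ℝ → ℝ≥0∞} {post : δ → ℝ → ℝ≥0∞}
    (hP : Triple P M γ pre mid) (hQ : Triple Q M γ mid post) :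
    Triple (P.andThen Q) M γ pre post := by
  obtain ⟨U, hU1, hU2, hU3⟩ := hP
  obtain ⟨V, hV1, hV2, hV3⟩ := hQ
  refine ⟨fun s => Sum.elim U V s, fun a r => hU1 a r, ?_, ?_⟩
  · rintro (s | s) r c hc
    · rcases hs : P.act s with q | b
      · simp [Procedure.andThen, hs] at hc
      · simp only [Procedure.andThen, Sum.elim_inl, hs, Sum.elim_inr] at hc
        exact (hV2 _ r c hc).trans ((hV1 b r).trans (hU2 s r b hs))
    · exact hV2 s r c hc
  · rintro (s | s) r q hq
    · rcases hs : P.act s with q' | b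
      · simp only [Procedure.andThen, Sum.elim_inl, hs, Sum.inl.injEq] at hq
        subst hq
        simpa [Procedure.andThen, hs] using hU3 s r q' hs
      · simp only [Procedure.andThen, Sum.elim_inl, hs, Sum.elim_inr] at hq
        have := (hV3 _ r q hq).trans ((hV1 b r).trans (hU2 s r b hs))
        simpa [Procedure.andThen, hs] using this
    · exact hV3 s r q hq

theorem Triple.pure (b : β) (post : β → ℝ → ℝ≥0∞) :
    Triple (Procedure.pure b : Procedure d N Unit β) M γ (fun _ r => post b r) post := by
  refine ⟨fun _ r => post b r, fun _ _ => le_rfl, fun s r c hc => ?_, fun s r q hq => ?_⟩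
  · simp only [Procedure.pure, Sum.inr.injEq] at hc
    rw [hc]
  · simp [Procedure.pure] at hq

/-- Optional stopping: the `post`-expectation collected by the runs already stopped, plus the
potential of those still running, does not increase with the number of queries. Integrals of
possibly nonmeasurable functions are superadditive, which is the direction used. -/
theorem Triple.lintegral_outcomeLaw_le {pre : α → ℝ → ℝ≥0∞} {post : β → ℝ → ℝ≥0∞}
    (h : Triple P M γ pre post) (a : α) :
    ∫⁻ p, post p.1 p.2 ∂(P.outcomeLaw M γ a) ≤ pre a 0 := by
  obtain ⟨U, h1, h2, h3⟩ := h
  have hpt : ∀ s : P.State × ℝ, ∫⁻ p, post p.1 p.2 ∂(P.stopLaw s) +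
      ∫⁻ s', U s'.1 s'.2 ∂(P.stepLaw M γ s) ≤ U s.1 s.2 := by
    intro s
    rcases hs : P.act s.1 with q | b
    · simp only [stopLaw, stepLaw, hs, lintegral_zero_measure, zero_add]
      exact (lintegral_map_le _ _).trans (h3 s.1 s.2 q hs)
    · simp only [stopLaw, stepLaw, hs, lintegral_zero_measure, add_zero]
      refine le_trans ?_ (h2 s.1 s.2 b hs)
      exact lintegral_dirac_le (b, s.2) (fun p : β × ℝ => post p.1 p.2)
  have hn : ∀ n, ∑ k ∈ Finset.range n, ∫⁻ p, post p.1 p.2 ∂((P.runLaw M γ a k).bind P.stopLaw) +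
      ∫⁻ s, U s.1 s.2 ∂(P.runLaw M γ a n) ≤ U (P.init a) 0 := by
    intro n
    induction n with
    | zero =>
      rw [Finset.range_zero, Finset.sum_empty, zero_add]
      exact lintegral_dirac_le (P.init a, (0 : ℝ)) (fun s : P.State × ℝ => U s.1 s.2)
    | succ n ih =>
      refine le_trans ?_ ih
      rw [Finset.sum_range_succ, add_assoc]
      gcongr
      calc _ ≤ ∫⁻ s, ∫⁻ p, post p.1 p.2 ∂(P.stopLaw s) ∂(P.runLaw M γ a n) +
            ∫⁻ s, ∫⁻ s', U s'.1 s'.2 ∂(P.stepLaw M γ s) ∂(P.runLaw M γ a n) :=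
            add_le_add (Measure.lintegral_bind_le _ _ _) (Measure.lintegral_bind_le _ _ _)
        _ ≤ ∫⁻ s, (∫⁻ p, post p.1 p.2 ∂(P.stopLaw s) +
            ∫⁻ s', U s'.1 s'.2 ∂(P.stepLaw M γ s)) ∂(P.runLaw M γ a n) := le_lintegral_add _ _
        _ ≤ _ := lintegral_mono hpt
  rw [outcomeLaw, lintegral_sum_measure, ENNReal.tsum_eq_iSup_nat]
  exact iSup_le fun n => (le_self_add.trans (hn n)).trans (h1 a 0)

/-- A procedure that makes at most `n` queries, of total cost at most `C`. -/
def Bounded (P : Procedure d N α β) (γ : ℝ) (n : ℕ) (C : ℝ) : Prop :=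
  ∃ (rank : P.State → ℕ) (pot : P.State → ℝ),
    (∀ a, rank (P.init a) ≤ n ∧ pot (P.init a) ≤ C) ∧
    (∀ s b, P.act s = Sum.inr b → 0 ≤ pot s) ∧
    ∀ s q, P.act s = Sum.inl q → ∀ o, rank (P.next s o) < rank s ∧
      pot (P.next s o) + queryCost γ q ≤ pot s

theorem Bounded.pure (b : β) : Bounded (Procedure.pure b : Procedure d N Unit β) γ 0 0 := by
  refine ⟨fun _ => 0, fun _ => 0, fun _ => ⟨le_rfl, le_rfl⟩, fun _ _ _ => le_rfl,
    fun s q hq => ?_⟩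
  simp [Procedure.pure] at hq

theorem Bounded.andThen {n m : ℕ} {C D : ℝ} (hP : Bounded P γ n C) (hQ : Bounded Q γ m D) :
    Bounded (P.andThen Q) γ (n + m) (C + D) := by
  obtain ⟨ρ, p, h1, h2, h3⟩ := hP
  obtain ⟨σ, q, k1, k2, k3⟩ := hQ
  refine ⟨fun s => Sum.elim (fun s => ρ s + m) σ s, fun s => Sum.elim (fun s => p s + D) q s,
    fun a => ⟨Nat.add_le_add_right (h1 a).1 m, add_le_add_left (h1 a).2 D⟩, ?_, ?_⟩
  · rintro (s | s) c hc
    · rcases hs : P.act s with q' | b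
      · simp [Procedure.andThen, hs] at hc
      · simp only [Procedure.andThen, Sum.elim_inl, hs, Sum.elim_inr] at hc
        exact add_nonneg (h2 s b hs) ((k2 _ c hc).trans (k1 b).2)
    · exact k2 s c hc
  · rintro (s | s) q' hq o
    · rcases hs : P.act s with q'' | b
      · simp only [Procedure.andThen, Sum.elim_inl, hs, Sum.inl.injEq] at hq
        subst hq
        have := h3 s q'' hs o
        simp only [Procedure.andThen, Sum.elim_inl, hs]
        constructor
        · omega
        · linarith
      · simp only [Procedure.andThen, Sum.elim_inl, hs, Sum.elim_inr] at hq
        have := k3 _ q' hq o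
        have := k1 b
        have := h2 s b hs
        simp only [Procedure.andThen, Sum.elim_inl, Sum.elim_inr, hs]
        constructor
        · omega
        · linarith
    · exact k3 s q' hq o

/-- Each query lowers the rank, so after `k` queries rank plus `k` is at most `n`. The violation is
measured by an integral since the rank need not be measurable. -/
theorem Bounded.runLaw_eq_zero {n : ℕ} {C : ℝ} (h : Bounded P γ n C) (a : α) :
    P.runLaw M γ a (n + 1) Set.univ = 0 := by
  obtain ⟨ρ, p, h1, -, h3⟩ := h
  have key : ∀ k, ∫⁻ s, (if ρ s.1 + k ≤ n then 0 else 1) ∂(P.runLaw M γ a k) = 0 := by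
    intro k
    induction k with
    | zero =>
      refine le_antisymm ((lintegral_dirac_le _ _).trans ?_) zero_le
      simp [(h1 a).1]
    | succ k ih =>
      refine le_antisymm ((Measure.lintegral_bind_le _ _ _).trans (le_of_le_of_eq ?_ ih)) zero_le
      refine lintegral_mono fun s => ?_
      rcases hs : P.act s.1 with q | b
      · simp only [stepLaw, hs]
        refine (lintegral_map_le _ _).trans ?_
        calc _ ≤ ∫⁻ _, (if ρ s.1 + k ≤ n then 0 else 1) ∂(M.response q) := by
              refine lintegral_mono fun o => ?_
              have := (h3 s.1 q hs o).1
              dsimp only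
              split_ifs <;> first | exact le_rfl | exact zero_le | omega
          _ = _ := by simp
      · simp [stepLaw, hs]
  have h := key (n + 1)
  rw [lintegral_congr (g := fun _ => (1 : ℝ≥0∞)) (fun s => if_neg (by omega))] at h
  simpa using h

/-- Every step splits the mass into a stopped and a continuing part without loss, and after `n + 1`
queries nothing continues. -/
theorem Bounded.isProbabilityMeasure_outcomeLaw {n : ℕ} {C : ℝ} (h : Bounded P γ n C) (a : α) :
    IsProbabilityMeasure (P.outcomeLaw M γ a) := by
  have hstep : ∀ k, ((P.runLaw M γ a k).bind P.stopLaw) Set.univ +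
      P.runLaw M γ a (k + 1) Set.univ = P.runLaw M γ a k Set.univ := by
    intro k
    rw [runLaw, Measure.bind_apply .univ (P.measurable_stopLaw).aemeasurable,
      Measure.bind_apply .univ (P.measurable_stepLaw M γ).aemeasurable,
      ← lintegral_add_left (f := fun s => P.stopLaw s Set.univ)
        ((Measure.measurable_coe .univ).comp P.measurable_stopLaw), ← lintegral_one]
    refine lintegral_congr fun s => ?_
    rcases hs : P.act s.1 with q | b
    · have hm : Measurable fun o => (P.next s.1 o, s.2 + queryCost γ q) :=
        P.measurable_next.of_uncurry_left.prodMk measurable_const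
      simp only [stopLaw, stepLaw, hs]
      rw [Measure.map_apply hm .univ]
      simp
    · simp [stopLaw, stepLaw, hs]
  have hsum : ∀ k, ∑ j ∈ Finset.range k, ((P.runLaw M γ a j).bind P.stopLaw) Set.univ +
      P.runLaw M γ a k Set.univ = 1 := by
    intro k
    induction k with
    | zero => simp [runLaw]
    | succ k ih => rw [Finset.sum_range_succ, add_assoc, hstep, ih]
  have hle : P.outcomeLaw M γ a Set.univ ≤ 1 := by
    rw [outcomeLaw, Measure.sum_apply _ .univ, ENNReal.tsum_eq_iSup_nat]
    exact iSup_le fun k => le_self_add.trans (hsum k).le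
  have hge : 1 ≤ P.outcomeLaw M γ a Set.univ := by
    rw [← hsum (n + 1), h.runLaw_eq_zero, add_zero, outcomeLaw, Measure.sum_apply _ .univ]
    exact ENNReal.sum_le_tsum _
  exact ⟨le_antisymm hle hge⟩

theorem Bounded.ae_cost_le {n : ℕ} {C : ℝ} (h : Bounded P γ n C) (a : α) :
    ∀ᵐ p ∂(P.outcomeLaw M γ a), p.2 ≤ C := by
  obtain ⟨ρ, p, h1, h2, h3⟩ := h
  -- The potential indicates that spent cost plus remaining budget exceeds `C`; it cannot rise from
  -- `0` to `1`.
  have hT : Triple P M γ (fun _ r => if r ≤ 0 then 0 else 1) (fun _ r => if r ≤ C then 0 else 1) := by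
    refine ⟨fun s r => if r + p s ≤ C then 0 else 1, fun a r => ?_, fun s r b hb => ?_,
      fun s r q hq => ?_⟩
    · have := (h1 a).2
      dsimp only
      split_ifs <;> first | exact le_rfl | exact zero_le | (exfalso; linarith)
    · have := h2 s b hb
      dsimp only
      split_ifs <;> first | exact le_rfl | exact zero_le | (exfalso; linarith)
    · calc _ ≤ ∫⁻ _, (if r + p s ≤ C then 0 else 1) ∂(M.response q) := by
            refine lintegral_mono fun o => ?_
            have := (h3 s q hq o).2
            dsimp only
            split_ifs <;> first | exact le_rfl | exact zero_le | (exfalso; linarith)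
        _ = _ := by simp
  have h4 := hT.lintegral_outcomeLaw_le a
  rw [if_pos le_rfl] at h4
  have h5 : MeasurableSet {p : β × ℝ | p.2 ≤ C} := measurableSet_le measurable_snd measurable_const
  have h6 : ∫⁻ p, (if p.2 ≤ C then (0 : ℝ≥0∞) else 1) ∂(P.outcomeLaw M γ a) = 0 :=
    le_antisymm h4 zero_le
  rw [lintegral_eq_zero_iff (Measurable.ite h5 measurable_const measurable_const)] at h6
  filter_upwards [h6] with q hq
  by_contra hc
  simp [hc] at hq

end Procedure
end Semantics

/-! ### Truncation of sub-Gaussian variables -/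

section SubGaussian

variable {Ω : Type*} [MeasurableSpace Ω] {μ : Measure Ω} [IsProbabilityMeasure μ]

/-- A bounded `1`-Lipschitz function of a sub-Gaussian random variable is sub-Gaussian after
centering, with twice the parameter. -/
theorem hasSubgaussianMGF_lipschitz_comp {X : Ω → ℝ} {m b : ℝ} {c : ℝ≥0} (hX : Measurable X)
    (h : HasSubgaussianMGF (fun ω => X ω - m) c μ) {φ : ℝ → ℝ} (hφ : ∀ x y, |φ x - φ y| ≤ |x - y|)
    (hφm : Measurable φ) (hb : ∀ x, |φ x| ≤ b) :
    HasSubgaussianMGF (fun ω => φ (X ω) - ∫ ω', φ (X ω') ∂μ) (2 * c) μ := by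
  have hm : Measurable fun ω => φ (X ω) := hφm.comp hX
  have hZ : Integrable (fun ω => φ (X ω)) μ :=
    .of_bound hm.aestronglyMeasurable b (ae_of_all _ fun ω => hb _)
  have hexp : ∀ t, Integrable (fun ω => Real.exp (t * φ (X ω))) μ := fun t => by
    refine .of_bound (hm.const_mul t).exp.aestronglyMeasurable (Real.exp (|t| * b))
      (ae_of_all _ fun ω => ?_)
    rw [Real.norm_eq_abs, Real.abs_exp, Real.exp_le_exp]
    refine (le_abs_self _).trans ?_
    rw [abs_mul]
    exact mul_le_mul_of_nonneg_left (hb _) (abs_nonneg _)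
  have hsplit : ∀ t, (fun ω => Real.exp (t * (φ (X ω) - ∫ ω', φ (X ω') ∂μ))) =
      fun ω => Real.exp (t * φ (X ω)) * Real.exp (-(t * ∫ ω', φ (X ω') ∂μ)) := fun t => by
    funext ω
    rw [← Real.exp_add]
    ring_nf
  refine ⟨fun t => ?_, fun t => ?_⟩
  · rw [hsplit]
    exact (hexp t).mul_const _
  -- Symmetrization: Jensen replaces the mean by an independent copy. This costs the factor `2` in
  -- the parameter.
  · have hjensen : Real.exp (-(t * ∫ ω', φ (X ω') ∂μ)) ≤ ∫ ω, Real.exp (-t * φ (X ω)) ∂μ := by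
      have := convexOn_exp.map_integral_le (μ := μ) (f := fun ω => -t * φ (X ω))
        Real.continuous_exp.continuousOn isClosed_univ (ae_of_all _ fun _ => Set.mem_univ _)
        (hZ.const_mul (-t)) (hexp (-t))
      rwa [integral_const_mul, neg_mul] at this
    have h1 : mgf (fun ω => φ (X ω) - ∫ ω', φ (X ω') ∂μ) μ t ≤
        (∫ ω, Real.exp (t * φ (X ω)) ∂μ) * ∫ ω, Real.exp (-t * φ (X ω)) ∂μ := by
      rw [mgf, hsplit, integral_mul_const]
      exact mul_le_mul_of_nonneg_left hjensen (integral_nonneg fun _ => (Real.exp_pos _).le)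
    -- Taking both orders of the pair turns the integrand on the product space into a hyperbolic
    -- cosine of the difference, which is monotone in its absolute value. The unknown mean of `φ
    -- (X)` has disappeared.
    have h2 : (∫ ω, Real.exp (t * φ (X ω)) ∂μ) * (∫ ω, Real.exp (-t * φ (X ω)) ∂μ) +
        (∫ ω, Real.exp (-t * φ (X ω)) ∂μ) * (∫ ω, Real.exp (t * φ (X ω)) ∂μ) ≤
        (∫ ω, Real.exp (t * (X ω - m)) ∂μ) * (∫ ω, Real.exp (-t * (X ω - m)) ∂μ) +
        (∫ ω, Real.exp (-t * (X ω - m)) ∂μ) * (∫ ω, Real.exp (t * (X ω - m)) ∂μ) := by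
      simp only [← integral_prod_mul]
      rw [← integral_add ((hexp t).mul_prod (hexp (-t))) ((hexp (-t)).mul_prod (hexp t)),
        ← integral_add ((h.integrable_exp_mul t).mul_prod (h.integrable_exp_mul (-t)))
        ((h.integrable_exp_mul (-t)).mul_prod (h.integrable_exp_mul t))]
      refine integral_mono
        (((hexp t).mul_prod (hexp (-t))).add ((hexp (-t)).mul_prod (hexp t)))
        (((h.integrable_exp_mul t).mul_prod (h.integrable_exp_mul (-t))).add
        ((h.integrable_exp_mul (-t)).mul_prod (h.integrable_exp_mul t))) fun p => ?_
      have h3 : Real.cosh (t * (φ (X p.1) - φ (X p.2))) ≤ Real.cosh (t * (X p.1 - X p.2)) := by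
        rw [Real.cosh_le_cosh, abs_mul, abs_mul]
        exact mul_le_mul_of_nonneg_left (hφ _ _) (abs_nonneg _)
      rw [Real.cosh_eq, Real.cosh_eq] at h3
      simp only [← Real.exp_add]
      have e1 : t * φ (X p.1) + -t * φ (X p.2) = t * (φ (X p.1) - φ (X p.2)) := by ring
      have e2 : -t * φ (X p.1) + t * φ (X p.2) = -(t * (φ (X p.1) - φ (X p.2))) := by ring
      have e3 : t * (X p.1 - m) + -t * (X p.2 - m) = t * (X p.1 - X p.2) := by ring
      have e4 : -t * (X p.1 - m) + t * (X p.2 - m) = -(t * (X p.1 - X p.2)) := by ring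
      rw [e1, e2, e3, e4]
      linarith
    have h4 := h.mgf_le t
    have h5 := h.mgf_le (-t)
    rw [mgf] at h4 h5
    have h6 : (∫ ω, Real.exp (t * (X ω - m)) ∂μ) * (∫ ω, Real.exp (-t * (X ω - m)) ∂μ) ≤
        Real.exp (c * t ^ 2 / 2) * Real.exp (c * (-t) ^ 2 / 2) :=
      mul_le_mul h4 h5 (integral_nonneg fun _ => (Real.exp_pos _).le) (Real.exp_pos _).le
    rw [← Real.exp_add] at h6
    have h7 : ((2 * c : ℝ≥0) : ℝ) * t ^ 2 / 2 = c * t ^ 2 / 2 + c * (-t) ^ 2 / 2 := by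
      push_cast
      ring
    rw [h7]
    linarith

/-- Truncation of a real number to `[-M, M]`. -/
noncomputable def trunc (M x : ℝ) : ℝ := max (min x M) (-M)

theorem abs_trunc_sub_le (M x y : ℝ) : |trunc M x - trunc M y| ≤ |x - y| := by
  refine (abs_max_sub_max_le_abs _ _ _).trans ((abs_min_sub_min_le_max _ _ _ _).trans ?_)
  simp

theorem abs_trunc_le {M : ℝ} (hM : 0 ≤ M) (x : ℝ) : |trunc M x| ≤ M := by
  rw [abs_le]
  exact ⟨le_max_right _ _, max_le (min_le_right _ _) (by linarith)⟩

theorem measurable_trunc (M : ℝ) : Measurable (trunc M) := by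
  unfold trunc
  fun_prop

theorem trunc_neg {M : ℝ} (hM : 0 ≤ M) (x : ℝ) : trunc M (-x) = -trunc M x := by
  unfold trunc
  rcases le_total x M with h | h <;> rcases le_total (-x) M with h' | h'
  · rw [min_eq_left h, min_eq_left h', max_eq_left (by linarith), max_eq_left (by linarith)]
  · rw [min_eq_left h, min_eq_right h', max_eq_left (by linarith), max_eq_right (by linarith)]
    ring
  · rw [min_eq_right h, min_eq_left h', max_eq_right (by linarith), max_eq_left (by linarith)]
  · rw [min_eq_right h, min_eq_right h', max_eq_left (by linarith)]
    linarith

/-- From `cosh u = 1 + 2 sinh²(u / 2)` and `sinh v ≥ v` for `v ≥ 0`. It bounds second moments by the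
moment generating function at `1` and `-1`. -/
theorem sq_le_exp_add_exp_neg (u : ℝ) : u ^ 2 ≤ Real.exp u + Real.exp (-u) := by
  have key : ∀ v : ℝ, 0 ≤ v → v ^ 2 ≤ Real.exp v + Real.exp (-v) := fun v hv => by
    have h1 := Real.quadratic_le_exp_of_nonneg hv
    have h2 := Real.one_sub_le_exp_neg v
    have h3 : 2 + 2 * (v ^ 2 / 2) ≤ 2 * Real.cosh v := by
      have h4 : Real.cosh v = 1 + 2 * Real.sinh (v / 2) ^ 2 := by
        have := Real.cosh_two_mul (v / 2)
        rw [mul_div_cancel₀ v two_ne_zero] at this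
        rw [this, Real.cosh_sq]
        ring
      have h5 : v / 2 ≤ Real.sinh (v / 2) := Real.self_le_sinh_iff.2 (by linarith)
      have : (v / 2) ^ 2 ≤ Real.sinh (v / 2) ^ 2 := pow_le_pow_left₀ (by linarith) h5 2
      rw [h4]
      linarith
    rw [Real.cosh_eq] at h3
    linarith
  rcases le_total 0 u with h | h
  · exact key u h
  · have := key (-u) (by linarith)
    rw [neg_neg, neg_sq] at this
    linarith

/-- The mean of a truncated sub-Gaussian variable, from above. -/
theorem integral_trunc_le {X : Ω → ℝ} {c : ℝ≥0} (hX : Measurable X)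
    (h : HasSubgaussianMGF (fun ω => X ω - ∫ ω', X ω' ∂μ) c μ) {K M : ℝ} (hK : 0 ≤ K)
    (hKM : K < M) (hm : ∫ ω, X ω ∂μ ≤ K) :
    ∫ ω, trunc M (X ω) ∂μ ≤ max (∫ ω, X ω ∂μ) (-K) + Real.exp (c / 2) / (2 * (M - K)) := by
  set m := ∫ ω, X ω ∂μ with hmdef
  set a := M - K with ha
  have ha0 : 0 < a := by linarith
  set m' := max m (-K) with hm'
  have hm1 : m ≤ m' := le_max_left _ _
  have hm2 : -K ≤ m' := le_max_right _ _
  have hm3 : m' ≤ K := max_le hm (by linarith)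
  have hu : Integrable (fun ω => X ω - m) μ := h.integrable
  have hXint : Integrable X μ := by
    refine (hu.add (integrable_const m)).congr (ae_of_all _ fun ω => ?_)
    simp
  have hu0 : ∫ ω, (X ω - m) ∂μ = 0 := by
    rw [integral_sub hXint (integrable_const m)]
    simp [hmdef]
  -- With `u = X - m`, truncation can raise the value above `m' + u` by at most the positive part of
  -- `|u| - a`, which is at most `u² / (4 a)` by the inequality of means. The linear term integrates
  -- to zero, so the bias is of order `1 / a`.
  have hpt : ∀ ω, trunc M (X ω) ≤ m' + (X ω - m) +
      (Real.exp (1 * (X ω - m)) + Real.exp (-1 * (X ω - m))) / (4 * a) := by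
    intro ω
    set u := X ω - m with hudef
    rw [one_mul, neg_one_mul]
    have h1 := sq_le_exp_add_exp_neg u
    have h2 : u ^ 2 / (4 * a) ≤ (Real.exp u + Real.exp (-u)) / (4 * a) := by gcongr
    have h3 : |u| - a ≤ u ^ 2 / (4 * a) := by
      rw [le_div_iff₀ (by positivity), ← sq_abs u]
      nlinarith [sq_nonneg (|u| - 2 * a)]
    have h4 : 0 ≤ u ^ 2 / (4 * a) := by positivity
    have h5 := neg_le_abs u
    refine max_le ((min_le_left _ _).trans ?_) ?_ <;> linarith
  have hi1 := h.integrable_exp_mul 1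
  have hi2 := h.integrable_exp_mul (-1)
  have htr : Integrable (fun ω => trunc M (X ω)) μ :=
    .of_bound ((measurable_trunc M).comp hX).aestronglyMeasurable M
      (ae_of_all _ fun ω => abs_trunc_le (by linarith) _)
  have hA : Integrable (fun ω => m' + (X ω - m)) μ := (integrable_const m').add hu
  have hB : Integrable (fun ω =>
      (Real.exp (1 * (X ω - m)) + Real.exp (-1 * (X ω - m))) / (4 * a)) μ :=
    (hi1.add hi2).div_const _
  calc ∫ ω, trunc M (X ω) ∂μ ≤ ∫ ω, (m' + (X ω - m) +
        (Real.exp (1 * (X ω - m)) + Real.exp (-1 * (X ω - m))) / (4 * a)) ∂μ :=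
        integral_mono htr (hA.add hB) hpt
    _ = m' + (mgf (fun ω => X ω - m) μ 1 + mgf (fun ω => X ω - m) μ (-1)) / (4 * a) := by
        rw [integral_add hA hB,
          integral_add (integrable_const m') hu, hu0, integral_div, integral_add hi1 hi2]
        simp [mgf]
    _ ≤ m' + (Real.exp (c / 2) + Real.exp (c / 2)) / (4 * a) := by
        have h1 := h.mgf_le 1
        have h2 := h.mgf_le (-1)
        norm_num at h1 h2
        gcongr
    _ = _ := by
        congr 1
        field_simp
        ring

/-- The mean of a truncated sub-Gaussian variable, from below. -/
theorem le_integral_trunc {X : Ω → ℝ} {c : ℝ≥0} (hX : Measurable X)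
    (h : HasSubgaussianMGF (fun ω => X ω - ∫ ω', X ω' ∂μ) c μ) {K M : ℝ} (hK : 0 ≤ K)
    (hKM : K < M) (hm : -K ≤ ∫ ω, X ω ∂μ) :
    min (∫ ω, X ω ∂μ) K - Real.exp (c / 2) / (2 * (M - K)) ≤ ∫ ω, trunc M (X ω) ∂μ := by
  have h' : HasSubgaussianMGF (fun ω => -X ω - ∫ ω', -X ω' ∂μ) c μ := by
    refine h.neg.congr (ae_of_all _ fun ω => ?_)
    simp only [Pi.neg_apply, integral_neg]
    ring
  have h1 := integral_trunc_le hX.neg h' hK hKM (by rw [Pi.neg_def, integral_neg]; linarith)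
  simp only [Pi.neg_apply, trunc_neg (hK.trans hKM.le), integral_neg] at h1
  rw [max_neg_neg] at h1
  linarith

/-- Truncating the components of a subgradient estimator changes the inner product with `v` by
little, in the direction that matters, if large mean components occur only where `v` vanishes or is
bounded away from `0` with the same sign. -/
theorem le_sum_truncated_mean {d : ℕ} {m t v : Fin d → ℝ} {B K N R L r : ℝ}
    (hB : 0 ≤ B) (hN : 1 ≤ N) (hr : 0 ≤ r) (hK : K = d * (N * B) + L) (hBK : B ≤ K)
    (hv : ∀ i, |v i| ≤ N) (hlo : ∀ i, m i < -B → v i = 0 ∨ v i ≤ -1)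
    (hhi : ∀ i, B < m i → v i = 0 ∨ 1 ≤ v i)
    (ht1 : ∀ i, m i ≤ K → t i ≤ max (m i) (-K) + r)
    (ht2 : ∀ i, -K ≤ m i → min (m i) K - r ≤ t i)
    (hR : R ≤ ∑ i, m i * v i) (hRL : R ≤ L) : R - d * (N * r) ≤ ∑ i, t i * v i := by
  have hK0 : 0 ≤ K := hB.trans hBK
  -- Means clamped to `[-K, K]`. Where clamping is active the sign of `v i` is known, so the
  -- one-sided bound on `t i` suffices to compare `t i * v i` with `c i * v i`.
  let c : Fin d → ℝ := fun i => max (min (m i) K) (-K)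
  have hc1 : ∀ i, m i < -K → c i = -K := fun i hi =>
    max_eq_right ((min_le_left _ _).trans hi.le)
  have hc2 : ∀ i, K < m i → c i = K := fun i hi => by
    simp only [c]
    rw [min_eq_right hi.le, max_eq_left (by linarith)]
  have hc3 : ∀ i, -K ≤ m i → m i ≤ K → c i = m i := fun i h1 h2 => by
    simp only [c]
    rw [min_eq_left h2, max_eq_left h1]
  have hterm : ∀ i, c i * v i - N * r ≤ t i * v i := by
    intro i
    have hvi := abs_le.1 (hv i)
    rcases lt_or_ge (m i) (-K) with h | h
    · rw [hc1 i h]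
      have h1 := ht1 i (by linarith)
      rw [max_eq_right h.le] at h1
      rcases hlo i (by linarith) with h0 | h0
      · rw [h0]
        nlinarith
      · nlinarith
    · rcases le_or_gt (m i) K with h' | h'
      · rw [hc3 i h h']
        have h1 := ht1 i h'
        have h2 := ht2 i h
        rw [max_eq_left h] at h1
        rw [min_eq_left h'] at h2
        have h3 : |(t i - m i) * v i| ≤ r * N := by
          rw [abs_mul]
          exact mul_le_mul (abs_le.2 ⟨by linarith, by linarith⟩) (hv i) (abs_nonneg _) hr
        have h4 := (abs_le.1 h3).1
        linarith
      · rw [hc2 i h']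
        have h2 := ht2 i h
        rw [min_eq_right h'.le] at h2
        rcases hhi i (by linarith) with h0 | h0
        · rw [h0]
          nlinarith
        · nlinarith
  have hcv : ∀ i, 0 ≤ c i * v i + N * B := by
    intro i
    have hvi := abs_le.1 (hv i)
    rcases lt_or_ge (m i) (-B) with h | h
    · have h1 : c i ≤ 0 := max_le ((min_le_left _ _).trans (by linarith)) (by linarith)
      rcases hlo i h with h0 | h0
      · rw [h0]
        nlinarith
      · nlinarith
    · rcases le_or_gt (m i) B with h' | h'
      · rw [hc3 i (by linarith) (by linarith)]
        have h3 : |m i * v i| ≤ B * N := by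
          rw [abs_mul]
          exact mul_le_mul (abs_le.2 ⟨h, h'⟩) (hv i) (abs_nonneg _) hB
        have h4 := (abs_le.1 h3).1
        linarith
      · have h1 : 0 ≤ c i := (le_min (by linarith) hK0).trans (le_max_left _ _)
        rcases hhi i h' with h0 | h0
        · rw [h0]
          nlinarith
        · nlinarith
  -- Either clamping changes no term, or some active index has `|v j| ≥ 1` with favourable sign and
  -- contributes at least `K = d N B + L`. All the terms can lose at most `d N B` in total, which
  -- leaves at least `L ≥ R`.
  have hRc : R ≤ ∑ i, c i * v i := by
    by_cases hall : ∀ i, v i = 0 ∨ (-K ≤ m i ∧ m i ≤ K)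
    · refine hR.trans (le_of_eq (Finset.sum_congr rfl fun i _ => ?_))
      rcases hall i with h | h
      · simp [h]
      · rw [hc3 i h.1 h.2]
    · push Not at hall
      obtain ⟨j, hj, hj'⟩ := hall
      have h1 : K ≤ c j * v j := by
        rcases lt_or_ge (m j) (-K) with h | h
        · rw [hc1 j h]
          rcases hlo j (by linarith) with h0 | h0
          · exact absurd h0 hj
          · nlinarith
        · have h' := hj' h
          rw [hc2 j h']
          rcases hhi j (by linarith) with h0 | h0
          · exact absurd h0 hj
          · nlinarith
      have h2 := Finset.single_le_sum (f := fun i => c i * v i + N * B) (fun i _ => hcv i)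
        (Finset.mem_univ j)
      rw [Finset.sum_add_distrib] at h2
      simp only [Finset.sum_const, Finset.card_univ, Fintype.card_fin, nsmul_eq_mul] at h2
      have h3 : 0 ≤ N * B := by positivity
      linarith
  have h5 := Finset.sum_le_sum fun i (_ : i ∈ Finset.univ) => hterm i
  rw [Finset.sum_sub_distrib] at h5
  simp only [Finset.sum_const, Finset.card_univ, Fintype.card_fin, nsmul_eq_mul] at h5
  linarith

end SubGaussian

/-! ### The truncated subgradient estimator: bias and exponential moments -/

section Estimator

variable {d N : ℕ}

/-- A threshold beyond which truncation costs at most `β` in the subgradient inequality. -/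
noncomputable def truncBound (d N : ℕ) (τ : ℝ≥0) (L B β : ℝ) : ℝ :=
  d * (N * |B|) + N * |L| + |B| + d * (N * Real.exp (τ ^ 2 / 2)) / β + 1

/-- Mean components can exceed `|B|` in modulus only on a face of the cube. There `x i` is `1` or
`N`, and since `xs` is a grid point, `x i - xs i` vanishes or has modulus at least one and the
outward sign, as `le_sum_truncated_mean` demands. The Lipschitz bound supplies the range `N L` of
the extension. -/
theorem SimModel.truncated_subgradient [hN : Fact (2 ≤ N)] {M : SimModel.{u} d N} {τ : ℝ≥0} {L B β thr : ℝ}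
    (hL : M.LipschitzObjective L) (hB : M.MeanBound B) (hβ : 0 < β) {xs : Grid d N}
    (hsub : ∀ x : Cube d N, ∀ i,
      HasSubgaussianMGF (fun z => M.G x z i - M.meanG x i) (τ ^ 2) (M.η x))
    (hf : LNatConvex M.f)
    (hxs : ∀ x : Cube d N, convexExtension M.f x - convexExtension M.f xs.toCube ≤
      ∑ i, M.meanG x i * (x.1 i - xs.toCube.1 i))
    (hthr : truncBound d N τ L B β ≤ thr) (x : Cube d N) :
    convexExtension M.f x - M.f xs - β ≤
      ∑ i, (∫ z, trunc thr (M.G x z i) ∂(M.η x)) * (x.1 i - xs.1 i) := by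
  have hN1 : (1 : ℝ) ≤ N := by exact_mod_cast (le_trans one_le_two hN.out)
  have hG : ∀ i, Measurable fun z => M.G x z i := fun i =>
    (measurable_pi_apply i).comp (M.measurable_G_apply x)
  set K : ℝ := d * (N * |B|) + (N * |L| + |B|) with hK
  have hK0 : 0 ≤ K := by positivity
  set e : ℝ := Real.exp (τ ^ 2 / 2) with he
  have he0 : 0 < e := Real.exp_pos _
  have hKM : d * (N * e) / β + 1 ≤ thr - K := by
    unfold truncBound at hthr
    linarith
  have hq : 0 ≤ d * (N * e) / β := by positivity
  have hK1 : K < thr := by linarith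
  have hcoe : Real.exp (((τ ^ 2 : ℝ≥0) : ℝ) / 2) = e := by push_cast; rfl
  have hcoord : ∀ i, (1 ≤ x.1 i ∧ x.1 i ≤ N) ∧ (1 : ℝ) ≤ xs.1 i ∧ (xs.1 i : ℝ) ≤ N := fun i =>
    ⟨x.2 i, xs.toCube.2 i⟩
  have h := le_sum_truncated_mean (m := M.meanG x)
    (t := fun i => ∫ z, trunc thr (M.G x z i) ∂(M.η x)) (v := fun i => x.1 i - xs.1 i)
    (B := |B|) (K := K) (N := N) (R := convexExtension M.f x - M.f xs) (L := N * |L| + |B|)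
    (r := e / (2 * (thr - K))) (abs_nonneg B) hN1 (div_nonneg he0.le (by linarith)) hK
    (by have : 0 ≤ d * (N * |B|) + N * |L| := by positivity
        linarith)
    (fun i => by
      have := hcoord i
      rw [abs_le]
      constructor <;> linarith)
    (fun i hi => by
      have h1 := (hB x i).1
      have h2 : ¬ 1 < x.1 i := fun h' => by
        have := h1 h'
        have := neg_abs_le B
        have := le_abs_self B
        linarith
      have h3 : x.1 i = 1 := le_antisymm (not_lt.1 h2) (x.2 i).1
      rcases (xs.2 i).1.lt_or_eq with h4 | h4
      · right
        have : (2 : ℝ) ≤ xs.1 i := by exact_mod_cast h4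
        linarith
      · left
        rw [h3, ← h4]
        simp)
    (fun i hi => by
      have h1 := (hB x i).2
      have h2 : ¬ x.1 i < N := fun h' => by
        have := h1 h'
        have := le_abs_self B
        linarith
      have h3 : x.1 i = N := le_antisymm (x.2 i).2 (not_lt.1 h2)
      rcases (xs.2 i).2.lt_or_eq with h4 | h4
      · right
        have : (xs.1 i : ℝ) + 1 ≤ N := by exact_mod_cast h4
        linarith
      · left
        rw [h3, h4]
        simp)
    (fun i hi => by
      have := integral_trunc_le (hG i) (hsub x i) hK0 hK1 hi
      rwa [hcoe] at this)
    (fun i hi => by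
      have := le_integral_trunc (hG i) (hsub x i) hK0 hK1 hi
      rwa [hcoe] at this)
    (by
      have h1 := hf.convexExtension_toCube_le xs
      have h2 := hxs x
      have h3 : ∀ i, (xs.toCube.1 i : ℝ) = xs.1 i := fun i => rfl
      simp only [h3] at h2
      linarith)
    (by
      have h1 : convexExtension M.f x ≤ M.f xs + N * L := convexExtension_le_of_le (fun p => by
        have := sub_le_of_lipschitz hL p xs
        linarith) x
      have h2 : (N : ℝ) * L ≤ N * |L| := mul_le_mul_of_nonneg_left (le_abs_self L) (by positivity)
      have := abs_nonneg B
      linarith)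
  refine le_trans ?_ h
  -- The margin `thr - K ≥ d N e / β + 1` built into `truncBound` is chosen for this total bias.
  have h5 : d * (N * (e / (2 * (thr - K)))) ≤ β := by
    have : d * (N * (e / (2 * (thr - K)))) = d * (N * e) / (2 * (thr - K)) := by ring
    rw [this, div_le_iff₀ (by linarith)]
    have h6 : d * (N * e) ≤ (thr - K) * β := by
      rw [← div_le_iff₀ hβ]
      linarith
    nlinarith
  linarith

/-- Truncation acts on each component separately, so independence survives and the variance proxies
`2 τ² v i ²` add up. The bound does not involve `thr`, which keeps the slowly growing threshold out
of the deviation term. -/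
theorem SimModel.lintegral_exp_truncated_le {M : SimModel.{u} d N} {τ : ℝ≥0} {thr : ℝ}
    (hthr : 0 ≤ thr) {x : Cube d N} (hind : iIndepFun (fun i z => M.G x z i) (M.η x))
    (hsub : ∀ i, HasSubgaussianMGF (fun z => M.G x z i - M.meanG x i) (τ ^ 2) (M.η x))
    (v : Fin d → ℝ) (s : ℝ) :
    ∫⁻ z, ENNReal.ofReal (Real.exp (s * ∑ i, trunc thr (M.G x z i) * v i)) ∂(M.η x) ≤
      ENNReal.ofReal (Real.exp (s * ∑ i, (∫ z, trunc thr (M.G x z i) ∂(M.η x)) * v i +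
        s ^ 2 * τ ^ 2 * ∑ i, v i ^ 2)) := by
  have hG : ∀ i, Measurable fun z => M.G x z i := fun i =>
    (measurable_pi_apply i).comp (M.measurable_G_apply x)
  set t : Fin d → ℝ := fun i => ∫ z, trunc thr (M.G x z i) ∂(M.η x) with ht
  have h1 : ∀ i, HasSubgaussianMGF (fun z => v i * (trunc thr (M.G x z i) - t i))
      (Real.toNNReal (v i ^ 2) * (2 * τ ^ 2)) (M.η x) := fun i => by
    rw [Real.toNNReal_of_nonneg (sq_nonneg _)]
    exact (hasSubgaussianMGF_lipschitz_comp (hG i) (hsub i) (abs_trunc_sub_le thr)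
      (measurable_trunc thr) (abs_trunc_le hthr)).const_mul (v i)
  have h2 : iIndepFun (fun i z => v i * (trunc thr (M.G x z i) - t i)) (M.η x) :=
    hind.comp (fun i y => v i * (trunc thr y - t i)) fun i =>
      ((measurable_trunc thr).sub_const _).const_mul _
  have h3 := HasSubgaussianMGF.sum_of_iIndepFun h2 (s := Finset.univ) fun i _ => h1 i
  have h4 := h3.mgf_le s
  have h5 : ∀ z, Real.exp (s * ∑ i, trunc thr (M.G x z i) * v i) =
      Real.exp (s * ∑ i, v i * (trunc thr (M.G x z i) - t i)) * Real.exp (s * ∑ i, t i * v i) := by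
    intro z
    rw [← Real.exp_add, ← mul_add, ← Finset.sum_add_distrib]
    congr 2
    refine Finset.sum_congr rfl fun i _ => by ring
  simp_rw [h5]
  rw [← ofReal_integral_eq_lintegral_ofReal ((h3.integrable_exp_mul s).mul_const _)
    (ae_of_all _ fun z => (mul_pos (Real.exp_pos _) (Real.exp_pos _)).le), integral_mul_const]
  apply ENNReal.ofReal_le_ofReal
  rw [add_comm, Real.exp_add]
  refine mul_le_mul_of_nonneg_right (h4.trans (le_of_eq ?_)) (Real.exp_pos _).le
  congr 1
  rw [NNReal.coe_sum]
  simp only [NNReal.coe_mul, Real.coe_toNNReal _ (sq_nonneg _), NNReal.coe_pow, NNReal.coe_ofNat]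
  rw [← Finset.sum_mul]
  ring

end Estimator

/-! ### The projected subgradient method -/

section Descent

/-- Clamping is `1`-Lipschitz and fixes `c`; box projections are compositions of clamps. -/
theorem abs_clamp_sub_le {l u c : ℝ} (h1 : l ≤ c) (h2 : c ≤ u) (y : ℝ) :
    |max l (min u y) - c| ≤ |y - c| := by
  have h : c = max l (min u c) := by rw [min_eq_right h2, max_eq_right h1]
  conv_lhs => rw [h]
  rw [max_comm l, max_comm l]
  refine (abs_max_sub_max_le_abs _ _ _).trans ((abs_min_sub_min_le_max _ _ _ _).trans ?_)
  simp

variable {d N : ℕ} [hN : Fact (2 ≤ N)]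

theorem clip_apply_of_mem {v : Fin d → ℝ} {i : Fin d} (h1 : 1 ≤ v i) (h2 : v i ≤ N) :
    (clip v : Cube d N).1 i = v i := by
  change max 1 (min (N : ℝ) (v i)) = v i
  rw [min_eq_right h2, max_eq_right h1]

theorem abs_projBox_sub_le {x : Cube d N} {a c : ℝ} {i : Fin d} (hc1 : 1 ≤ c) (hc2 : c ≤ N)
    (hc : |x.1 i - c| ≤ a) (v : Fin d → ℝ) : |(projBox x a v).1 i - c| ≤ |v i - c| := by
  have h := abs_le.1 hc
  exact (abs_clamp_sub_le hc1 hc2 _).trans (abs_clamp_sub_le (by linarith) (by linarith) _)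

theorem abs_projBox_sub_center_le {x : Cube d N} {a : ℝ} (ha : 0 ≤ a) (v : Fin d → ℝ)
    (i : Fin d) : |(projBox x a v).1 i - x.1 i| ≤ a := by
  refine (abs_clamp_sub_le (x.2 i).1 (x.2 i).2 _).trans ?_
  rw [abs_le]
  constructor
  · linarith [le_max_left (x.1 i - a) (min (x.1 i + a) (v i))]
  · linarith [max_le (show x.1 i - a ≤ x.1 i + a by linarith) (min_le_left (x.1 i + a) (v i))]

/-- The one-step inequality of the projected subgradient method. -/
theorem sum_sq_projBox_le {x₀ x : Cube d N} {xs : Grid d N} {a thr step : ℝ} (hthr : 0 ≤ thr)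
    (hxs : ∀ i, |x₀.1 i - xs.1 i| ≤ a) (g : Fin d → ℝ) :
    ∑ i, ((projBox x₀ a fun i => x.1 i - step * truncate thr g i).1 i - xs.1 i) ^ 2 ≤
      ∑ i, (x.1 i - xs.1 i) ^ 2 - 2 * step * ∑ i, trunc thr (g i) * (x.1 i - xs.1 i) +
        step ^ 2 * (d * thr ^ 2) := by
  have h : ∀ i, ((projBox x₀ a fun i => x.1 i - step * truncate thr g i).1 i - xs.1 i) ^ 2 ≤
      (x.1 i - xs.1 i) ^ 2 - 2 * step * (trunc thr (g i) * (x.1 i - xs.1 i)) +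
        step ^ 2 * thr ^ 2 := by
    intro i
    have h1 : |(projBox x₀ a fun i => x.1 i - step * truncate thr g i).1 i - xs.1 i| ≤
        |x.1 i - step * trunc thr (g i) - xs.1 i| :=
      abs_projBox_sub_le (xs.toCube.2 i).1 (xs.toCube.2 i).2 (hxs i) _
    have h2 := sq_le_sq.2 h1
    have h3 : trunc thr (g i) ^ 2 ≤ thr ^ 2 := by
      rw [sq_le_sq, abs_of_nonneg hthr]
      exact abs_trunc_le hthr _
    have h4 := mul_le_mul_of_nonneg_left h3 (sq_nonneg step)
    nlinarith
  refine (Finset.sum_le_sum fun i _ => h i).trans (le_of_eq ?_)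
  rw [Finset.sum_add_distrib, Finset.sum_sub_distrib, ← Finset.mul_sum]
  simp
  ring

/-- The accumulated suboptimality of `t` iterates with sum `S`, measured at their average. -/
noncomputable def regret (f : Grid d N → ℝ) (xs : Grid d N) (t : ℕ) (S : Fin d → ℝ) : ℝ :=
  t * (convexExtension f (clip fun i => S i / t) - f xs)

/-- Jensen for the new average with weights `t / (t + 1)` and `1 / (t + 1)`. The bounds on `S` say
that averages lie in the cube, so `clip` is inert; for `t = 0` it is not, but the weight is zero. -/
theorem regret_succ_le {f : Grid d N → ℝ} (hf : LNatConvex f) (xs : Grid d N) {t : ℕ}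
    {S : Fin d → ℝ} (hS : ∀ i, (t : ℝ) ≤ S i ∧ S i ≤ N * t) (x : Cube d N) :
    regret f xs (t + 1) (fun i => S i + x.1 i) ≤
      regret f xs t S + (convexExtension f x - f xs) := by
  have ht : (0 : ℝ) < t + 1 := by positivity
  have h := hf.convexExtension_convex (x := clip fun i => S i / t) (y := x)
    (z := clip fun i => (S i + x.1 i) / ((t + 1 : ℕ) : ℝ)) (s := t / (t + 1)) (t := 1 / (t + 1))
    (by positivity) (by positivity) (by field_simp) (fun i => by
      have hx := x.2 i
      rw [clip_apply_of_mem]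
      · rcases Nat.eq_zero_or_pos t with rfl | hpos
        · have := hS i
          simp only [Nat.cast_zero, mul_zero] at this
          have : S i = 0 := le_antisymm this.2 this.1
          simp [this]
        · have hpos' : (0 : ℝ) < t := by exact_mod_cast hpos
          rw [clip_apply_of_mem]
          · push_cast
            field_simp
          · rw [le_div_iff₀ hpos']
            linarith [(hS i).1]
          · rw [div_le_iff₀ hpos']
            exact (hS i).2
      · push_cast
        rw [le_div_iff₀ ht]
        linarith [(hS i).1]
      · push_cast
        rw [div_le_iff₀ ht]
        linarith [(hS i).2])
  unfold regret
  have h2 := mul_le_mul_of_nonneg_left h ht.le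
  have h3 : ((t : ℝ) + 1) * (t / (t + 1) * convexExtension f (clip fun i => S i / t) +
      1 / (t + 1) * convexExtension f x) =
      t * convexExtension f (clip fun i => S i / t) + convexExtension f x := by
    field_simp
  push_cast at h2 h3 ⊢
  linarith

/-- The exponent of the exponential supermartingale that controls the subgradient method. -/
noncomputable def ssgdExponent (f : Grid d N → ℝ) (xs : Grid d N) (lam ε step w : ℝ) (T : ℕ)
    (s : ℕ × Cube d N × Cube d N × (Fin d → ℝ)) : ℝ :=
  lam * (regret f xs s.1 s.2.2.2 + (∑ i, (s.2.2.1.1 i - xs.1 i) ^ 2) / (2 * step) - T * ε / 2) +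
    (T - s.1) * w

open Classical in
/-- High-probability guarantee of the projected and truncated subgradient method. -/
theorem ssgd_triple {M : SimModel.{u} d N} {τ : ℝ≥0} {L B γ D ε thr step : ℝ} {T : ℕ}
    (hd : 1 ≤ d) (hτ : 0 < τ) (hL : M.LipschitzObjective L) (hB : M.MeanBound B)
    {xs : Grid d N} (hf : LNatConvex M.f)
    (hxs : ∀ x : Cube d N, convexExtension M.f x - convexExtension M.f xs.toCube ≤
      ∑ i, M.meanG x i * (x.1 i - xs.toCube.1 i))
    (hG : ∀ x : Cube d N, iIndepFun (fun i z => M.G x z i) (M.η x) ∧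
      ∀ i, HasSubgaussianMGF (fun z => M.G x z i - M.meanG x i) (τ ^ 2) (M.η x))
    (hD : 0 < D) (hε : 0 < ε) (hstep : 0 < step)
    (hthr : truncBound d N τ L B (ε / 8) ≤ thr)
    (hopt : d * D ^ 2 / (8 * step) + T * (step * (d * thr ^ 2) / 2) ≤ T * ε / 8) (p : ℝ≥0∞) :
    Procedure.Triple (ssgd (D / 2) T thr step) M γ
      (fun x _ => p + ENNReal.ofReal (Real.exp (-(T * ε ^ 2 / (64 * τ ^ 2 * (d * D ^ 2))))) +
        if ∀ i, |x.1 i - xs.1 i| ≤ D / 2 then 0 else 1)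
      (fun x _ => p + if convexExtension M.f x ≤ M.f xs + ε / 2 then 0 else 1) := by
  have hthr0 : 0 ≤ thr := by
    refine le_trans ?_ hthr
    unfold truncBound
    positivity
  have hd' : (0 : ℝ) < d := by exact_mod_cast hd
  have hτ' : (0 : ℝ) < τ := hτ
  -- Maximizes `lam ε / 4 - lam² τ² d D²`, the net gain per iteration; the maximum is `ε² / (64 τ² d
  -- D²)`. The `ε / 4` is `ε / 2` minus `ε / 8` for the truncation bias and `ε / 8` for the
  -- optimization error.
  set lam : ℝ := ε / (8 * τ ^ 2 * (d * D ^ 2)) with hlam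
  have hlam0 : 0 < lam := by positivity
  set w : ℝ := lam * (ε / 8 + step * (d * thr ^ 2) / 2) + lam ^ 2 * τ ^ 2 * (d * D ^ 2) with hw
  let E := ssgdExponent M.f xs lam ε step w T
  let Inv : ℕ × Cube d N × Cube d N × (Fin d → ℝ) → Prop := fun s => s.1 ≤ T ∧
    (∀ i, |s.2.2.1.1 i - s.2.1.1 i| ≤ D / 2) ∧ ∀ i, (s.1 : ℝ) ≤ s.2.2.2 i ∧ s.2.2.2 i ≤ N * s.1
  let Good : Cube d N → Prop := fun x => ∀ i, |x.1 i - xs.1 i| ≤ D / 2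
  -- States violating the invariant get `⊤`, so nothing has to be shown for them; runs whose box may
  -- miss `xs` are given up as failed. The summand `p` reserves failing probability for later
  -- phases.
  refine ⟨fun s _ => if Good s.2.1 then (if Inv s then p + ENNReal.ofReal (Real.exp (E s)) else ⊤)
    else p + 1, fun x r => ?_, ?_, ?_⟩
  · dsimp only [ssgd]
    by_cases hx : Good x
    · have hInv : Inv (0, x, x, 0) := ⟨Nat.zero_le _, fun i => by simp; positivity, by simp⟩
      rw [if_pos hx, if_pos hInv, if_pos hx, add_zero]
      gcongr
      have h1 : ∑ i, (x.1 i - xs.1 i) ^ 2 ≤ d * D ^ 2 / 4 := by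
        have : ∀ i ∈ Finset.univ, (x.1 i - xs.1 i) ^ 2 ≤ D ^ 2 / 4 := fun i _ => by
          have := hx i
          rw [← sq_abs]
          nlinarith [abs_nonneg (x.1 i - xs.1 i)]
        refine (Finset.sum_le_sum this).trans (le_of_eq ?_)
        simp
        ring
      have h2 : (∑ i, (x.1 i - xs.1 i) ^ 2) / (2 * step) ≤ d * D ^ 2 / (8 * step) := by
        rw [div_le_div_iff₀ (by positivity) (by positivity)]
        nlinarith
      have h3 : E (0, x, x, 0) ≤ lam * (d * D ^ 2 / (8 * step) - T * ε / 2) + T * w := by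
        simp only [E, ssgdExponent, regret, Nat.cast_zero, zero_mul, zero_add, sub_zero]
        have := mul_le_mul_of_nonneg_left h2 hlam0.le
        linarith
      have h4 := mul_le_mul_of_nonneg_left hopt hlam0.le
      have h5 : lam * ε / 4 - lam ^ 2 * τ ^ 2 * (d * D ^ 2) =
          ε ^ 2 / (64 * τ ^ 2 * (d * D ^ 2)) := by
        rw [hlam]
        field_simp
        ring
      have h6 : T * (lam * ε / 4 - lam ^ 2 * τ ^ 2 * (d * D ^ 2)) =
          T * ε ^ 2 / (64 * τ ^ 2 * (d * D ^ 2)) := by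
        rw [h5]
        ring
      rw [hw] at h3
      linarith
    · rw [if_neg hx, if_neg hx]
      gcongr
      exact le_self_add
  · rintro ⟨t, x₀, x, S⟩ r b hb
    dsimp only [ssgd] at hb ⊢
    by_cases ht : t < T
    · simp [ht] at hb
    · simp only [ht, if_false, Sum.inr.injEq] at hb
      by_cases hx : Good x₀
      · rw [if_pos hx]
        by_cases hInv : Inv (t, x₀, x, S)
        · rw [if_pos hInv]
          gcongr
          split_ifs with hc
          · exact zero_le
          · rw [← ENNReal.ofReal_one]
            apply ENNReal.ofReal_le_ofReal
            rw [Real.one_le_exp_iff]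
            have htT : t = T := le_antisymm hInv.1 (not_lt.1 ht)
            subst htT
            simp only [E, ssgdExponent, regret, sub_self, zero_mul, add_zero]
            rw [hb]
            have h1 : 0 ≤ (∑ i, (x.1 i - xs.1 i) ^ 2) / (2 * step) := by positivity
            have h2 : (t : ℝ) * (ε / 2) ≤ t * (convexExtension M.f b - M.f xs) :=
              mul_le_mul_of_nonneg_left (by linarith) (by positivity)
            apply mul_nonneg hlam0.le
            linarith
        · rw [if_neg hInv]
          exact le_top
      · rw [if_neg hx]
        gcongr
        split_ifs
        · exact zero_le
        · exact le_rfl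
  · rintro ⟨t, x₀, x, S⟩ r q hq
    dsimp only [ssgd] at hq ⊢
    by_cases ht : t < T
    · simp only [ht, if_true, Sum.inl.injEq] at hq
      subst hq
      refine (lintegral_map_le _ _).trans ?_
      by_cases hx : Good x₀
      · simp only [if_pos hx]
        by_cases hInv : Inv (t, x₀, x, S)
        · rw [if_pos hInv]
          obtain ⟨hI1, hI2, hI3⟩ := hInv
          dsimp only at hI1 hI2 hI3
          set A : ℝ := lam * (regret M.f xs t S + (convexExtension M.f x - M.f xs) +
            (∑ i, (x.1 i - xs.1 i) ^ 2) / (2 * step) + step * (d * thr ^ 2) / 2 - T * ε / 2) +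
            (T - t - 1) * w with hA
          -- Both points are within `D / 2` of the centre `x₀` in each coordinate.
          have hv : ∑ i, (x.1 i - xs.1 i) ^ 2 ≤ d * D ^ 2 := by
            have : ∀ i ∈ Finset.univ, (x.1 i - xs.1 i) ^ 2 ≤ D ^ 2 := fun i _ => by
              have h1 := abs_le.1 (hx i)
              have h2 := abs_le.1 (hI2 i)
              apply sq_le_sq'
              · linarith
              · linarith
            refine (Finset.sum_le_sum this).trans (le_of_eq ?_)
            simp
          -- Only the inner product with the truncated gradient is random; it is split off as a
          -- factor before integrating.
          have hpt : ∀ z, (if Inv (t + 1, x₀,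
              projBox x₀ (D / 2) (fun i => x.1 i - step * truncate thr (M.G x z) i),
              fun i => S i + x.1 i) then p + ENNReal.ofReal (Real.exp (E (t + 1, x₀,
              projBox x₀ (D / 2) (fun i => x.1 i - step * truncate thr (M.G x z) i),
              fun i => S i + x.1 i))) else ⊤) ≤ p + ENNReal.ofReal (Real.exp A) *
              ENNReal.ofReal (Real.exp (-lam * ∑ i, trunc thr (M.G x z i) * (x.1 i - xs.1 i))) := by
            intro z
            rw [if_pos]
            · rw [← ENNReal.ofReal_mul (Real.exp_pos _).le, ← Real.exp_add]
              gcongr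
              have h1 := regret_succ_le hf xs hI3 x
              have h2 := sum_sq_projBox_le (x := x) (step := step) hthr0 hx (M.G x z)
              have h3 := div_le_div_of_nonneg_right h2 (by positivity : 0 ≤ 2 * step)
              have h4 : (∑ i, (x.1 i - xs.1 i) ^ 2 -
                  2 * step * ∑ i, trunc thr (M.G x z i) * (x.1 i - xs.1 i) +
                  step ^ 2 * (d * thr ^ 2)) / (2 * step) =
                  (∑ i, (x.1 i - xs.1 i) ^ 2) / (2 * step) -
                  ∑ i, trunc thr (M.G x z i) * (x.1 i - xs.1 i) + step * (d * thr ^ 2) / 2 := by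
                field_simp
              rw [h4] at h3
              have h5 := mul_le_mul_of_nonneg_left (add_le_add h1 h3) hlam0.le
              simp only [E, ssgdExponent, hA]
              push_cast
              linarith
            · refine ⟨ht, abs_projBox_sub_center_le (by positivity) _, fun i => ?_⟩
              have h1 := hI3 i
              have h2 := x.2 i
              push_cast
              constructor <;> linarith
          refine (lintegral_mono hpt).trans ?_
          rw [lintegral_add_left measurable_const, lintegral_const, measure_univ, mul_one,
            lintegral_const_mul' _ _ ENNReal.ofReal_ne_top]
          gcongr
          refine (mul_le_mul_right (SimModel.lintegral_exp_truncated_le hthr0 (hG x).1 (hG x).2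
            (fun i => x.1 i - xs.1 i) (-lam)) _).trans ?_
          rw [← ENNReal.ofReal_mul (Real.exp_pos _).le, ← Real.exp_add]
          apply ENNReal.ofReal_le_ofReal
          rw [Real.exp_le_exp]
          have hb := SimModel.truncated_subgradient hL hB (by positivity) (fun x => (hG x).2) hf hxs
            hthr x
          have hb1 := mul_le_mul_of_nonneg_left hb hlam0.le
          have hb2 := mul_le_mul_of_nonneg_left hv (by positivity : 0 ≤ lam ^ 2 * (τ : ℝ) ^ 2)
          simp only [E, ssgdExponent, hA, hw, neg_sq]
          linarith
        · rw [if_neg hInv]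
          exact le_top
      · simp [hx]
    · simp [ht] at hq

theorem ssgd_bounded {γ a thr step : ℝ} {T : ℕ} (hγ : 0 ≤ γ) :
    Procedure.Bounded (ssgd a T thr step : Procedure d N (Cube d N) (Cube d N)) γ T (γ * T) := by
  refine ⟨fun s => T - s.1, fun s => γ * ((T - s.1 : ℕ) : ℝ), fun x => ?_, fun s b _ => ?_, ?_⟩
  · simp [ssgd]
  · positivity
  · rintro ⟨t, x₀, x, S⟩ q hq o
    dsimp only [ssgd] at hq ⊢
    by_cases ht : t < T
    · simp only [ht, if_true, Sum.inl.injEq] at hq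
      subst hq
      refine ⟨by omega, ?_⟩
      have : ((T - t : ℕ) : ℝ) = (T - (t + 1) : ℕ) + 1 := by
        exact_mod_cast (by omega : T - t = T - (t + 1) + 1)
      rw [this]
      simp only [queryCost]
      linarith
    · simp [ht] at hq

end Descent

/-! ### Selection among the neighbouring points -/

section Rounding

theorem sum_range_mul_mod (w : ℕ → ℝ) (m n : ℕ) :
    ∑ k ∈ Finset.range (m * n), w (k % m) = n * ∑ j ∈ Finset.range m, w j := by
  induction n with
  | zero => simp
  | succ n ih =>
    rw [Nat.mul_succ, Finset.sum_range_add, ih]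
    have : ∀ j ∈ Finset.range m, w ((m * n + j) % m) = w j := fun j hj => by
      rw [Nat.mul_add_mod, Nat.mod_eq_of_lt (Finset.mem_range.1 hj)]
    rw [Finset.sum_congr rfl this]
    push_cast
    ring

theorem SimModel.lintegral_exp_output_le {d N : ℕ} {M : SimModel.{u} d N} {σ : ℝ≥0}
    (hF : M.SubgaussianOutput σ) (x : Grid d N) (s : ℝ) :
    ∫⁻ y, ENNReal.ofReal (Real.exp (s * M.F x y)) ∂(M.ξ x) ≤
      ENNReal.ofReal (Real.exp (s * M.f x + s ^ 2 * σ ^ 2 / 2)) := by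
  have h5 : ∀ y, Real.exp (s * M.F x y) =
      Real.exp (s * (M.F x y - M.f x)) * Real.exp (s * M.f x) := by
    intro y
    rw [← Real.exp_add]
    ring_nf
  simp_rw [h5]
  rw [← ofReal_integral_eq_lintegral_ofReal (((hF x).integrable_exp_mul s).mul_const _)
    (ae_of_all _ fun z => (mul_pos (Real.exp_pos _) (Real.exp_pos _)).le), integral_mul_const]
  apply ENNReal.ofReal_le_ofReal
  rw [add_comm, Real.exp_add]
  refine mul_le_mul_of_nonneg_right (((hF x).mgf_le s).trans (le_of_eq ?_)) (Real.exp_pos _).le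
  push_cast
  ring_nf

variable {d N : ℕ} [hN : Fact (2 ≤ N)]

/-- Weights of a comparison between the sample sums at the neighbouring points `j₀` and `j`. -/
noncomputable def contrast (lam : ℝ) (j₀ j k : ℕ) : ℝ :=
  lam * ((if k = j₀ then 1 else 0) - if k = j then 1 else 0)

/-- The logarithm of the bound for the moment generating function of one simulation at the `k`-th
neighbouring point of `x`, with weight `c k`. -/
noncomputable def stepBound (f : Grid d N → ℝ) (σ : ℝ≥0) (x : Cube d N) (c : ℕ → ℝ) (k : ℕ) : ℝ :=
  c k * f (neighbor x k) + c k ^ 2 * σ ^ 2 / 2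

/-- The exponent of the supermartingale for a weighted sum of the sample sums. -/
noncomputable def roundExponent (f : Grid d N → ℝ) (σ : ℝ≥0) (n : ℕ) (c : Cube d N → ℕ → ℝ)
    (s : ℕ × Cube d N × (Fin (d + 1) → ℝ)) : ℝ :=
  ∑ i : Fin (d + 1), c s.2.1 i * s.2.2 i +
    ∑ k ∈ Finset.Ico s.1 ((d + 1) * n), stepBound f σ s.2.1 (c s.2.1) (k % (d + 1))

/-- Needed because the rounding potential is a sum over candidates: an upper bound for the integral
of a sum does require measurability. -/
theorem measurable_roundExponent_roundNext (f : Grid d N → ℝ) (σ : ℝ≥0) {n : ℕ}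
    {c : Cube d N → ℕ → ℝ} {Ω : Type*} [MeasurableSpace Ω] {g : Ω → ℝ} (hg : Measurable g)
    (s : ℕ × Cube d N × (Fin (d + 1) → ℝ)) :
    Measurable fun y => roundExponent f σ n c (roundNext s (Sum.inl (g y))) := by
  have h : ∀ i : Fin (d + 1), Measurable fun y =>
      c s.2.1 i * (s.2.2 i + if (i : ℕ) = s.1 % (d + 1) then g y else 0) := by
    intro i
    refine Measurable.const_mul ?_ _
    split_ifs
    · exact hg.const_add _
    · exact measurable_const
  exact (Finset.measurable_fun_sum Finset.univ fun i _ => h i).add_const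
    (∑ k ∈ Finset.Ico (s.1 + 1) ((d + 1) * n), stepBound f σ s.2.1 (c s.2.1) (k % (d + 1)))

/-- One observation changes a single sample sum. Its moment generating function is bounded by the
exponential of the `stepBound` that leaves the sum over remaining simulations. -/
theorem lintegral_exp_roundExponent_le {M : SimModel.{u} d N} {σ : ℝ≥0}
    (hF : M.SubgaussianOutput σ) {n : ℕ} (c : Cube d N → ℕ → ℝ)
    (s : ℕ × Cube d N × (Fin (d + 1) → ℝ)) (hs : s.1 < (d + 1) * n) :
    ∫⁻ y, ENNReal.ofReal (Real.exp (roundExponent M.f σ n c (roundNext s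
      (Sum.inl (M.F (neighbor s.2.1 (s.1 % (d + 1))) y)))))
        ∂(M.ξ (neighbor s.2.1 (s.1 % (d + 1)))) ≤
      ENNReal.ofReal (Real.exp (roundExponent M.f σ n c s)) := by
  obtain ⟨k, x, V⟩ := s
  dsimp only at hs ⊢
  set j := k % (d + 1) with hj
  have hjd : j < d + 1 := Nat.mod_lt _ (Nat.succ_pos d)
  set A : ℝ := ∑ i : Fin (d + 1), c x i * V i +
    ∑ k ∈ Finset.Ico (k + 1) ((d + 1) * n), stepBound M.f σ x (c x) (k % (d + 1)) with hA
  have h1 : ∀ y, ENNReal.ofReal (Real.exp (roundExponent M.f σ n c (roundNext (k, x, V)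
      (Sum.inl (M.F (neighbor x j) y))))) = ENNReal.ofReal (Real.exp A) *
        ENNReal.ofReal (Real.exp (c x j * M.F (neighbor x j) y)) := by
    intro y
    rw [← ENNReal.ofReal_mul (Real.exp_pos _).le, ← Real.exp_add]
    congr 2
    simp only [roundExponent, roundNext, Sum.elim_inl, id, hA, mul_add, Finset.sum_add_distrib]
    have h2 : ∑ i : Fin (d + 1), c x i * (if (i : ℕ) = k % (d + 1) then M.F (neighbor x j) y else 0)
        = c x j * M.F (neighbor x j) y := by
      rw [Finset.sum_eq_single ⟨j, hjd⟩]
      · simp [hj]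
      · intro i _ hi
        have : (i : ℕ) ≠ k % (d + 1) := fun h => hi (Fin.ext h)
        simp [this]
      · simp
    rw [h2]
    ring
  simp_rw [h1]
  rw [lintegral_const_mul' _ _ ENNReal.ofReal_ne_top]
  refine (mul_le_mul_right (SimModel.lintegral_exp_output_le hF _ _) _).trans ?_
  rw [← ENNReal.ofReal_mul (Real.exp_pos _).le, ← Real.exp_add]
  apply le_of_eq
  congr 2
  simp only [roundExponent, hA, Finset.sum_eq_sum_Ico_succ_bot hs]
  rw [← hj]
  simp only [stepBound]
  ring

open Classical in
/-- The rounding procedure succeeds with high probability. -/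
theorem round_triple {M : SimModel.{u} d N} {σ : ℝ≥0} {γ ε : ℝ} {n : ℕ} (hσ : 0 < σ)
    (hF : M.SubgaussianOutput σ) (xs : Grid d N) (hε : 0 < ε) (hn : 0 < n) :
    Procedure.Triple (roundToGrid n) M γ
      (fun x _ => ENNReal.ofReal ((d + 1) * Real.exp (-(n * ε ^ 2 / (16 * σ ^ 2)))) +
        if convexExtension M.f x ≤ M.f xs + ε / 2 then 0 else 1)
      (fun x _ => if M.f x ≤ M.f xs + ε then 0 else 1) := by
  have hσ' : (0 : ℝ) < σ := hσ
  have hn' : (0 : ℝ) < n := by exact_mod_cast hn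
  -- Minimizes `-lam ε / 2 + lam² σ²`: a bad candidate is worse than the good one by at least `ε /
  -- 2`, and the contrast receives noise from both samples.
  set lam : ℝ := ε / (4 * σ ^ 2) with hlam
  have hlam0 : 0 < lam := by positivity
  choose j₀ hj₀d hj₀ using fun x : Cube d N => exists_neighbor_le M.f x
  let Good : Cube d N → Prop := fun x => convexExtension M.f x ≤ M.f xs + ε / 2
  let Bad : Cube d N → Finset (Fin (d + 1)) := fun x =>
    Finset.univ.filter fun j => M.f xs + ε < M.f (neighbor x j)
  let E : Fin (d + 1) → ℕ × Cube d N × (Fin (d + 1) → ℝ) → ℝ := fun j =>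
    roundExponent M.f σ n fun x => contrast lam (j₀ x) j
  have hE0 : ∀ x, Good x → ∀ j ∈ Bad x, E j (0, x, 0) ≤ -(n * ε ^ 2 / (16 * σ ^ 2)) := by
    intro x hx j hj
    have hbad : M.f xs + ε < M.f (neighbor x j) := by simpa [Bad] using hj
    have hne : (j : ℕ) ≠ j₀ x := by
      intro h
      rw [h] at hbad
      have := hj₀ x
      have : convexExtension M.f x ≤ M.f xs + ε / 2 := hx
      linarith
    simp only [E, roundExponent, Pi.zero_apply, mul_zero, Finset.sum_const_zero, zero_add]
    rw [← Finset.range_eq_Ico, sum_range_mul_mod (stepBound M.f σ x (contrast lam (j₀ x) j))]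
    have h1 : ∀ k ∈ Finset.range (d + 1), stepBound M.f σ x (contrast lam (j₀ x) j) k =
        (if k = j₀ x then lam * M.f (neighbor x (j₀ x)) + lam ^ 2 * σ ^ 2 / 2 else 0) +
        (if k = j then -lam * M.f (neighbor x j) + lam ^ 2 * σ ^ 2 / 2 else 0) := by
      intro k _
      unfold stepBound contrast
      split_ifs with h2 h3 h3
      · exact absurd (h3.symm.trans h2) hne
      · rw [h2]
        ring
      · rw [h3]
        ring
      · ring
    rw [Finset.sum_congr rfl h1, Finset.sum_add_distrib, Finset.sum_ite_eq',
      Finset.sum_ite_eq', if_pos (Finset.mem_range.2 (Nat.lt_succ_of_le (hj₀d x))),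
      if_pos (Finset.mem_range.2 j.2)]
    have h2 : convexExtension M.f x ≤ M.f xs + ε / 2 := hx
    have h3 := hj₀ x
    have h4 : lam * (M.f (neighbor x (j₀ x)) - M.f (neighbor x j)) ≤ lam * (-(ε / 2)) :=
      mul_le_mul_of_nonneg_left (by linarith) hlam0.le
    have h5 : lam * (-(ε / 2)) + lam ^ 2 * σ ^ 2 = -(ε ^ 2 / (16 * σ ^ 2)) := by
      rw [hlam]
      field_simp
      ring
    have h6 : n * (-(ε ^ 2 / (16 * (σ : ℝ) ^ 2))) = -(n * ε ^ 2 / (16 * σ ^ 2)) := by ring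
    rw [← h6]
    apply mul_le_mul_of_nonneg_left _ hn'.le
    linarith
  -- Union bound over the bad candidates. If one of them is returned, its sum does not exceed that
  -- of `j₀`, so its exponent is nonnegative and its term is at least `1`.
  refine ⟨fun s _ => if Good s.2.1 then ∑ j ∈ Bad s.2.1, ENNReal.ofReal (Real.exp (E j s)) else 1,
    fun x r => ?_, ?_, ?_⟩
  · dsimp only [roundToGrid]
    by_cases hx : Good x
    · rw [if_pos hx, if_pos hx, add_zero]
      calc _ ≤ ∑ j ∈ Bad x, ENNReal.ofReal (Real.exp (-(n * ε ^ 2 / (16 * σ ^ 2)))) :=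
            Finset.sum_le_sum fun j hj => ENNReal.ofReal_le_ofReal
              (Real.exp_le_exp.2 (hE0 x hx j hj))
        _ ≤ ∑ j : Fin (d + 1), ENNReal.ofReal (Real.exp (-(n * ε ^ 2 / (16 * σ ^ 2)))) :=
            Finset.sum_le_sum_of_subset (Finset.subset_univ _)
        _ = _ := by
            rw [ENNReal.ofReal_mul (by positivity)]
            simp only [Finset.sum_const, Finset.card_univ, Fintype.card_fin, nsmul_eq_mul]
            congr 1
            rw [← Nat.cast_succ, ENNReal.ofReal_natCast]
    · rw [if_neg hx, if_neg hx]
      exact le_add_self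
  · rintro ⟨k, x, V⟩ r b hb
    dsimp only [roundToGrid, roundAct] at hb ⊢
    by_cases hk : k < (d + 1) * n
    · simp [hk] at hb
    · simp only [hk, if_false, Sum.inr.injEq] at hb
      by_cases hx : Good x
      · rw [if_pos hx]
        split_ifs with hc
        · exact zero_le
        · set j := argminFin fun j => V j / n with hj
          have hjb : j ∈ Bad x := by
            simp only [Bad, Finset.mem_filter, Finset.mem_univ, true_and]
            rw [hb]
            exact not_le.1 hc
          have hmin : V j ≤ V ⟨j₀ x, Nat.lt_succ_of_le (hj₀d x)⟩ := by
            have h1 := ((argminFin_eq_iff (fun j => V j / n) j).1 hj.symm).1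
              ⟨j₀ x, Nat.lt_succ_of_le (hj₀d x)⟩
            exact (div_le_div_iff_of_pos_right hn').1 h1
          refine le_trans ?_ (Finset.single_le_sum (f := fun j =>
            ENNReal.ofReal (Real.exp (E j (k, x, V)))) (fun _ _ => zero_le) hjb)
          rw [← ENNReal.ofReal_one]
          apply ENNReal.ofReal_le_ofReal
          rw [Real.one_le_exp_iff]
          simp only [E, roundExponent, contrast, Finset.Ico_eq_empty (by omega : ¬ k < (d + 1) * n),
            Finset.sum_empty, add_zero]
          have h2 : ∑ i : Fin (d + 1), lam * ((if (i : ℕ) = j₀ x then 1 else 0) -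
              if (i : ℕ) = j then 1 else 0) * V i =
              lam * (V ⟨j₀ x, Nat.lt_succ_of_le (hj₀d x)⟩ - V j) := by
            simp only [mul_assoc, sub_mul, ite_mul, one_mul, zero_mul]
            rw [← Finset.mul_sum, Finset.sum_sub_distrib]
            congr 2
            · rw [Finset.sum_eq_single ⟨j₀ x, Nat.lt_succ_of_le (hj₀d x)⟩]
              · simp
              · intro i _ hi
                exact if_neg fun h => hi (Fin.ext h)
              · simp
            · rw [Finset.sum_eq_single j]
              · simp
              · intro i _ hi
                exact if_neg fun h => hi (Fin.ext h)
              · simp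
          rw [h2]
          exact mul_nonneg hlam0.le (by linarith)
      · rw [if_neg hx]
        split_ifs
        · exact zero_le
        · exact le_rfl
  · rintro ⟨k, x, V⟩ r q hq
    dsimp only [roundToGrid, roundAct] at hq ⊢
    by_cases hk : k < (d + 1) * n
    · simp only [hk, if_true, Sum.inl.injEq] at hq
      subst hq
      refine (lintegral_map_le _ _).trans ?_
      by_cases hx : Good x
      · have hx' : ∀ o, Good (roundNext (k, x, V) o).2.1 := fun o => hx
        simp only [if_pos hx, if_pos (hx' _)]
        change ∫⁻ y, ∑ j ∈ Bad x, _ ∂_ ≤ _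
        rw [lintegral_finsetSum']
        · exact Finset.sum_le_sum fun j _ => lintegral_exp_roundExponent_le hF _ (k, x, V) hk
        · exact fun j _ => (measurable_roundExponent_roundNext _ _ (M.measurable_F _)
            _).exp.ennreal_ofReal.aemeasurable
      · have hx' : ∀ o, ¬ Good (roundNext (k, x, V) o).2.1 := fun o => hx
        simp [hx, hx']
    · simp [hk] at hq

theorem round_bounded {γ : ℝ} (n : ℕ) :
    Procedure.Bounded (roundToGrid n : Procedure d N (Cube d N) (Grid d N)) γ ((d + 1) * n)
      ((d + 1) * n) := by
  refine ⟨fun s => (d + 1) * n - s.1, fun s => (((d + 1) * n - s.1 : ℕ) : ℝ), fun x => ?_,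
    fun s b _ => ?_, ?_⟩
  · simp [roundToGrid]
  · positivity
  · rintro ⟨k, x, V⟩ q hq o
    dsimp only [roundToGrid, roundAct, roundNext] at hq ⊢
    by_cases hk : k < (d + 1) * n
    · simp only [hk, if_true, Sum.inl.injEq] at hq
      subst hq
      refine ⟨by omega, ?_⟩
      have : (((d + 1) * n - k : ℕ) : ℝ) = ((d + 1) * n - (k + 1) : ℕ) + 1 := by
        exact_mod_cast (by omega : (d + 1) * n - k = (d + 1) * n - (k + 1) + 1)
      rw [this]
      simp only [queryCost]
      linarith
    · simp [hk] at hq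

end Rounding

open Filter Topology

/-! ### The prescribed parameters for small `δ` -/

section Parameters

theorem tendsto_log_one_div : Tendsto (fun δ : ℝ => Real.log (1 / δ)) (𝓝[>] 0) atTop := by
  have : (fun δ : ℝ => Real.log (1 / δ)) = fun δ => -Real.log δ := by
    funext δ
    rw [one_div, Real.log_inv]
  rw [this]
  exact tendsto_neg_atBot_atTop.comp Real.tendsto_log_nhdsGT_zero

theorem tendsto_numIter {κ : ℝ} (hκ : 0 < κ) {d : ℕ} (hd : 1 ≤ d) {D ε : ℝ} (hD : 0 < D)
    (hε : 0 < ε) : Tendsto (fun δ : ℝ => numIter κ d D ε δ) (𝓝[>] 0) atTop := by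
  have hd' : (0 : ℝ) < d := by exact_mod_cast hd
  have h : Tendsto (fun δ : ℝ => κ * (d * D ^ 2 / ε ^ 2 * Real.log (1 / δ))) (𝓝[>] 0) atTop :=
    (tendsto_log_one_div.const_mul_atTop (by positivity)).const_mul_atTop hκ
  exact tendsto_nat_ceil_atTop.comp h

/-- The truncation threshold and step size are eventually adequate as the number of iterations
grows. -/
theorem eventually_parameters {θ : ℝ} (hθ : 0 < θ) {d : ℕ} (hd : 1 ≤ d) {D ε : ℝ} (hD : 0 < D)
    (hε : 0 < ε) (b : ℝ) : ∀ᶠ T : ℕ in atTop, b ≤ truncThreshold θ d D ε T ∧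
      0 < stepSize D (truncThreshold θ d D ε T) T ∧
      d * D ^ 2 / (8 * stepSize D (truncThreshold θ d D ε T) T) +
        T * (stepSize D (truncThreshold θ d D ε T) T * (d * truncThreshold θ d D ε T ^ 2) / 2) ≤
          T * ε / 8 := by
  have hd' : (0 : ℝ) < d := by exact_mod_cast hd
  set a : ℝ := d * D / ε with ha
  have ha0 : 0 < a := by positivity
  have hthr : ∀ T : ℕ, truncThreshold θ d D ε T = θ * √(Real.log (a * T)) := fun T => by
    rw [truncThreshold, ha]
    ring_nf
  have hlin : Tendsto (fun T : ℕ => a * (T : ℝ)) atTop atTop :=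
    tendsto_natCast_atTop_atTop.const_mul_atTop ha0
  have hlim : Tendsto (fun T : ℕ => θ * √(Real.log (a * T))) atTop atTop :=
    (Real.tendsto_sqrt_atTop.comp (Real.tendsto_log_atTop.comp hlin)).const_mul_atTop hθ
  -- This is `(5 a M)² ≤ T` for the threshold `M`. For the prescribed step size the two error terms
  -- are `d D M √T / 8` and `d D M √T / 2`; their sum is `5 / 8` of `d D M √T`, whence the `5`.
  have hlog : ∀ᶠ T : ℕ in atTop, Real.log (a * T) * (θ ^ 2 * (5 * a) ^ 2) ≤ T := by
    have h1 := (Real.isLittleO_log_id_atTop.bound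
      (show (0 : ℝ) < 1 / (a * (θ ^ 2 * (5 * a) ^ 2)) by positivity))
    filter_upwards [hlin.eventually h1] with T hT
    rw [id, Real.norm_eq_abs, Real.norm_eq_abs,
      abs_of_nonneg (by positivity : 0 ≤ a * (T : ℝ))] at hT
    have h2 := (le_abs_self _).trans hT
    calc Real.log (a * T) * (θ ^ 2 * (5 * a) ^ 2)
        ≤ 1 / (a * (θ ^ 2 * (5 * a) ^ 2)) * (a * T) * (θ ^ 2 * (5 * a) ^ 2) := by gcongr
      _ = (T : ℝ) := by field_simp
  filter_upwards [hlim.eventually_ge_atTop b, hlim.eventually_ge_atTop 1, hlog,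
    eventually_ge_atTop 1] with T hb h1 hT hT1
  rw [hthr]
  set thr := θ * √(Real.log (a * T)) with hthr'
  have hTpos : (0 : ℝ) < T := by exact_mod_cast hT1
  have hs : 0 < √(T : ℝ) := Real.sqrt_pos.2 hTpos
  have hss : √(T : ℝ) ^ 2 = T := Real.sq_sqrt hTpos.le
  have hthr0 : 0 < thr := by linarith
  refine ⟨hb, div_pos hD (by positivity), ?_⟩
  have h5 : thr * (5 * a) ≤ √(T : ℝ) := by
    apply Real.le_sqrt_of_sq_le
    have hlog0 : 0 ≤ Real.log (a * T) := by
      by_contra hneg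
      rw [hthr', Real.sqrt_eq_zero_of_nonpos (not_le.1 hneg).le] at hthr0
      simp at hthr0
    have : thr ^ 2 = θ ^ 2 * Real.log (a * T) := by rw [hthr', mul_pow, Real.sq_sqrt hlog0]
    rw [mul_pow, this]
    linarith
  have e1 : d * D ^ 2 / (8 * stepSize D thr T) + T * (stepSize D thr T * (d * thr ^ 2) / 2) =
      ε / 8 * (√(T : ℝ) * (thr * (5 * a))) := by
    unfold stepSize
    rw [ha]
    nth_rewrite 2 [← hss]
    field_simp
    ring
  rw [e1]
  calc ε / 8 * (√(T : ℝ) * (thr * (5 * a))) ≤ ε / 8 * (√(T : ℝ) * √(T : ℝ)) := by gcongr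
    _ = T * ε / 8 := by rw [← sq, hss]; ring

variable {d N : ℕ} [hN : Fact (2 ≤ N)]

open Classical in
/-- The subgradient method with the parameters for precision `ε` and failing probability `δ` reaches
the precision `ε / 2` with probability at least `1 - δ / 2`, for small `δ`. -/
theorem eventually_ssgd_triple {τ : ℝ≥0} {κ θ D ε : ℝ} (hτ : 0 < τ) (hκ : 128 * (τ : ℝ) ^ 2 ≤ κ)
    (hθ : 0 < θ) (hd : 1 ≤ d) (hD : 0 < D) (hε : 0 < ε) (σ : ℝ≥0) (L B : ℝ) :
    ∀ᶠ δ : ℝ in 𝓝[>] 0, ∀ (M : SimModel.{u} d N) (γ : ℝ) (xs : Grid d N) (p : ℝ≥0∞),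
      M ∈ modelsMC d N σ τ L B →
      (∀ x : Cube d N, convexExtension M.f x - convexExtension M.f xs.toCube ≤
        ∑ i, M.meanG x i * (x.1 i - xs.toCube.1 i)) →
      Procedure.Triple (ssgd (D / 2) (numIter κ d D ε δ)
          (truncThreshold θ d D ε (numIter κ d D ε δ))
          (stepSize D (truncThreshold θ d D ε (numIter κ d D ε δ)) (numIter κ d D ε δ))) M γ
        (fun x _ => p + ENNReal.ofReal (δ / 2) +
          if ∀ i, |x.1 i - xs.1 i| ≤ D / 2 then 0 else 1)
        (fun x _ => p + if convexExtension M.f x ≤ M.f xs + ε / 2 then 0 else 1) := by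
  have hτ' : (0 : ℝ) < τ := hτ
  have hκ0 : 0 < κ := lt_of_lt_of_le (by positivity) hκ
  have hd' : (0 : ℝ) < d := by exact_mod_cast hd
  filter_upwards [(tendsto_numIter hκ0 hd hD hε).eventually
      (eventually_parameters hθ hd hD hε (truncBound d N τ L B (ε / 8))),
    tendsto_log_one_div.eventually_ge_atTop (Real.log 2), self_mem_nhdsWithin] with δ h1 h2 h3
  have hδ : 0 < δ := h3
  rintro M γ xs p ⟨hf, -, hL, hU, hB⟩ hxs
  refine (ssgd_triple hd hτ hL hB hf hxs hU.2 hD hε h1.2.1 h1.1 h1.2.2 p).mono fun x r => ?_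
  gcongr
  have hT : κ * (d * D ^ 2 / ε ^ 2 * Real.log (1 / δ)) ≤ numIter κ d D ε δ := Nat.le_ceil _
  have hlog : 0 ≤ Real.log (1 / δ) := (Real.log_nonneg one_le_two).trans h2
  -- `128 = 2 · 64` yields two copies of `log (1 / δ)`: one gives `δ`, the other exceeds `log 2` and
  -- gives the factor `1 / 2`.
  have h4 : 2 * Real.log (1 / δ) ≤ numIter κ d D ε δ * ε ^ 2 / (64 * τ ^ 2 * (d * D ^ 2)) := by
    rw [le_div_iff₀ (by positivity)]
    calc 2 * Real.log (1 / δ) * (64 * τ ^ 2 * (d * D ^ 2))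
        = 128 * τ ^ 2 * (d * D ^ 2 / ε ^ 2 * Real.log (1 / δ)) * ε ^ 2 := by
          field_simp
          ring
      _ ≤ κ * (d * D ^ 2 / ε ^ 2 * Real.log (1 / δ)) * ε ^ 2 := by gcongr
      _ ≤ _ := by gcongr
  calc Real.exp (-(numIter κ d D ε δ * ε ^ 2 / (64 * τ ^ 2 * (d * D ^ 2))))
      ≤ Real.exp (-Real.log (1 / δ) + -Real.log 2) := by
        apply Real.exp_le_exp.2
        linarith
    _ = δ / 2 := by
        rw [Real.exp_add, Real.exp_neg, Real.exp_neg, Real.exp_log (by positivity),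
          Real.exp_log (by positivity)]
        field_simp

open Classical in
/-- The rounding procedure turns precision `ε / 2` of the convex extension into precision `ε` with
probability at least `1 - δ / 2`, for small `δ`. -/
theorem eventually_round_triple {σ : ℝ≥0} {ε : ℝ} (hσ : 0 < σ) (hε : 0 < ε) :
    ∀ᶠ δ : ℝ in 𝓝[>] 0, ∀ (M : SimModel.{u} d N) (γ : ℝ) (xs : Grid d N),
      M.SubgaussianOutput σ →
      Procedure.Triple (roundToGrid (roundSamples σ ε δ)) M γ
        (fun x _ => ENNReal.ofReal (δ / 2) +
          if convexExtension M.f x ≤ M.f xs + ε / 2 then 0 else 1)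
        (fun x _ => if M.f x ≤ M.f xs + ε then 0 else 1) := by
  have hσ' : (0 : ℝ) < σ := hσ
  -- The sample size does not depend on `d`. It provides two copies of `log (1 / δ)`, and for `δ`
  -- small in terms of `d` the second one pays for the union over `d + 1` candidates.
  filter_upwards [tendsto_log_one_div.eventually_ge_atTop (Real.log (2 * (d + 1))),
    self_mem_nhdsWithin] with δ h2 h3 M γ xs hF
  have hδ : 0 < δ := h3
  have hd1 : (1 : ℝ) ≤ 2 * (d + 1) := by
    have : (0 : ℝ) ≤ d := by positivity
    linarith
  have hlog : 0 ≤ Real.log (1 / δ) := (Real.log_nonneg hd1).trans h2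
  have h8 : Real.log (8 / δ) = Real.log 8 + Real.log (1 / δ) := by
    rw [← Real.log_mul (by norm_num) (by positivity)]
    ring_nf
  have h80 : 0 < Real.log 8 := Real.log_pos (by norm_num)
  have hn : 32 * (σ : ℝ) ^ 2 / ε ^ 2 * Real.log (8 / δ) ≤ roundSamples σ ε δ := Nat.le_ceil _
  have hn0 : 0 < roundSamples σ ε δ := by
    apply Nat.ceil_pos.2
    have : 0 < Real.log (8 / δ) := by linarith
    positivity
  refine (round_triple hσ hF xs hε hn0).mono fun x r => ?_
  gcongr
  have h4 : 2 * Real.log (1 / δ) ≤ roundSamples σ ε δ * ε ^ 2 / (16 * σ ^ 2) := by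
    rw [le_div_iff₀ (by positivity)]
    calc 2 * Real.log (1 / δ) * (16 * σ ^ 2)
        ≤ 2 * Real.log (8 / δ) * (16 * σ ^ 2) := by
          have : Real.log (1 / δ) ≤ Real.log (8 / δ) := by linarith
          gcongr
      _ = 32 * (σ : ℝ) ^ 2 / ε ^ 2 * Real.log (8 / δ) * ε ^ 2 := by
          field_simp
          ring
      _ ≤ _ := by gcongr
  calc (d + 1) * Real.exp (-(roundSamples σ ε δ * ε ^ 2 / (16 * σ ^ 2)))
      ≤ (d + 1) * Real.exp (-Real.log (1 / δ) + -Real.log (2 * (d + 1))) := by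
        gcongr
        linarith
    _ = δ / 2 := by
        rw [Real.exp_add, Real.exp_neg, Real.exp_neg, Real.exp_log (by positivity),
          Real.exp_log (by positivity)]
        field_simp

theorem eventually_roundSamples_le {σ : ℝ≥0} {ε : ℝ} (hσ : 0 < σ) (hε : 0 < ε) :
    ∀ᶠ δ : ℝ in 𝓝[>] 0, (roundSamples σ ε δ : ℝ) ≤ 128 * σ ^ 2 / ε ^ 2 * Real.log (1 / δ) := by
  have hσ' : (0 : ℝ) < σ := hσ
  filter_upwards [tendsto_log_one_div.eventually_ge_atTop (Real.log 8),
    tendsto_log_one_div.eventually_ge_atTop (1 / (64 * σ ^ 2 / ε ^ 2)),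
    self_mem_nhdsWithin] with δ h1 h2 h3
  have hδ : 0 < δ := h3
  have h8 : Real.log (8 / δ) = Real.log 8 + Real.log (1 / δ) := by
    rw [← Real.log_mul (by norm_num) (by positivity)]
    ring_nf
  have h80 : 0 < Real.log 8 := Real.log_pos (by norm_num)
  have h0 : 0 ≤ 32 * (σ : ℝ) ^ 2 / ε ^ 2 * Real.log (8 / δ) := by
    have : 0 ≤ Real.log (8 / δ) := by linarith
    positivity
  have h4 : 1 ≤ 64 * (σ : ℝ) ^ 2 / ε ^ 2 * Real.log (1 / δ) := by
    rwa [div_le_iff₀' (by positivity)] at h2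
  have h5 : 32 * (σ : ℝ) ^ 2 / ε ^ 2 * Real.log (8 / δ) ≤
      32 * (σ : ℝ) ^ 2 / ε ^ 2 * (2 * Real.log (1 / δ)) := by
    gcongr
    linarith
  have h6 := (Nat.ceil_lt_add_one h0).le
  unfold roundSamples
  refine h6.trans ?_
  have e1 : 32 * (σ : ℝ) ^ 2 / ε ^ 2 * (2 * Real.log (1 / δ)) =
    64 * (σ : ℝ) ^ 2 / ε ^ 2 * Real.log (1 / δ) := by ring
  have e2 : 128 * (σ : ℝ) ^ 2 / ε ^ 2 * Real.log (1 / δ) =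
    2 * (64 * (σ : ℝ) ^ 2 / ε ^ 2 * Real.log (1 / δ)) := by ring
  linarith

theorem eventually_numIter_le {κ : ℝ} (hκ : 0 < κ) {d : ℕ} (hd : 1 ≤ d) {D ε : ℝ} (hD : 0 < D)
    (hε : 0 < ε) : ∀ᶠ δ : ℝ in 𝓝[>] 0,
      (numIter κ d D ε δ : ℝ) ≤ 2 * κ * (d * D ^ 2 / ε ^ 2 * Real.log (1 / δ)) := by
  have hd' : (0 : ℝ) < d := by exact_mod_cast hd
  filter_upwards [tendsto_log_one_div.eventually_ge_atTop (1 / (κ * (d * D ^ 2 / ε ^ 2)))]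
    with δ h1
  rw [div_le_iff₀' (by positivity)] at h1
  have h6 := (Nat.ceil_lt_add_one (a := κ * (d * D ^ 2 / ε ^ 2 * Real.log (1 / δ)))
    (by linarith)).le
  unfold numIter
  linarith

/-- The ratio of width to precision is `4 / c` in every epoch. This is what removes the factor `N²`.
-/
theorem numIter_epoch (κ : ℝ) (d : ℕ) {N : ℕ} (hN : N ≠ 0) (c δ : ℝ) (e : ℕ) :
    numIter κ d ((N : ℝ) / 2 ^ e) (c * N / 4 / 2 ^ e) δ = numIter κ d 4 c δ := by
  have hN' : (N : ℝ) ≠ 0 := by exact_mod_cast hN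
  unfold numIter
  rcases eq_or_ne c 0 with rfl | hc
  · simp
  · have : d * ((N : ℝ) / 2 ^ e) ^ 2 / (c * N / 4 / 2 ^ e) ^ 2 = d * 4 ^ 2 / c ^ 2 := by
      field_simp
    rw [this]

/-- As `log 2 > 1 / 2`, the part `⌈log₂ N⌉ - 1` is at most `2 log N`, and the remaining `2` is at
most `4 log N`. -/
theorem numEpochs_le {N : ℕ} (hN : 2 ≤ N) : (numEpochs N : ℝ) ≤ 6 * Real.log N := by
  have hN' : (2 : ℝ) ≤ N := by exact_mod_cast hN
  have h2 : 1 / 2 < Real.log 2 := by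
    have := Real.log_two_gt_d9
    linarith
  have hlogN : Real.log 2 ≤ Real.log N := Real.log_le_log (by norm_num) hN'
  have h1 : 2 ^ (Nat.clog 2 N - 1) < N := Nat.pow_pred_clog_lt_self one_lt_two (by omega)
  have h3 : 1 ≤ Nat.clog 2 N := Nat.clog_pos one_lt_two hN
  have h4 : ((Nat.clog 2 N - 1 : ℕ) : ℝ) * Real.log 2 ≤ Real.log N := by
    rw [← Real.log_pow]
    exact Real.log_le_log (by positivity) (by exact_mod_cast h1.le)
  have h5 : (numEpochs N : ℝ) = ((Nat.clog 2 N - 1 : ℕ) : ℝ) + 2 := by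
    unfold numEpochs
    exact_mod_cast (by omega : Nat.clog 2 N + 1 = Nat.clog 2 N - 1 + 2)
  have h6 : (0 : ℝ) ≤ ((Nat.clog 2 N - 1 : ℕ) : ℝ) := by positivity
  rw [h5]
  nlinarith

end Parameters

/-! ### Guarantees and costs of the two algorithms -/

section Guarantees

open Classical in
theorem ofReal_one_sub_le_measure {X : Type*} [MeasurableSpace X] {μ : Measure X}
    [IsProbabilityMeasure μ] {S : Set X} (hS : MeasurableSet S) {δ : ℝ} (hδ : 0 ≤ δ)
    (h : ∫⁻ x, (if x ∈ S then 0 else 1) ∂μ ≤ ENNReal.ofReal δ) : ENNReal.ofReal (1 - δ) ≤ μ S := by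
  have h1 : μ Sᶜ ≤ ENNReal.ofReal δ := by
    refine le_trans (le_of_eq ?_) h
    rw [← lintegral_indicator_one hS.compl]
    refine lintegral_congr fun x => ?_
    by_cases hx : x ∈ S <;> simp [hx]
  rw [ENNReal.ofReal_sub _ hδ, ENNReal.ofReal_one]
  have h2 : 1 - μ Sᶜ = μ S := by
    rw [← prob_compl_eq_one_sub hS.compl, compl_compl]
  rw [← h2]
  exact tsub_le_tsub_left h1 1

theorem tendsto_div_const_nhdsGT {a : ℝ} (ha : 0 < a) :
    Tendsto (fun δ : ℝ => δ / a) (𝓝[>] 0) (𝓝[>] 0) := by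
  refine tendsto_nhdsWithin_iff.2 ⟨?_, ?_⟩
  · have : Tendsto (fun δ : ℝ => δ / a) (𝓝 0) (𝓝 (0 / a)) := tendsto_id.div_const _
    rw [zero_div] at this
    exact this.mono_left nhdsWithin_le_nhds
  · filter_upwards [self_mem_nhdsWithin] with δ hδ
    exact div_pos hδ ha

theorem exists_of_eventually_nhdsGT {P : ℝ → Prop} (h : ∀ᶠ δ in 𝓝[>] 0, P δ) :
    ∃ δ₀ : ℝ, 0 < δ₀ ∧ ∀ δ : ℝ, 0 < δ → δ < δ₀ → P δ := by
  obtain ⟨δ₀, hδ₀, hs⟩ := mem_nhdsGT_iff_exists_Ioo_subset.1 h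
  exact ⟨δ₀, hδ₀, fun δ h1 h2 => hs ⟨h1, h2⟩⟩

variable {d N : ℕ}

theorem cost_conclusion {O : Guarantee.{u} d N} {models : Set (SimModel.{u} d N)} {γ : ℝ}
    {A : SimAlgorithm d N} {n : ℕ} {C bound : ℝ} (hA : IsAlgorithmFor O models γ A)
    (hb : Procedure.Bounded A γ n C) (hC : C ≤ bound) :
    IsAlgorithmFor O models γ A ∧ CostAtMost models γ A bound ∧
      expectedSimulationCost O models γ ≤ ENNReal.ofReal bound := by
  have hcost : CostAtMost models γ A bound := fun M _ => by
    filter_upwards [hb.ae_cost_le (M := M) ()] with p hp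
    exact hp.trans hC
  refine ⟨hA, hcost, iInf₂_le_of_le A hA (iSup₂_le fun M hM => ?_)⟩
  have := (hA M hM).1
  calc ∫⁻ p, ENNReal.ofReal p.2 ∂(A.outcomeLaw M γ ())
      ≤ ∫⁻ _, ENNReal.ofReal bound ∂(A.outcomeLaw M γ ()) :=
        lintegral_mono_ae ((hcost M hM).mono fun p hp => ENNReal.ofReal_le_ofReal hp)
    _ = ENNReal.ofReal bound := by simp

open Classical in
theorem measure_le_of_triple {M : SimModel.{u} d N} {γ v δ : ℝ} {A : SimAlgorithm d N}
    {pre : ℝ≥0∞} [IsProbabilityMeasure (A.outcomeLaw M γ ())] (hδ : 0 ≤ δ)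
    (hA : Procedure.Triple A M γ (fun _ _ => pre) (fun x _ => if M.f x ≤ v then 0 else 1))
    (hpre : pre ≤ ENNReal.ofReal δ) :
    ENNReal.ofReal (1 - δ) ≤ (A.outcomeLaw M γ ()) {p | M.f p.1 ≤ v} :=
  ofReal_one_sub_le_measure ((MeasurableSet.of_discrete (s := {x | M.f x ≤ v})).preimage
    measurable_fst) hδ ((hA.lintegral_outcomeLaw_le ()).trans hpre)

variable [hN : Fact (2 ≤ N)]

theorem abs_startPoint_sub_le (xs : Grid d N) (i : Fin d) :
    |(startPoint : Cube d N).1 i - xs.1 i| ≤ (N : ℝ) / 2 := by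
  have h := xs.toCube.2 i
  change |(N : ℝ) / 2 - xs.1 i| ≤ N / 2
  have h1 : (1 : ℝ) ≤ xs.1 i := h.1
  have h2 : (xs.1 i : ℝ) ≤ N := h.2
  rw [abs_le]
  constructor <;> linarith

theorem ssgdPGS_bounded {σ : ℝ≥0} {ε δ γ M step : ℝ} {T : ℕ} (hγ : 0 ≤ γ) :
    Procedure.Bounded (ssgdPGS σ ε δ T M step : SimAlgorithm d N) γ
      (0 + T + (d + 1) * roundSamples σ ε δ) (0 + γ * T + (d + 1) * roundSamples σ ε δ) :=
  ((Procedure.Bounded.pure startPoint).andThen (ssgd_bounded hγ)).andThen (round_bounded _)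

theorem eventually_isAlgorithmFor_ssgdPGS {σ τ : ℝ≥0} {κ θ ε : ℝ} (hσ : 0 < σ) (hτ : 0 < τ)
    (hκ : 128 * (τ : ℝ) ^ 2 ≤ κ) (hθ : 0 < θ) (hd : 1 ≤ d) (hε : 0 < ε) (L B : ℝ) :
    ∀ᶠ δ : ℝ in 𝓝[>] 0, ∀ γ : ℝ, 0 ≤ γ →
      IsAlgorithmFor (PGS ε δ) (modelsMC.{u} d N σ τ L B) γ
        (ssgdPGS σ ε δ (numIter κ d N ε δ) (truncThreshold θ d N ε (numIter κ d N ε δ))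
          (stepSize N (truncThreshold θ d N ε (numIter κ d N ε δ)) (numIter κ d N ε δ))) := by
  classical
  have hN0 : (0 : ℝ) < N := by exact_mod_cast (zero_lt_two.trans_le hN.out)
  filter_upwards [eventually_ssgd_triple (N := N) hτ hκ hθ hd hN0 hε σ L B,
    eventually_round_triple (d := d) (N := N) hσ hε, self_mem_nhdsWithin] with δ h1 h2 h3 γ hγ M hM
  have hδ : 0 < δ := h3
  have hprob := (ssgdPGS_bounded (d := d) (N := N) (σ := σ) (ε := ε) (δ := δ)
    (M := truncThreshold θ d N ε (numIter κ d N ε δ))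
    (step := stepSize N (truncThreshold θ d N ε (numIter κ d N ε δ)) (numIter κ d N ε δ))
    (T := numIter κ d N ε δ) hγ).isProbabilityMeasure_outcomeLaw (M := M) ()
  refine ⟨hprob, ?_⟩
  obtain ⟨xs, hmin, hxs⟩ := hM.2.2.2.1.1
  -- The budget splits evenly: `δ / 2` is reserved for rounding while SSGD spends its own `δ / 2`.
  -- The box about the starting point contains every grid point, so the start is always good.
  have hT := ((Procedure.Triple.pure startPoint _).andThen
    (h1 M γ xs (ENNReal.ofReal (δ / 2)) hM hxs)).andThen (h2 M γ xs hM.2.1)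
  rw [if_pos (abs_startPoint_sub_le xs), add_zero,
    ← ENNReal.ofReal_add (by positivity) (by positivity), add_halves] at hT
  refine (measure_le_of_triple (A := ssgdPGS σ ε δ _ _ _) hδ.le hT le_rfl).trans
    (measure_mono fun p hp y => ?_)
  have h4 : M.f p.1 ≤ M.f xs + ε := hp
  have h5 := hmin y
  linarith

theorem adaptiveEpochs_bounded {κ θ c δ γ : ℝ} (hγ : 0 ≤ γ) (e : ℕ) :
    Procedure.Bounded (adaptiveEpochs κ θ c δ e : Procedure d N Unit (Cube d N)) γ
      (e * numIter κ d 4 c (δ / (2 * numEpochs N)))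
      (e * (γ * numIter κ d 4 c (δ / (2 * numEpochs N)))) := by
  induction e with
  | zero => simpa using! Procedure.Bounded.pure startPoint
  | succ e ih =>
    have h := ih.andThen (ssgd_bounded (d := d) (N := N) (a := (N : ℝ) / 2 ^ e / 2)
      (thr := truncThreshold θ d ((N : ℝ) / 2 ^ e) (c * N / 4 / 2 ^ e)
        (numIter κ d ((N : ℝ) / 2 ^ e) (c * N / 4 / 2 ^ e) (δ / (2 * numEpochs N))))
      (step := stepSize ((N : ℝ) / 2 ^ e) (truncThreshold θ d ((N : ℝ) / 2 ^ e) (c * N / 4 / 2 ^ e)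
        (numIter κ d ((N : ℝ) / 2 ^ e) (c * N / 4 / 2 ^ e) (δ / (2 * numEpochs N))))
        (numIter κ d ((N : ℝ) / 2 ^ e) (c * N / 4 / 2 ^ e) (δ / (2 * numEpochs N))))
      (T := numIter κ d ((N : ℝ) / 2 ^ e) (c * N / 4 / 2 ^ e) (δ / (2 * numEpochs N))) hγ)
    have hT := numIter_epoch κ d (by have := hN.out; omega : N ≠ 0) c (δ / (2 * numEpochs N)) e
    have e1 : (e + 1) * numIter κ d 4 c (δ / (2 * numEpochs N)) =
        e * numIter κ d 4 c (δ / (2 * numEpochs N)) + numIter κ d ((N : ℝ) / 2 ^ e)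
          (c * N / 4 / 2 ^ e) (δ / (2 * numEpochs N)) := by
      rw [hT]
      ring
    have e2 : ((e + 1 : ℕ) : ℝ) * (γ * numIter κ d 4 c (δ / (2 * numEpochs N))) =
        e * (γ * numIter κ d 4 c (δ / (2 * numEpochs N))) + γ * numIter κ d ((N : ℝ) / 2 ^ e)
          (c * N / 4 / 2 ^ e) (δ / (2 * numEpochs N)) := by
      rw [hT]
      push_cast
      ring
    rw [e1, e2]
    exact h

theorem adaptiveSSGD_bounded {σ : ℝ≥0} {κ θ c δ γ : ℝ} (hγ : 0 ≤ γ) :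
    Procedure.Bounded (adaptiveSSGD σ κ θ c δ : SimAlgorithm d N) γ
      (numEpochs N * numIter κ d 4 c (δ / (2 * numEpochs N)) + (d + 1) * roundSamples σ (c / 2) δ)
      (numEpochs N * (γ * numIter κ d 4 c (δ / (2 * numEpochs N))) +
        (d + 1) * roundSamples σ (c / 2) δ) :=
  (adaptiveEpochs_bounded hγ _).andThen (round_bounded _)

open Classical in
/-- The epochs of the adaptive method, given the guarantee for each run of the subgradient method,
localize the minimizer. -/
theorem adaptiveEpochs_triple {M : SimModel.{u} d N} {κ θ c δ γ : ℝ} {xs : Grid d N} {q : ℝ≥0∞}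
    (hc : 0 < c) (hf : LNatConvex M.f) (hIZ : ∀ x, x ≠ xs → M.f xs + c ≤ M.f x) {m : ℕ}
    (h : ∀ e < m, ∀ p : ℝ≥0∞, Procedure.Triple
      (ssgd ((N : ℝ) / 2 ^ e / 2)
        (numIter κ d ((N : ℝ) / 2 ^ e) (c * N / 4 / 2 ^ e) (δ / (2 * numEpochs N)))
        (truncThreshold θ d ((N : ℝ) / 2 ^ e) (c * N / 4 / 2 ^ e)
          (numIter κ d ((N : ℝ) / 2 ^ e) (c * N / 4 / 2 ^ e) (δ / (2 * numEpochs N))))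
        (stepSize ((N : ℝ) / 2 ^ e) (truncThreshold θ d ((N : ℝ) / 2 ^ e) (c * N / 4 / 2 ^ e)
          (numIter κ d ((N : ℝ) / 2 ^ e) (c * N / 4 / 2 ^ e) (δ / (2 * numEpochs N))))
          (numIter κ d ((N : ℝ) / 2 ^ e) (c * N / 4 / 2 ^ e) (δ / (2 * numEpochs N))))) M γ
      (fun x _ => p + q + if ∀ i, |x.1 i - xs.1 i| ≤ (N : ℝ) / 2 ^ e / 2 then 0 else 1)
      (fun x _ => p + if convexExtension M.f x ≤ M.f xs + c * N / 4 / 2 ^ e / 2 then 0 else 1))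
    (p : ℝ≥0∞) :
    Procedure.Triple (adaptiveEpochs κ θ c δ m) M γ (fun _ _ => p + m * q)
      (fun x _ => p + if ∀ i, |x.1 i - xs.1 i| ≤ (N : ℝ) / 2 ^ m / 2 then 0 else 1) := by
  induction m generalizing p with
  | zero =>
    refine (Procedure.Triple.pure startPoint _).mono fun _ _ => ?_
    have : ∀ i, |(startPoint : Cube d N).1 i - xs.1 i| ≤ (N : ℝ) / 2 ^ 0 / 2 := fun i => by
      simpa using abs_startPoint_sub_le xs i
    rw [if_pos this]
    simp
  | succ m ih =>
    have h1 := ih (fun e he => h e (by omega)) (p + q)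
    have h2 := (h1.andThen (h m (Nat.lt_succ_self m) p)).mono
      (pre' := fun _ _ => p + ((m + 1 : ℕ) : ℝ≥0∞) * q) fun _ _ => by
        push_cast
        rw [add_mul, one_mul, add_assoc, add_comm q]
    refine h2.mono_post fun x _ => ?_
    gcongr
    split_ifs with h3 h4 h4
    · exact le_rfl
    · exact zero_le
    · exfalso
      apply h3
      intro i
      -- Precision `ε_m / 2 = c N / (8 · 2^m)` localizes `xs` within `N / (8 · 2^m)`, half the
      -- radius of the next box.
      have h5 := hf.sharp_convexExtension hc.le hIZ x i
      have h6 : c * |x.1 i - xs.1 i| ≤ c * (N / 4 / 2 ^ m / 2) := by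
        have : c * (N / 4 / 2 ^ m / 2) = c * N / 4 / 2 ^ m / 2 := by ring
        linarith
      have h7 := le_of_mul_le_mul_left h6 hc
      refine h7.trans ?_
      rw [pow_succ]
      have : (N : ℝ) / (2 ^ m * 2) / 2 = 2 * (N / 4 / 2 ^ m / 2) := by
        field_simp
        norm_num
      rw [this]
      have : (0 : ℝ) ≤ N / 4 / 2 ^ m / 2 := by positivity
      linarith
    · exact le_rfl

theorem eventually_isAlgorithmFor_adaptiveSSGD {σ τ : ℝ≥0} {κ θ c : ℝ} (hσ : 0 < σ) (hτ : 0 < τ)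
    (hκ : 128 * (τ : ℝ) ^ 2 ≤ κ) (hθ : 0 < θ) (hd : 1 ≤ d) (hc : 0 < c) (L B : ℝ) :
    ∀ᶠ δ : ℝ in 𝓝[>] 0, ∀ γ : ℝ, 0 ≤ γ →
      IsAlgorithmFor (PCSIZ δ) (modelsMCc.{u} d N σ τ L B c) γ (adaptiveSSGD σ κ θ c δ) := by
  classical
  have hN0 : (0 : ℝ) < N := by exact_mod_cast (zero_lt_two.trans_le hN.out)
  have hE0 : (0 : ℝ) < 2 * numEpochs N := by
    have : 0 < numEpochs N := Nat.succ_pos _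
    positivity
  -- There are finitely many epochs for given `N`, so one bound on `δ` serves all of them.
  have hall := (Finset.eventually_all (Finset.range (numEpochs N))).2 fun e _ =>
    (tendsto_div_const_nhdsGT hE0).eventually (eventually_ssgd_triple.{u} (N := N) hτ hκ hθ hd
      (by positivity : 0 < (N : ℝ) / 2 ^ e) (by positivity : 0 < c * N / 4 / 2 ^ e) σ L B)
  filter_upwards [hall, eventually_round_triple (d := d) (N := N) hσ (half_pos hc),
    self_mem_nhdsWithin] with δ h1 h2 h3 γ hγ M hM
  have hδ : 0 < δ := h3
  have hprob := (adaptiveSSGD_bounded (d := d) (N := N) (σ := σ) (κ := κ) (θ := θ) (c := c)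
    (δ := δ) hγ).isProbabilityMeasure_outcomeLaw (M := M) ()
  refine ⟨hprob, ?_⟩
  obtain ⟨hM, ys, hys⟩ := hM
  obtain ⟨xs, hmin, hxs⟩ := hM.2.2.2.1.1
  have hxy : xs = ys := by
    by_contra hne
    have := hys xs hne
    have := hmin ys
    linarith
  subst hxy
  set q : ℝ≥0∞ := ENNReal.ofReal (δ / (2 * numEpochs N) / 2) with hq
  have hep := fun (e : ℕ) (he : e < numEpochs N) (p : ℝ≥0∞) =>
    h1 e (Finset.mem_range.2 he) M γ xs p hM hxs
  -- The last epoch is kept apart: rounding needs its guarantee in value, not the localization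
  -- derived from it.
  have hT1 := adaptiveEpochs_triple (m := Nat.clog 2 N) hc hM.1 hys
    (fun e he => hep e (he.trans (Nat.lt_succ_self _))) (ENNReal.ofReal (δ / 2) + q)
  have hT2 := hT1.andThen (hep (Nat.clog 2 N) (Nat.lt_succ_self _) (ENNReal.ofReal (δ / 2)))
  have hT3 : Procedure.Triple (adaptiveEpochs κ θ c δ (numEpochs N)) M γ _ _ := hT2.mono_post
    (post' := fun x _ => ENNReal.ofReal (δ / 2) +
      if convexExtension M.f x ≤ M.f xs + c / 2 / 2 then 0 else 1) fun x _ => by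
      gcongr
      split_ifs with h3 h4 h4
      · exact le_rfl
      · exact zero_le
      · exfalso
        apply h3
        refine h4.trans ?_
        -- Hence the last precision is at most `c / 4`, so its half is below the `(c / 2) / 2` that
        -- rounding with precision `c / 2` asks for.
        have h5 : (N : ℝ) ≤ 2 ^ Nat.clog 2 N := by
          exact_mod_cast Nat.le_pow_clog one_lt_two N
        have h6 : c * N / 4 / 2 ^ Nat.clog 2 N ≤ c / 4 := by
          rw [div_le_iff₀ (by positivity)]
          nlinarith
        linarith
      · exact le_rfl
  have hT4 := hT3.andThen (h2 M γ xs hM.2.1)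
  -- The `E` epochs fail with total probability at most `E q = δ / 4`.
  have hpre : ENNReal.ofReal (δ / 2) + q + (Nat.clog 2 N : ℝ≥0∞) * q ≤ ENNReal.ofReal δ := by
    have : (Nat.clog 2 N : ℝ≥0∞) = ENNReal.ofReal (Nat.clog 2 N : ℝ) :=
      (ENNReal.ofReal_natCast _).symm
    rw [this, hq, ← ENNReal.ofReal_mul (by positivity),
      ← ENNReal.ofReal_add (by positivity) (by positivity),
      ← ENNReal.ofReal_add (by positivity) (by positivity)]
    apply ENNReal.ofReal_le_ofReal
    have : (numEpochs N : ℝ) = Nat.clog 2 N + 1 := by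
      unfold numEpochs
      push_cast
      ring
    have h7 : (numEpochs N : ℝ) * (δ / (2 * numEpochs N) / 2) = δ / 4 := by
      have : (numEpochs N : ℝ) ≠ 0 := by
        intro h
        simp [h] at hE0
      field_simp
      norm_num
    rw [this] at h7 ⊢
    linarith
  refine (measure_le_of_triple (A := adaptiveSSGD σ κ θ c δ) hδ.le hT4 hpre).trans (measure_mono fun p hp y => ?_)
  have h4 : M.f p.1 ≤ M.f xs + c / 2 := hp
  -- A suboptimal point would be worse by at least `c`, contradicting precision `c / 2`.
  by_cases hpx : p.1 = xs
  · rw [hpx]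
    exact hmin y
  · have := hys p.1 hpx
    linarith

theorem eventually_cost_ssgdPGS_le {σ : ℝ≥0} {κ ε : ℝ} (hσ : 0 < σ) (hκ : 0 < κ) (hd : 1 ≤ d)
    (hε : 0 < ε) : ∀ᶠ δ : ℝ in 𝓝[>] 0, ∀ γ : ℝ, 1 ≤ γ →
      0 + γ * numIter κ d N ε δ + (d + 1) * roundSamples σ ε δ ≤
        (384 * κ + 2048 * σ ^ 2) * (γ * d * N ^ 2 / ε ^ 2 * Real.log (1 / δ)) := by
  have hd' : (1 : ℝ) ≤ d := by exact_mod_cast hd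
  have hN1 : (1 : ℝ) ≤ N := by exact_mod_cast (one_le_two.trans hN.out)
  filter_upwards [eventually_numIter_le hκ hd (by linarith : (0 : ℝ) < N) hε,
    eventually_roundSamples_le hσ hε, tendsto_log_one_div.eventually_ge_atTop 0]
    with δ h1 h2 h3 γ hγ
  have hγ0 : 0 ≤ γ := by linarith
  have h4 : (1 : ℝ) ≤ γ * N ^ 2 := one_le_mul_of_one_le_of_one_le hγ (one_le_pow₀ hN1)
  have h5 : (d + 1) * (roundSamples σ ε δ : ℝ) ≤
      256 * σ ^ 2 * (γ * d * N ^ 2 / ε ^ 2 * Real.log (1 / δ)) := by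
    calc (d + 1) * (roundSamples σ ε δ : ℝ)
        ≤ (2 * d) * (128 * σ ^ 2 / ε ^ 2 * Real.log (1 / δ)) := by
          gcongr
          linarith
      _ = 256 * σ ^ 2 * (d / ε ^ 2 * Real.log (1 / δ)) * 1 := by ring
      _ ≤ 256 * σ ^ 2 * (d / ε ^ 2 * Real.log (1 / δ)) * (γ * N ^ 2) := by gcongr
      _ = _ := by ring
  have h6 : γ * (numIter κ d N ε δ : ℝ) ≤
      2 * κ * (γ * d * N ^ 2 / ε ^ 2 * Real.log (1 / δ)) := by
    calc γ * (numIter κ d N ε δ : ℝ) ≤ γ * (2 * κ * (d * N ^ 2 / ε ^ 2 * Real.log (1 / δ))) := by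
          gcongr
      _ = _ := by ring
  have h7 : 0 ≤ γ * d * N ^ 2 / ε ^ 2 * Real.log (1 / δ) := by positivity
  nlinarith [mul_nonneg hκ.le h7, mul_nonneg (sq_nonneg (σ : ℝ)) h7]

theorem eventually_cost_adaptiveSSGD_le {σ : ℝ≥0} {κ c : ℝ} (hσ : 0 < σ) (hκ : 0 < κ)
    (hd : 1 ≤ d) (hc : 0 < c) : ∀ᶠ δ : ℝ in 𝓝[>] 0, ∀ γ : ℝ, 1 ≤ γ →
      numEpochs N * (γ * numIter κ d 4 c (δ / (2 * numEpochs N))) +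
          (d + 1) * roundSamples σ (c / 2) δ ≤
        (384 * κ + 2048 * σ ^ 2) * (γ * d * Real.log N / c ^ 2 * Real.log (1 / δ)) := by
  have hd' : (1 : ℝ) ≤ d := by exact_mod_cast hd
  have hE0 : (0 : ℝ) < 2 * numEpochs N := by
    have : 0 < numEpochs N := Nat.succ_pos _
    positivity
  have hE := numEpochs_le hN.out
  have hlogN : 1 ≤ 2 * Real.log N := by
    have h1 := Real.log_two_gt_d9
    have h2 : Real.log 2 ≤ Real.log N :=
      Real.log_le_log (by norm_num) (by exact_mod_cast hN.out)
    linarith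
  filter_upwards [(tendsto_div_const_nhdsGT hE0).eventually
      (eventually_numIter_le hκ hd (by norm_num : (0 : ℝ) < 4) hc),
    eventually_roundSamples_le hσ (half_pos hc), tendsto_log_one_div.eventually_ge_atTop 0,
    tendsto_log_one_div.eventually_ge_atTop (Real.log (2 * numEpochs N)), self_mem_nhdsWithin]
    with δ h1 h2 h3 h4 h5 γ hγ
  have hδ : 0 < δ := h5
  have hγ0 : 0 ≤ γ := by linarith
  have hlogN0 : 0 ≤ Real.log N := by linarith
  -- Once `log (2 E) ≤ log (1 / δ)`, dividing `δ` among the epochs costs only a factor `2`, not an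
  -- extra `log log N`.
  have h6 : Real.log (1 / (δ / (2 * numEpochs N))) ≤ 2 * Real.log (1 / δ) := by
    have : 1 / (δ / (2 * numEpochs N)) = (2 * numEpochs N) * (1 / δ) := by field_simp
    rw [this, Real.log_mul hE0.ne' (by positivity)]
    linarith
  have h7 : (numIter κ d 4 c (δ / (2 * numEpochs N)) : ℝ) ≤
      64 * κ * (d / c ^ 2 * Real.log (1 / δ)) := by
    calc _ ≤ 2 * κ * (d * 4 ^ 2 / c ^ 2 * (2 * Real.log (1 / δ))) := by
          refine h1.trans ?_
          gcongr
      _ = _ := by ring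
  have h8 : numEpochs N * (γ * numIter κ d 4 c (δ / (2 * numEpochs N))) ≤
      384 * κ * (γ * d * Real.log N / c ^ 2 * Real.log (1 / δ)) := by
    calc _ ≤ 6 * Real.log N * (γ * (64 * κ * (d / c ^ 2 * Real.log (1 / δ)))) := by gcongr
      _ = _ := by ring
  have h9 : (1 : ℝ) ≤ γ * (2 * Real.log N) := one_le_mul_of_one_le_of_one_le hγ hlogN
  have h10 : (d + 1) * (roundSamples σ (c / 2) δ : ℝ) ≤
      2048 * σ ^ 2 * (γ * d * Real.log N / c ^ 2 * Real.log (1 / δ)) := by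
    calc (d + 1) * (roundSamples σ (c / 2) δ : ℝ)
        ≤ (2 * d) * (128 * σ ^ 2 / (c / 2) ^ 2 * Real.log (1 / δ)) := by
          gcongr
          linarith
      _ = 1024 * σ ^ 2 * (d / c ^ 2 * Real.log (1 / δ)) * 1 := by
          ring
      _ ≤ 1024 * σ ^ 2 * (d / c ^ 2 * Real.log (1 / δ)) * (γ * (2 * Real.log N)) := by gcongr
      _ = _ := by ring
  rw [add_mul (384 * κ)]
  exact add_le_add h8 h10

end Guarantees

end ConvexSim

theorem mainTheorem10 (σ τ : ℝ≥0) (hσ : 0 < σ) (hτ : 0 < τ) :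
    ∃ κ₀ : ℝ, 0 < κ₀ ∧ ∀ κ θ : ℝ, κ₀ ≤ κ → 0 < θ → ∃ C : ℝ, 0 < C ∧
      ∀ (d N : ℕ) [Fact (2 ≤ N)], 1 ≤ d → ∀ L B : ℝ,
        (∀ ε : ℝ, 0 < ε → ∃ δ₀ : ℝ, 0 < δ₀ ∧ ∀ δ : ℝ, 0 < δ → δ < δ₀ → ∀ γ : ℝ, 1 ≤ γ →
          ∀ (T : ℕ) (M step bound : ℝ),
            T = numIter κ d N ε δ →
            M = truncThreshold θ d N ε T →
            step = stepSize N M T →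
            bound = C * (γ * d * N ^ 2 / ε ^ 2 * Real.log (1 / δ)) →
            IsAlgorithmFor (PGS ε δ) (modelsMC.{u} d N σ τ L B) γ (ssgdPGS σ ε δ T M step) ∧
            CostAtMost (modelsMC.{u} d N σ τ L B) γ (ssgdPGS σ ε δ T M step) bound ∧
            expectedSimulationCost (PGS ε δ) (modelsMC.{u} d N σ τ L B) γ ≤
              ENNReal.ofReal bound) ∧
        (∀ c : ℝ, 0 < c → ∃ δ₀ : ℝ, 0 < δ₀ ∧ ∀ δ : ℝ, 0 < δ → δ < δ₀ → ∀ γ : ℝ, 1 ≤ γ →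
          ∀ bound : ℝ,
            bound = C * (γ * d * Real.log N / c ^ 2 * Real.log (1 / δ)) →
            IsAlgorithmFor (PCSIZ δ) (modelsMCc.{u} d N σ τ L B c) γ
              (adaptiveSSGD σ κ θ c δ) ∧
            CostAtMost (modelsMCc.{u} d N σ τ L B c) γ (adaptiveSSGD σ κ θ c δ) bound ∧
            expectedSimulationCost (PCSIZ δ) (modelsMCc.{u} d N σ τ L B c) γ ≤
              ENNReal.ofReal bound) := by
  have hσ' : (0 : ℝ) < σ := hσ
  have hτ' : (0 : ℝ) < τ := hτ
  refine ⟨128 * (τ : ℝ) ^ 2, by positivity, fun κ θ hκ hθ => ?_⟩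
  have hκ0 : 0 < κ := lt_of_lt_of_le (by positivity) hκ
  -- The constant is dictated by the adaptive method: `384 = 6 · 64` from `numEpochs_le` and the
  -- epoch length, `2048` from rounding with precision `c / 2` and `1 ≤ 2 log N`. It is more than
  -- enough for the other algorithm.
  refine ⟨384 * κ + 2048 * σ ^ 2, by positivity, fun d N _ hd L B => ⟨fun ε hε => ?_, fun c hc => ?_⟩⟩
  · obtain ⟨δ₀, hδ₀, h⟩ := exists_of_eventually_nhdsGT
      ((eventually_isAlgorithmFor_ssgdPGS.{u} (N := N) hσ hτ hκ hθ hd hε L B).and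
        (eventually_cost_ssgdPGS_le (σ := σ) (N := N) hσ hκ0 hd hε))
    refine ⟨δ₀, hδ₀, fun δ hδ hδ' γ hγ T M step bound hT hM hstep hbound => ?_⟩
    obtain ⟨h1, h2⟩ := h δ hδ hδ'
    subst hT hM hstep hbound
    exact cost_conclusion (h1 γ (by linarith)) (ssgdPGS_bounded (by linarith)) (h2 γ hγ)
  · obtain ⟨δ₀, hδ₀, h⟩ := exists_of_eventually_nhdsGT
      ((eventually_isAlgorithmFor_adaptiveSSGD.{u} (N := N) hσ hτ hκ hθ hd hc L B).and
        (eventually_cost_adaptiveSSGD_le (σ := σ) (N := N) hσ hκ0 hd hc))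
    refine ⟨δ₀, hδ₀, fun δ hδ hδ' γ hγ bound hbound => ?_⟩
    obtain ⟨h1, h2⟩ := h δ hδ hδ'
    subst hbound
    exact cost_conclusion (h1 γ (by linarith)) (adaptiveSSGD_bounded (by linarith)) (h2 γ hγ)
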